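/- Throughout, a polygon is a simple polygon in the plane, and edges without further qualification are polygon edges. Two vertices of a polygon $P$ are \emph{visible} if the closed segment joining them is contained in the closed polygon; a vertex $u$ and an edge $e$ of $P$ are \emph{visible} if some closed segment joining $u$ to a point of the relatively open edge $e$ is contained in the closed polygon. $P$ is in \emph{general position} if, for any two visible vertices that are not adjacent on the boundary, the open segment joining them is contained in the open polygon. The \emph{visibility graph} of $P$ joins every two visible vertices by the open segment between them, and $P$ is \emph{deflated} if no two distinct edges of its visibility graph intersect. A \emph{deformation} of $P$ is a family $(P^t)_{t\in[0,1]}$ of simple polygons with $P^0=P$ whose vertices $v^t$ depend continuously on $t$ (vertices being joined by edges in $P^t$ as in $P$); it is \emph{monotonic} if there are no vertices $u,v$ and times $s<t$ such that $u^t,v^t$ are visible in $P^t$ but $u^s,v^s$ are not visible in $P^s$. $P$ is \emph{deflatable} if it has a monotonic deformation for which $P^1$ is deflated. The \emph{directed dual} of a triangulation $T$ of a polygon is the partially directed plane tree with a triangle node for each triangle of $T$ and a terminal node for each polygon edge, two nodes being adjacent if the corresponding objects share an edge; the neighbours of a triangle node have the counter-clockwise cyclic order of the corresponding edges of the triangle.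 An edge between the nodes of two adjacent triangles $a,b$ is directed $a\to b$ exactly when $(a,b)$ is \emph{right-reflex}, that is, when the quadrilateral $a\cup b$ has a reflex vertex on the right-hand side of a single-segment path from $a$ to $b$ inside the open quadrilateral. The directed dual of a deflated polygon is that of its (unique) triangulation. A \emph{compatible directed dual} of a polygon $P$ in general position is the directed dual of a deflated polygon $P'$ for which there is a bijection between the vertices of $P$ and those of $P'$, carrying a counter-clockwise walk along the boundary of $P$ to a counter-clockwise walk along the boundary of $P'$, such that a vertex-vertex or vertex-edge pair is visible in $P'$ only if the corresponding pair is visible in $P$. \textbf{Theorem.} A polygon $P$ in general position that has no compatible directed dual is not deflatable. -/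

import Mathlib

/-- The plane, in coordinates. (Only its affine structure, its topology and its orientation
are used.) -/
abbrev Plane : Type := ℝ × ℝ

/-- Twice the signed area of the triangle `a b c`; it is positive iff `(a, b, c)` is a left turn,
i.e. iff `a, b, c` are the corners of a nondegenerate triangle in counter-clockwise order. -/
def orient (a b c : Plane) : ℝ :=
  (b.1 - a.1) * (c.2 - a.2) - (b.2 - a.2) * (c.1 - a.1)

/-- A closed polygonal chain is simple if it has at least three vertices, these are distinct, and
two distinct (closed) edges meet only in common endpoints. -/
structure Polygon.IsSimple {n : ℕ} (P : Polygon Plane n) : Prop where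
  three_le : 3 ≤ n
  injective : Function.Injective P.vertices
  edges : ∀ i j : Fin n, i ≠ j →
    P.edgeSet ℝ i ∩ P.edgeSet ℝ j ⊆
      {P i, P (finRotate n i)} ∩ {P j, P (finRotate n j)}

/-- A simple polygon in the plane with `n` vertices. The vertices are indexed by `Fin n` in the
order of a walk along the boundary (clockwise or counter-clockwise); the edges join the vertices
`i` and `finRotate n i`, the cyclic successor of `i`. -/
structure SimplePolygon (n : ℕ) extends Polygon Plane n where
  isSimple : toPolygon.IsSimple

namespace SimplePolygon

variable {n : ℕ}

instance : CoeFun (SimplePolygon n) (fun _ => Fin n → Plane) where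
  coe P := P.vertices

/-- The boundary of the polygon: the union of its closed edges. -/
def boundary (P : SimplePolygon n) : Set Plane := P.toPolygon.boundary ℝ

/-- The open polygon: the points off the boundary that lie in a bounded connected component of
the complement of the boundary. -/
def openRegion (P : SimplePolygon n) : Set Plane :=
  {x | x ∉ P.boundary ∧ Bornology.IsBounded (connectedComponentIn P.boundaryᶜ x)}

/-- The closed polygon. -/
def closedRegion (P : SimplePolygon n) : Set Plane := P.boundary ∪ P.openRegion

/-! ### Visibility -/

/-- The vertices `u` and `v` see each other. -/
def Visible (P : SimplePolygon n) (u v : Fin n) : Prop :=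
  segment ℝ (P u) (P v) ⊆ P.closedRegion

/-- The vertex `u` and the edge with endpoints `a` and `b` see each other: a closed segment
contained in the closed polygon joins `u` to a point of the (relatively open) edge. -/
def SeesEdge (P : SimplePolygon n) (u a b : Fin n) : Prop :=
  ∃ q ∈ openSegment ℝ (P a) (P b), segment ℝ (P u) q ⊆ P.closedRegion

/-- General position: the open segment joining any visible pair of vertices that are not the two
endpoints of a polygon edge is contained in the open polygon. -/
def InGeneralPosition (P : SimplePolygon n) : Prop :=
  ∀ u v : Fin n, u ≠ v → v ≠ finRotate n u → u ≠ finRotate n v → P.Visible u v →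
    openSegment ℝ (P u) (P v) ⊆ P.openRegion

/-- The visibility graph; its edges are drawn as straight open segments. -/
def visibilityGraph (P : SimplePolygon n) : SimpleGraph (Fin n) where
  Adj u v := u ≠ v ∧ P.Visible u v
  symm := ⟨fun u v h => ⟨h.1.symm, by
    have h2 := h.2
    unfold Visible at h2 ⊢
    rwa [segment_symm]⟩⟩
  loopless := ⟨fun _ h => h.1 rfl⟩

/-- A polygon is deflated if no two edges of its visibility graph intersect. -/
def IsDeflated (P : SimplePolygon n) : Prop :=
  ∀ u v x y : Fin n, P.visibilityGraph.Adj u v → P.visibilityGraph.Adj x y →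
    s(u, v) ≠ s(x, y) →
    Disjoint (openSegment ℝ (P u) (P v)) (openSegment ℝ (P x) (P y))

/-! ### Deformations -/

/-- A deformation of `P`: a continuous motion of the vertices during the time interval `[0, 1]`
that starts at `P` and keeps the polygon simple. -/
structure Deformation (P : SimplePolygon n) where
  polygonAt : unitInterval → SimplePolygon n
  continuous : ∀ v : Fin n, Continuous fun t => polygonAt t v
  start : polygonAt 0 = P

/-- A deformation is monotonic if no two vertices ever become visible. -/
def Deformation.IsMonotonic {P : SimplePolygon n} (M : P.Deformation) : Prop :=
  ¬ ∃ (u v : Fin n) (s t : unitInterval), s < t ∧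
    (M.polygonAt t).Visible u v ∧ ¬ (M.polygonAt s).Visible u v

/-- `P` is deflatable if some monotonic deformation of `P` ends in a deflated polygon. -/
def IsDeflatable (P : SimplePolygon n) : Prop :=
  ∃ M : P.Deformation, M.IsMonotonic ∧ (M.polygonAt 1).IsDeflated

/-! ### Orientation -/

/-- The signed area enclosed by the polygon (shoelace formula). It is positive iff the
enumeration of the vertices is a counter-clockwise walk along the boundary. -/
noncomputable def signedArea (P : SimplePolygon n) : ℝ :=
  (1 / 2) * ∑ i : Fin n, ((P i).1 * (P (finRotate n i)).2 - (P (finRotate n i)).1 * (P i).2)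

open Classical in
/-- The vertex that follows `u` in a counter-clockwise walk along the boundary. -/
noncomputable def ccwNext (P : SimplePolygon n) (u : Fin n) : Fin n :=
  if 0 < P.signedArea then finRotate n u else (finRotate n).symm u

/-- The bijection `σ` from the vertices of `P` to those of `P'` preserves order and chirality:
a counter-clockwise walk along the boundary of `P` corresponds to one along that of `P'`. -/
def PreservesOrderAndChirality (P P' : SimplePolygon n) (σ : Fin n ≃ Fin n) : Prop :=
  ∀ u : Fin n, σ (P.ccwNext u) = P'.ccwNext (σ u)

/-! ### Triangulations -/

/-- A triangulation of `P`: a partition of the closed polygon into (nondegenerate, closed)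
triangles with disjoint interiors whose corners are vertices of `P`. A triangle is given by the
set of its corners. -/
structure Triangulation (P : SimplePolygon n) where
  triangles : Finset (Finset (Fin n))
  isTriangle : ∀ t ∈ triangles, ∃ i j k : Fin n, t = {i, j, k} ∧ 0 < orient (P i) (P j) (P k)
  disjoint : ∀ s ∈ triangles, ∀ t ∈ triangles, s ≠ t →
    Disjoint (interior (convexHull ℝ (P.vertices '' (s : Set (Fin n)))))
      (interior (convexHull ℝ (P.vertices '' (t : Set (Fin n)))))
  cover : (⋃ t ∈ triangles, convexHull ℝ (P.vertices '' (t : Set (Fin n)))) = P.closedRegion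

end SimplePolygon

/-- A partially directed plane tree. The embedding in the plane is recorded, up to deformation,
by the counter-clockwise cyclic order of the neighbours of each node: `rot x` maps every
neighbour of `x` to the next one in counter-clockwise order about `x`. The relation `arc x y`
says that the edge joining `x` and `y` is directed `x → y`. -/
structure PartiallyDirectedPlaneTree where
  Node : Type
  finite : Finite Node
  graph : SimpleGraph Node
  isTree : graph.IsTree
  rot : (x : Node) → Equiv.Perm (graph.neighborSet x)
  rot_cyclic : ∀ x : Node, (rot x).IsCycleOn Set.univ
  arc : Node → Node → Prop
  arc_adj : ∀ x y : Node, arc x y → graph.Adj x y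
  arc_asymm : ∀ x y : Node, arc x y → ¬ arc y x

namespace SimplePolygon

variable {n : ℕ}

namespace Triangulation

variable {P : SimplePolygon n}

/-- The nodes of the dual: a triangle node for each triangle and a terminal node for each polygon
edge, the terminal node `i` standing for the edge that joins `i` and `finRotate n i`. -/
abbrev DualNode (T : P.Triangulation) : Type := {t : Finset (Fin n) // t ∈ T.triangles} ⊕ Fin n

/-- The edges (as pairs of vertices) of the triangle, or the polygon edge, that corresponds to a
node of the dual. -/
def nodeEdges (T : P.Triangulation) : T.DualNode → Set (Sym2 (Fin n))
  | Sum.inl t => {e | ¬ e.IsDiag ∧ ∀ v ∈ e, v ∈ t.1}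
  | Sum.inr i => {s(i, finRotate n i)}

/-- The pair `(a, b)` of adjacent triangles is right-reflex. The triangles share the edge `v w`
and have opposite corners `p` and `q`. On a path from `a` to `b` that crosses this edge, `v` is
on the right, since `p, v, w` and `q, w, v` are in counter-clockwise order; and `v` is a reflex
vertex of the quadrilateral `p v q w` (listed in counter-clockwise order), since the turn at `v`
is a right turn. -/
def RightReflex (_T : P.Triangulation) (a b : Finset (Fin n)) : Prop :=
  ∃ p v w q : Fin n, a = {p, v, w} ∧ b = {q, w, v} ∧
    0 < orient (P p) (P v) (P w) ∧ 0 < orient (P q) (P w) (P v) ∧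
    orient (P p) (P v) (P q) < 0

/-- `D` is (up to isomorphism of partially directed plane trees) the directed dual of `T`. -/
def IsDirectedDual (T : P.Triangulation) (D : PartiallyDirectedPlaneTree) : Prop :=
  ∃ φ : T.DualNode ≃ D.Node,
    -- two nodes are adjacent iff their correspondents share an edge
    (∀ x y : T.DualNode, D.graph.Adj (φ x) (φ y) ↔
      x ≠ y ∧ (T.nodeEdges x ∩ T.nodeEdges y).Nonempty) ∧
    -- if `i j` and `j k` are consecutive edges of a triangle `a` in counter-clockwise order, then
    -- the neighbour across `j k` follows the neighbour across `i j` in the order about `a`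
    (∀ (a : {t : Finset (Fin n) // t ∈ T.triangles}) (i j k : Fin n) (x y : T.DualNode)
      (hx : D.graph.Adj (φ (Sum.inl a)) (φ x)) (hy : D.graph.Adj (φ (Sum.inl a)) (φ y)),
      a.1 = {i, j, k} → 0 < orient (P i) (P j) (P k) →
      s(i, j) ∈ T.nodeEdges x → s(j, k) ∈ T.nodeEdges y →
      D.rot (φ (Sum.inl a)) ⟨φ x, hx⟩ = ⟨φ y, hy⟩) ∧
    -- exactly the right-reflex pairs of adjacent triangles are directed
    (∀ x y : T.DualNode, D.arc (φ x) (φ y) ↔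
      ∃ a b : {t : Finset (Fin n) // t ∈ T.triangles},
        x = Sum.inl a ∧ y = Sum.inl b ∧ T.RightReflex a.1 b.1)

end Triangulation

/-- `D` is a compatible directed dual of `P`: it is the directed dual of (the triangulation of) a
deflated polygon `P'` such that, under an order- and chirality-preserving bijection `σ` of the
vertices, a vertex-vertex or vertex-edge pair is visible in `P'` only if its correspondent is
visible in `P`. -/
def IsCompatibleDirectedDual (P : SimplePolygon n) (D : PartiallyDirectedPlaneTree) : Prop :=
  ∃ P' : SimplePolygon n, P'.IsDeflated ∧
    (∃ T : P'.Triangulation, T.IsDirectedDual D) ∧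
    ∃ σ : Fin n ≃ Fin n, P.PreservesOrderAndChirality P' σ ∧
      (∀ u v : Fin n, P'.Visible (σ u) (σ v) → P.Visible u v) ∧
      (∀ u i : Fin n, P'.SeesEdge (σ u) (σ i) (σ (finRotate n i)) →
        P.SeesEdge u i (finRotate n i))

end SimplePolygon

open Filter Topology

/-! ### Plane geometry -/

/-- The cross product of two plane vectors. -/
def cross (a b : Plane) : ℝ := a.1 * b.2 - a.2 * b.1

/-- The dot product of two plane vectors. -/
def dotp (a b : Plane) : ℝ := a.1 * b.1 + a.2 * b.2

lemma orient_eq_cross (a b c : Plane) : orient a b c = cross (b - a) (c - a) := rfl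

lemma orient_rotate (a b c : Plane) : orient b c a = orient a b c := by
  unfold orient; ring

lemma orient_swap (a b c : Plane) : orient b a c = -orient a b c := by
  unfold orient; ring

lemma orient_comb (a b x y : Plane) {s t : ℝ} (h : s + t = 1) :
    orient a b (s • x + t • y) = s * orient a b x + t * orient a b y := by
  obtain rfl : s = 1 - t := by linarith
  simp [orient]; ring

lemma orient_self_left (a b : Plane) : orient a b a = 0 := by unfold orient; ring

lemma orient_self_right (a b : Plane) : orient a b b = 0 := by unfold orient; ring

lemma orient_same (a b : Plane) : orient a a b = 0 := by unfold orient; ring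

lemma continuous_orient (a b : Plane) : Continuous (orient a b) := by
  unfold orient; fun_prop

lemma dotp_self_pos {v : Plane} (h : v ≠ 0) : 0 < dotp v v := by
  have : v.1 ≠ 0 ∨ v.2 ≠ 0 := by
    by_contra! hh
    exact h (Prod.ext hh.1 hh.2)
  unfold dotp
  rcases this with h | h
  · nlinarith [mul_self_pos.mpr h, mul_self_nonneg v.2]
  · nlinarith [mul_self_pos.mpr h, mul_self_nonneg v.1]

/-- Two parallel vectors, the first nonzero, are proportional. -/
lemma exists_smul_of_cross_eq_zero {v w : Plane} (hv : v ≠ 0) (h : cross v w = 0) :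
    ∃ k : ℝ, w = k • v := by
  have hp := dotp_self_pos hv
  refine ⟨dotp v w / dotp v v, ?_⟩
  unfold cross at h
  unfold dotp at *
  have hp' := hp.ne'
  ext
  · rw [Prod.smul_fst, smul_eq_mul, div_mul_eq_mul_div, eq_div_iff hp']
    linear_combination (-v.2) * h
  · rw [Prod.smul_snd, smul_eq_mul, div_mul_eq_mul_div, eq_div_iff hp']
    linear_combination (v.1) * h

lemma mem_segment_of_cross_dotp {x a b : Plane} (hc : cross (a - x) (b - x) = 0)
    (hd : dotp (a - x) (b - x) ≤ 0) : x ∈ segment ℝ a b := by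
  by_cases ha : a = x
  · subst ha; exact left_mem_segment ℝ _ _
  have hA : a - x ≠ 0 := sub_ne_zero.mpr ha
  obtain ⟨k, hk⟩ := exists_smul_of_cross_eq_zero hA hc
  have hp := dotp_self_pos hA
  have hk0 : k ≤ 0 := by
    rw [hk] at hd
    by_contra! hpos
    have : dotp (a - x) (k • (a - x)) = k * dotp (a - x) (a - x) := by
      simp [dotp]; ring
    rw [this] at hd
    nlinarith
  -- These weights come from solving `b - x = k • (a - x)` for `x`; they are nonnegative because `k
  -- ≤ 0`.
  refine ⟨-k / (1 - k), 1 / (1 - k), by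
    apply div_nonneg <;> linarith, by apply div_nonneg <;> linarith, by
    rw [← add_div]; rw [div_eq_one_iff_eq] <;> linarith, ?_⟩
  have h1 : (1 - k) ≠ 0 := by linarith
  have e1 := congrArg Prod.fst hk
  have e2 := congrArg Prod.snd hk
  simp at e1 e2
  ext
  · simp; field_simp; linarith
  · simp; field_simp; linarith

/-- Collinear points with `x` at a segment's line: the point with coordinate in `[0, 1]`. -/
lemma mem_segment_iff_smul {x a b : Plane} :
    x ∈ segment ℝ a b ↔ ∃ t : ℝ, 0 ≤ t ∧ t ≤ 1 ∧ x = a + t • (b - a) := by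
  rw [segment_eq_image']
  constructor
  · rintro ⟨t, ⟨h0, h1⟩, rfl⟩; exact ⟨t, h0, h1, rfl⟩
  · rintro ⟨t, h0, h1, rfl⟩; exact ⟨t, ⟨h0, h1⟩, rfl⟩

lemma mem_openSegment_iff_smul {x a b : Plane} :
    x ∈ openSegment ℝ a b ↔ ∃ t : ℝ, 0 < t ∧ t < 1 ∧ x = a + t • (b - a) := by
  rw [openSegment_eq_image']
  constructor
  · rintro ⟨t, ⟨h0, h1⟩, rfl⟩; exact ⟨t, h0, h1, rfl⟩
  · rintro ⟨t, h0, h1, rfl⟩; exact ⟨t, ⟨h0, h1⟩, rfl⟩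

lemma orient_of_mem_segment {a b x : Plane} (h : x ∈ segment ℝ a b) : orient a b x = 0 := by
  obtain ⟨t, -, -, rfl⟩ := mem_segment_iff_smul.mp h
  simp [orient]; ring

/-! ### Angles -/

/-- The signed angle at `x` from `a` to `b`. -/
noncomputable def ang (x a b : Plane) : ℝ :=
  Complex.arg ⟨dotp (a - x) (b - x), cross (a - x) (b - x)⟩

/-- The cut of `Complex.arg` is reached only if `a` and `b` appear from `x` in opposite directions,
or if `x` is one of them. Hence the angle at `x` is continuous off the segment. -/
lemma mem_slitPlane_of_notMem_segment {x a b : Plane} (h : x ∉ segment ℝ a b) :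
    (⟨dotp (a - x) (b - x), cross (a - x) (b - x)⟩ : ℂ) ∈ Complex.slitPlane := by
  rw [Complex.mem_slitPlane_iff]
  by_contra! hh
  exact h (mem_segment_of_cross_dotp hh.2 hh.1)

lemma continuous_angArg (a b : Plane) : Continuous fun x : Plane =>
    (⟨dotp (a - x) (b - x), cross (a - x) (b - x)⟩ : ℂ) := by
  have : (fun x : Plane => (⟨dotp (a - x) (b - x), cross (a - x) (b - x)⟩ : ℂ)) =
      fun x => (dotp (a - x) (b - x) : ℂ) + (cross (a - x) (b - x) : ℂ) * Complex.I := by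
    ext x
    apply Complex.ext <;> simp
  rw [this]
  unfold dotp cross
  fun_prop

lemma continuousAt_ang {x a b : Plane} (h : x ∉ segment ℝ a b) :
    ContinuousAt (fun x => ang x a b) x :=
  ContinuousAt.comp (g := Complex.arg)
    (f := fun x : Plane => (⟨dotp (a - x) (b - x), cross (a - x) (b - x)⟩ : ℂ))
    (Complex.continuousAt_arg (mem_slitPlane_of_notMem_segment h))
    (continuous_angArg a b).continuousAt

/-- Exchanging `a` and `b` conjugates the complex number. This negates its argument except at the
value `π`, which does not occur off the segment. -/
lemma ang_swap {x a b : Plane} (h : x ∉ segment ℝ a b) : ang x b a = -ang x a b := by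
  have hs := mem_slitPlane_of_notMem_segment h
  have e : (⟨dotp (b - x) (a - x), cross (b - x) (a - x)⟩ : ℂ) =
      (starRingEnd ℂ) ⟨dotp (a - x) (b - x), cross (a - x) (b - x)⟩ := by
    apply Complex.ext
    · simp [dotp]; ring
    · simp [cross]; ring
  unfold ang
  rw [e, Complex.arg_conj, if_neg (Complex.mem_slitPlane_iff_arg.mp hs).1]

lemma ang_pos {x a b : Plane} (h : 0 < orient a b x) : 0 < ang x a b ∧ ang x a b < Real.pi := by
  have hc : 0 < (⟨dotp (a - x) (b - x), cross (a - x) (b - x)⟩ : ℂ).im := by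
    have : cross (a - x) (b - x) = orient a b x := by simp [cross, orient]; ring
    simpa [this] using h
  refine ⟨?_, ?_⟩
  · refine lt_of_le_of_ne (Complex.arg_nonneg_iff.mpr hc.le) fun h0 => ?_
    have := (Complex.arg_eq_zero_iff.mp h0.symm).2
    exact hc.ne' this
  · refine lt_of_le_of_ne (Complex.arg_le_pi _) fun h0 => ?_
    exact hc.ne' (Complex.arg_eq_pi_iff.mp h0).2

/-- If all the points are seen from `x` in an open half-plane, the angle is a difference of
directions. -/
lemma ang_eq_sub {x a b u : Plane} (ha : 0 < dotp u (a - x)) (hb : 0 < dotp u (b - x)) :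
    ang x a b = Complex.arg ⟨dotp u (b - x), cross u (b - x)⟩ -
      Complex.arg ⟨dotp u (a - x), cross u (a - x)⟩ := by
  have hu : 0 < dotp u u := by
    apply dotp_self_pos
    rintro rfl
    simp [dotp] at ha
  set A : ℂ := ⟨dotp u (a - x), cross u (a - x)⟩ with hA
  set B : ℂ := ⟨dotp u (b - x), cross u (b - x)⟩ with hB
  have hA0 : A ≠ 0 := fun h => ha.ne' (congrArg Complex.re h)
  have hB0 : B ≠ 0 := fun h => hb.ne' (congrArg Complex.re h)
  -- `A` and `B` are `a - x` and `b - x` in the frame given by `u`. Both lie in the right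
  -- half-plane, so the arguments of the conjugate of `A` and of `B` add up without wrapping around.
  have e : (dotp u u : ℂ) * (⟨dotp (a - x) (b - x), cross (a - x) (b - x)⟩ : ℂ) =
      (starRingEnd ℂ) A * B := by
    apply Complex.ext
    · simp [hA, hB, dotp, cross]; ring
    · simp [hA, hB, dotp, cross]; ring
  have hAs : Complex.arg A ∈ Set.Ioo (-(Real.pi / 2)) (Real.pi / 2) := by
    have := Complex.abs_arg_lt_pi_div_two_iff.mpr (Or.inl (show 0 < A.re from ha))
    exact ⟨(abs_lt.mp this).1, (abs_lt.mp this).2⟩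
  have hBs : Complex.arg B ∈ Set.Ioo (-(Real.pi / 2)) (Real.pi / 2) := by
    have := Complex.abs_arg_lt_pi_div_two_iff.mpr (Or.inl (show 0 < B.re from hb))
    exact ⟨(abs_lt.mp this).1, (abs_lt.mp this).2⟩
  have hcA : ((starRingEnd ℂ) A).arg = -A.arg := by
    rw [Complex.arg_conj, if_neg]
    have := hAs.2; have := Real.pi_pos; intro h; linarith
  unfold ang
  rw [← Complex.arg_real_mul _ hu, e, Complex.arg_mul (by simpa using hA0) hB0, hcA]
  · ring
  · rw [hcA]
    constructor <;> linarith [hAs.1, hAs.2, hBs.1, hBs.2, Real.pi_pos]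

/-- The total angle swept, as seen from `x`, by the closed polygonal chain `p 0, …, p m`. -/
noncomputable def tot (p : ℕ → Plane) (m : ℕ) (x : Plane) : ℝ :=
  ∑ k ∈ Finset.range m, ang x (p k) (p (k + 1))

/-- Twice the signed area of the closed polygonal chain `p 0, …, p m`. -/
def area2 (p : ℕ → Plane) (m : ℕ) : ℝ :=
  ∑ k ∈ Finset.range m, cross (p k) (p (k + 1))

/-- A chain that lies in an open half-plane with `x` on its border cannot wind around `x`: the
angles are differences of directions, and their sum telescopes. -/
lemma tot_eq_zero_of_halfplane {p : ℕ → Plane} {m : ℕ} {x u : Plane} (hp : p m = p 0)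
    (h : ∀ k, k ≤ m → 0 < dotp u (p k - x)) : tot p m x = 0 := by
  unfold tot
  have hs := Finset.sum_range_sub
    (fun k => Complex.arg ⟨dotp u (p k - x), cross u (p k - x)⟩) m
  rw [hp, sub_self] at hs
  rw [← hs]
  apply Finset.sum_congr rfl
  · intro k hk
    have := Finset.mem_range.mp hk
    exact ang_eq_sub (h k (by omega)) (h (k + 1) (by omega))

/-- The angles up to `p n` rotate the direction of `p 0` into that of `p n`. For a closed chain the
total rotation is the identity. -/
lemma tot_int {p : ℕ → Plane} {m : ℕ} {x : Plane} (hp : p m = p 0) (hx : ∀ k, p k ≠ x) :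
    ∃ N : ℤ, tot p m x = N * (2 * Real.pi) := by
  let A : ℕ → ℂ := fun k => ⟨(p k - x).1, (p k - x).2⟩
  have hA : ∀ k, A k ≠ 0 := by
    intro k h
    apply hx k
    have h1 := congrArg Complex.re h
    have h2 := congrArg Complex.im h
    simp [A] at h1 h2
    exact Prod.ext (by linarith) (by linarith)
  have hz : ∀ k, (⟨dotp (p k - x) (p (k+1) - x), cross (p k - x) (p (k+1) - x)⟩ : ℂ) =
      (starRingEnd ℂ) (A k) * A (k + 1) := by
    intro k
    apply Complex.ext
    · simp [A, dotp]; ring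
    · simp [A, cross]; ring
  have hn : ∀ k, (‖A k‖ : ℂ) ≠ 0 := fun k => by exact_mod_cast norm_ne_zero_iff.mpr (hA k)
  -- The rotation property of the partial sums, with the norms multiplied out.
  have key : ∀ n, Complex.exp (tot p n x * Complex.I) * A 0 * ‖A n‖ = A n * ‖A 0‖ := by
    intro n
    induction n with
    | zero => simp [tot]
    | succ n ih =>
      have e1 : tot p (n+1) x = tot p n x + ang x (p n) (p (n+1)) := by
        simp [tot, Finset.sum_range_succ]
      have e2 := Complex.norm_mul_exp_arg_mul_I ((starRingEnd ℂ) (A n) * A (n + 1))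
      rw [← hz n] at e2
      change _ * Complex.exp (ang x (p n) (p (n+1)) * Complex.I) = _ at e2
      rw [hz n, norm_mul, RCLike.norm_conj] at e2
      have e3 : (starRingEnd ℂ) (A n) * A n = (‖A n‖ : ℂ) ^ 2 := by
        rw [← Complex.normSq_eq_conj_mul_self, Complex.normSq_eq_norm_sq]; push_cast; rfl
      rw [e1]
      push_cast at e2 ⊢
      rw [add_mul, Complex.exp_add]
      apply mul_left_cancel₀ (pow_ne_zero 2 (hn n))
      linear_combination ‖A n‖ * ‖A (n+1)‖ *
        Complex.exp (ang x (p n) (p (n+1)) * Complex.I) * ih + A n * ‖A 0‖ * e2 +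
        A (n+1) * ‖A 0‖ * e3
  have hm : A m = A 0 := by simp [A, hp]
  have h1 : Complex.exp (tot p m x * Complex.I) = 1 := by
    have := key m
    rw [hm, mul_assoc] at this
    exact (mul_eq_right₀ (mul_ne_zero (hA 0) (hn 0))).mp this
  obtain ⟨N, hN⟩ := Complex.exp_eq_one_iff.mp h1
  refine ⟨N, ?_⟩
  have := congrArg Complex.im hN
  simpa using this


/-! ### Regions -/

/-- The points off `B` that lie in a bounded component of the complement of `B`. -/
def opn (B : Set Plane) : Set Plane :=
  {x | x ∉ B ∧ Bornology.IsBounded (connectedComponentIn Bᶜ x)}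

/-- The union of `B` and the bounded components of its complement. -/
def cls (B : Set Plane) : Set Plane := B ∪ opn B

lemma convex_orient_pos (a b : Plane) : Convex ℝ {y | 0 < orient a b y} := by
  intro x hx y hy s t hs ht hst
  simp only [Set.mem_ofPred_eq] at *
  rw [orient_comb _ _ _ _ hst]
  rcases hs.eq_or_lt with rfl | hs
  · obtain rfl : t = 1 := by linarith
    simpa using hy
  · nlinarith [mul_pos hs hx, mul_nonneg ht hy.le]

lemma convex_orient_neg (a b : Plane) : Convex ℝ {y | orient a b y < 0} := by
  have : {y | orient a b y < 0} = {y | 0 < orient b a y} := by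
    ext y; simp [orient_swap a b y]
  rw [this]; exact convex_orient_pos b a

lemma orient_add_smul (a b z d : Plane) (t : ℝ) :
    orient a b (z + t • d) = orient a b z + t * cross (b - a) d := by
  simp [orient, cross]; ring

/-- At a left turn the sum of the two legs points into the angle; at a straight angle the left
normal does. -/
lemma exists_inner_direction {a w b : Plane} (hb : b ≠ w)
    (h : 0 < orient a w b ∨ ∃ k < (0:ℝ), a - w = k • (b - w)) :
    ∃ d, 0 < cross (w - a) d ∧ 0 < cross (b - w) d := by
  rcases h with h | ⟨k, hk, h⟩
  · refine ⟨(a - w) + (b - w), ?_, ?_⟩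
    · convert h using 1; simp [cross, orient]; ring
    · convert h using 1; simp [cross, orient]; ring
  · have hp := dotp_self_pos (sub_ne_zero.mpr hb)
    refine ⟨(-(b - w).2, (b - w).1), ?_, ?_⟩
    · have h' : w - a = (-k) • (b - w) := by rw [neg_smul, ← h]; abel
      rw [h']
      have : cross (-k • (b - w)) (-(b - w).2, (b - w).1) = -k * dotp (b - w) (b - w) := by
        simp [cross, dotp]; ring
      rw [this]; exact mul_pos (by linarith) hp
    · convert hp using 1; simp [cross, dotp]; ring

lemma closure_of_direction {C : Set Plane} {z d : Plane} (h : ∀ᶠ t : ℝ in 𝓝[>] 0, z + t • d ∈ C) :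
    z ∈ closure C := by
  have ht : Tendsto (fun t : ℝ => z + t • d) (𝓝[>] 0) (𝓝 z) := by
    have : Tendsto (fun t : ℝ => z + t • d) (𝓝 0) (𝓝 (z + (0:ℝ) • d)) :=
      (Continuous.tendsto (by fun_prop) _)
    simp only [zero_smul, add_zero] at this
    exact this.mono_left nhdsWithin_le_nhds
  exact mem_closure_of_tendsto ht h

lemma eventually_ball {z d w : Plane} {r : ℝ} (hz : z ∈ Metric.ball w r) :
    ∀ᶠ t : ℝ in 𝓝[>] 0, z + t • d ∈ Metric.ball w r := by
  have : Tendsto (fun t : ℝ => z + t • d) (𝓝 0) (𝓝 (z + (0:ℝ) • d)) :=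
      (Continuous.tendsto (by fun_prop) _)
  simp only [zero_smul, add_zero] at this
  exact (this.eventually (Metric.isOpen_ball.mem_nhds hz)).filter_mono nhdsWithin_le_nhds

/-- The two legs divide the ball into a convex and a reflex sector, both connected and off `B`. A
component that comes near `w` contains one of them, and either sector is adherent to both legs, as a
push along `d` or `-d` shows. -/
lemma sector_closure_aux {B C : Set Plane} {a w b : Plane} {r : ℝ}
    (hB : B ∩ Metric.ball w r ⊆ segment ℝ a w ∪ segment ℝ w b)
    (hsub : segment ℝ a w ∪ segment ℝ w b ⊆ B) (ha : a ≠ w) (hb : b ≠ w)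
    (hra : r ≤ ‖a - w‖) (hrb : r ≤ ‖b - w‖)
    (h : 0 < orient a w b ∨ ∃ k < (0:ℝ), a - w = k • (b - w)) (hCB : C ⊆ Bᶜ)
    (hC : ∀ S : Set Plane, IsPreconnected S → S ⊆ Bᶜ → (S ∩ C).Nonempty → S ⊆ C)
    (hw : w ∈ closure C) (hr : 0 < r) : B ∩ Metric.ball w r ⊆ closure C := by
  obtain ⟨d, hd1, hd2⟩ := exists_inner_direction hb h
  have hab : 0 ≤ orient a w b := by
    rcases h with h | ⟨k, hk, h⟩
    · exact h.le
    · apply le_of_eq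
      have : orient a w b = -cross (a - w) (b - w) := by simp [cross, orient]; ring
      rw [this, h]; simp [cross]; ring
  have hwb : w ∈ Metric.ball w r := Metric.mem_ball_self hr
  -- values on the two rays
  have ray1 : ∀ z ∈ segment ℝ a w, orient a w z = 0 ∧ 0 ≤ orient w b z := by
    intro z hz
    refine ⟨orient_of_mem_segment hz, ?_⟩
    rw [segment_symm] at hz
    obtain ⟨t, h0, -, rfl⟩ := mem_segment_iff_smul.mp hz
    have : orient w b (w + t • (a - w)) = t * orient a w b := by
      simp [orient]; ring
    rw [this]; positivity
  have ray2 : ∀ z ∈ segment ℝ w b, orient w b z = 0 ∧ 0 ≤ orient a w z := by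
    intro z hz
    refine ⟨orient_of_mem_segment hz, ?_⟩
    obtain ⟨t, h0, -, rfl⟩ := mem_segment_iff_smul.mp hz
    have : orient a w (w + t • (b - w)) = t * orient a w b := by
      simp [orient]; ring
    rw [this]; positivity
  -- `Lam` is the convex sector. The reflex sector `Rho` is written as a union of two convex sets,
  -- which have a point on the ray in direction `-d` in common.
  set Lam : Set Plane := {y | 0 < orient a w y} ∩ {y | 0 < orient w b y} ∩ Metric.ball w r with hLam
  set Rho : Set Plane := ({y | orient a w y < 0} ∩ Metric.ball w r) ∪
    ({y | orient w b y < 0} ∩ Metric.ball w r) with hRho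
  have hLamB : Lam ⊆ Bᶜ := by
    rintro y ⟨⟨h1, h2⟩, h3⟩ hyB
    rcases hB ⟨hyB, h3⟩ with hy | hy
    · exact (ne_of_gt h1) (ray1 y hy).1
    · exact (ne_of_gt h2) (ray2 y hy).1
  have hRhoB : Rho ⊆ Bᶜ := by
    rintro y hy hyB
    have hyb : y ∈ Metric.ball w r := by rcases hy with hy | hy <;> exact hy.2
    rcases hB ⟨hyB, hyb⟩ with hy' | hy' <;> rcases hy with ⟨hy, -⟩ | ⟨hy, -⟩ <;>
      simp only [Set.mem_ofPred_eq] at hy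
    · linarith [(ray1 y hy').1]
    · linarith [(ray1 y hy').2]
    · linarith [(ray2 y hy').2]
    · linarith [(ray2 y hy').1]
  have hLamC : IsPreconnected Lam :=
    (((convex_orient_pos a w).inter (convex_orient_pos w b)).inter
      (convex_ball w r)).isPreconnected
  have hRhoC : IsPreconnected Rho := by
    obtain ⟨t, ht, htb⟩ := ((eventually_ball (d := -d) hwb).and self_mem_nhdsWithin).exists
    have htb' : 0 < t := htb
    apply IsPreconnected.union (w + t • -d)
    · refine ⟨?_, ht⟩
      simp only [Set.mem_ofPred_eq]
      rw [orient_add_smul, orient_self_right]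
      have : cross (w - a) (-d) = -cross (w - a) d := by simp [cross]; ring
      rw [this]; nlinarith
    · refine ⟨?_, ht⟩
      simp only [Set.mem_ofPred_eq]
      rw [orient_add_smul, orient_self_left]
      have : cross (b - w) (-d) = -cross (b - w) d := by simp [cross]; ring
      rw [this]; nlinarith
    · exact ((convex_orient_neg a w).inter (convex_ball w r)).isPreconnected
    · exact ((convex_orient_neg w b).inter (convex_ball w r)).isPreconnected
  -- a point of `C` near `w`
  obtain ⟨y, hyC, hyb⟩ : ∃ y ∈ C, y ∈ Metric.ball w r := by
    obtain ⟨y, hy1, hy2⟩ := mem_closure_iff.mp hw _ Metric.isOpen_ball hwb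
    exact ⟨y, hy2, hy1⟩
  have small : ∀ (s : ℝ) (v : Plane), r ≤ ‖v‖ → w + s • v ∈ Metric.ball w r → |s| < 1 := by
    intro s v hv hs
    rw [mem_ball_iff_norm, add_sub_cancel_left, norm_smul, Real.norm_eq_abs] at hs
    by_contra! hcon
    nlinarith [norm_nonneg v]
  -- A point of the ball in neither sector lies on a leg, since the radius does not exceed the
  -- lengths of the legs.
  have cover : y ∈ Lam ∪ Rho := by
    by_contra hcon
    simp only [hLam, hRho, Set.mem_union, Set.mem_inter_iff, Set.mem_ofPred_eq, hyb, and_true,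
      not_or, not_and_or, not_lt] at hcon
    obtain ⟨h1, h2, h3⟩ := hcon
    apply hCB hyC
    apply hsub
    rcases h1 with h1 | h1
    · have h1 := le_antisymm h1 h2
      have hcr : cross (a - w) (y - w) = 0 := by
        have : cross (a - w) (y - w) = -orient a w y := by simp [cross, orient]; ring
        rw [this, h1, neg_zero]
      obtain ⟨s, hs⟩ := exists_smul_of_cross_eq_zero (sub_ne_zero.mpr ha) hcr
      have hy : y = w + s • (a - w) := by rw [← hs]; abel
      have hs1 := small s _ hra (hy ▸ hyb)
      rcases le_or_gt 0 s with hs0 | hs0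
      · left
        rw [segment_symm]
        exact mem_segment_iff_smul.mpr ⟨s, hs0, (abs_lt.mp hs1).2.le, hy⟩
      · rcases h with h | ⟨k, hk, h⟩
        · exfalso
          have : orient w b y = s * orient a w b := by
            rw [hy]; simp [orient]; ring
          nlinarith
        · right
          rw [h, smul_smul] at hy
          have hs2 := small _ _ hrb (hy ▸ hyb)
          exact mem_segment_iff_smul.mpr ⟨s * k, by nlinarith, (abs_lt.mp hs2).2.le, hy⟩
    · have h1 := le_antisymm h1 h3
      have hcr : cross (b - w) (y - w) = 0 := by
        have : cross (b - w) (y - w) = orient w b y := by simp [cross, orient]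
        rw [this, h1]
      obtain ⟨s, hs⟩ := exists_smul_of_cross_eq_zero (sub_ne_zero.mpr hb) hcr
      have hy : y = w + s • (b - w) := by rw [← hs]; abel
      have hs1 := small s _ hrb (hy ▸ hyb)
      rcases le_or_gt 0 s with hs0 | hs0
      · right
        exact mem_segment_iff_smul.mpr ⟨s, hs0, (abs_lt.mp hs1).2.le, hy⟩
      · rcases h with h | ⟨k, hk, h⟩
        · exfalso
          have : orient a w y = s * orient a w b := by
            rw [hy]; simp [orient]; ring
          nlinarith
        · left
          have hb' : b - w = k⁻¹ • (a - w) := by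
            rw [h, smul_smul, inv_mul_cancel₀ hk.ne, one_smul]
          rw [hb', smul_smul] at hy
          have hs2 := small _ _ hra (hy ▸ hyb)
          rw [segment_symm]
          have := inv_lt_zero.mpr hk
          exact mem_segment_iff_smul.mpr ⟨s * k⁻¹, by nlinarith, (abs_lt.mp hs2).2.le, hy⟩
  rintro z ⟨hzB, hzb⟩
  have hz := hB ⟨hzB, hzb⟩
  have hz1 : 0 ≤ orient a w z := by
    rcases hz with hz | hz
    · exact (ray1 z hz).1.ge
    · exact (ray2 z hz).2
  have hz2 : 0 ≤ orient w b z := by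
    rcases hz with hz | hz
    · exact (ray1 z hz).2
    · exact (ray2 z hz).1.ge
  rcases cover with hy | hy
  · have hs := hC Lam hLamC hLamB ⟨y, hy, hyC⟩
    apply closure_of_direction (d := d)
    filter_upwards [eventually_ball (d := d) hzb, self_mem_nhdsWithin] with t ht ht0
    have ht0' : 0 < t := ht0
    apply hs
    refine ⟨⟨?_, ?_⟩, ht⟩
    · simp only [Set.mem_ofPred_eq]; rw [orient_add_smul]; nlinarith [mul_pos ht0' hd1]
    · simp only [Set.mem_ofPred_eq]; rw [orient_add_smul]; nlinarith [mul_pos ht0' hd2]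
  · have hs := hC Rho hRhoC hRhoB ⟨y, hy, hyC⟩
    apply closure_of_direction (d := -d)
    filter_upwards [eventually_ball (d := -d) hzb, self_mem_nhdsWithin] with t ht ht0
    have ht0' : 0 < t := ht0
    apply hs
    have e1 : cross (w - a) (-d) = -cross (w - a) d := by simp [cross]; ring
    have e2 : cross (b - w) (-d) = -cross (b - w) d := by simp [cross]; ring
    rcases hz with hz | hz
    · left
      refine ⟨?_, ht⟩
      simp only [Set.mem_ofPred_eq]
      rw [orient_add_smul, e1, (ray1 z hz).1]
      nlinarith [mul_pos ht0' hd1]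
    · right
      refine ⟨?_, ht⟩
      simp only [Set.mem_ofPred_eq]
      rw [orient_add_smul, e2, (ray2 z hz).1]
      nlinarith [mul_pos ht0' hd2]

/-- If near `w` the set `B` consists of two segments that leave `w` in different directions, then a
component of the complement of `B` that is adherent to `w` is adherent to all of `B` near `w`. -/
lemma sector_closure {B C : Set Plane} {a w b : Plane} {r : ℝ}
    (hB : B ∩ Metric.ball w r ⊆ segment ℝ a w ∪ segment ℝ w b)
    (hsub : segment ℝ a w ∪ segment ℝ w b ⊆ B) (ha : a ≠ w) (hb : b ≠ w)
    (hra : r ≤ ‖a - w‖) (hrb : r ≤ ‖b - w‖)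
    (h : orient a w b ≠ 0 ∨ ∃ k < (0:ℝ), a - w = k • (b - w)) (hCB : C ⊆ Bᶜ)
    (hC : ∀ S : Set Plane, IsPreconnected S → S ⊆ Bᶜ → (S ∩ C).Nonempty → S ⊆ C)
    (hw : w ∈ closure C) (hr : 0 < r) : B ∩ Metric.ball w r ⊆ closure C := by
  rcases h with h | h
  · rcases lt_or_gt_of_ne h with h | h
    · refine sector_closure_aux (a := b) (b := a) ?_ ?_ hb ha hrb hra (Or.inl ?_) hCB hC hw hr
      · rw [segment_symm ℝ b w, segment_symm ℝ w a, Set.union_comm]; exact hB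
      · rw [segment_symm ℝ b w, segment_symm ℝ w a, Set.union_comm]; exact hsub
      · have : orient b w a = -orient a w b := by unfold orient; ring
        linarith
    · exact sector_closure_aux hB hsub ha hb hra hrb (Or.inl h) hCB hC hw hr
  · exact sector_closure_aux hB hsub ha hb hra hrb (Or.inr h) hCB hC hw hr

/-! ### Closed polygonal chains -/

lemma isCompact_segment (a b : Plane) : IsCompact (segment ℝ a b) := by
  rw [segment_eq_image']
  exact isCompact_Icc.image (by fun_prop)

/-- The union of the edges of a closed polygonal chain. -/
def Bd (p : ℕ → Plane) : Set Plane := ⋃ k, segment ℝ (p k) (p (k + 1))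

/-- The simple closed polygonal chains with `m` vertices, as `m`-periodic sequences. -/
structure IsSimpleLoop (p : ℕ → Plane) (m : ℕ) : Prop where
  three_le : 3 ≤ m
  per : ∀ k, p (k + m) = p k
  inj : ∀ i j, p i = p j → i % m = j % m
  edges : ∀ i j z, z ∈ segment ℝ (p i) (p (i + 1)) → z ∈ segment ℝ (p j) (p (j + 1)) →
    p i = p j ∨ (z = p j ∧ p j = p (i + 1)) ∨ (z = p i ∧ p i = p (j + 1))

namespace IsSimpleLoop

variable {p : ℕ → Plane} {m : ℕ}

lemma per_mul (h : IsSimpleLoop p m) (k c : ℕ) : p (k + m * c) = p k := by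
  induction c with
  | zero => simp
  | succ c ih => rw [Nat.mul_succ, ← add_assoc, h.per, ih]

lemma mod_eq (h : IsSimpleLoop p m) (k : ℕ) : p (k % m) = p k := by
  conv_rhs => rw [← Nat.mod_add_div k m]
  rw [h.per_mul]

lemma eq_iff (h : IsSimpleLoop p m) {i j : ℕ} : p i = p j ↔ i % m = j % m :=
  ⟨h.inj i j, fun e => by rw [← h.mod_eq i, e, h.mod_eq j]⟩

/-- A shift of the numbering brings any chosen vertex or edge to the place where the later lemmas
need it: number 1 for a corner, the last edge for a base. -/
lemma shift (h : IsSimpleLoop p m) (s : ℕ) : IsSimpleLoop (fun k => p (k + s)) m where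
  three_le := h.three_le
  per k := by simpa [add_right_comm] using h.per (k + s)
  inj i j e := by
    have := h.inj _ _ e
    exact Nat.ModEq.add_right_cancel' s this
  edges i j z hi hj := by
    rw [add_right_comm] at hi hj
    simpa [add_right_comm] using h.edges (i + s) (j + s) z hi hj

lemma ne_succ (h : IsSimpleLoop p m) (k : ℕ) : p k ≠ p (k + 1) := by
  intro e
  have h3 := h.three_le
  have : k ≡ k + 1 [MOD m] := h.inj _ _ e
  have := (Nat.ModEq.add_left_cancel' k (show k + 0 ≡ k + 1 [MOD m] from this))
  rw [Nat.ModEq, Nat.zero_mod, Nat.mod_eq_of_lt (by omega)] at this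
  omega

lemma ne_succ2 (h : IsSimpleLoop p m) (k : ℕ) : p k ≠ p (k + 2) := by
  intro e
  have h3 := h.three_le
  have : k ≡ k + 2 [MOD m] := h.inj _ _ e
  have := (Nat.ModEq.add_left_cancel' k (show k + 0 ≡ k + 2 [MOD m] from this))
  rw [Nat.ModEq, Nat.zero_mod, Nat.mod_eq_of_lt (by omega)] at this
  omega

lemma edge_subset (p : ℕ → Plane) (k : ℕ) : segment ℝ (p k) (p (k + 1)) ⊆ Bd p :=
  Set.subset_iUnion (fun k => segment ℝ (p k) (p (k + 1))) k

lemma vertex_mem (p : ℕ → Plane) (k : ℕ) : p k ∈ Bd p :=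
  edge_subset p k (left_mem_segment ℝ _ _)

lemma mem_Bd {x : Plane} : x ∈ Bd p ↔ ∃ k, x ∈ segment ℝ (p k) (p (k + 1)) := by
  simp [Bd]

lemma edge_mod (h : IsSimpleLoop p m) (k : ℕ) :
    segment ℝ (p (k % m)) (p (k % m + 1)) = segment ℝ (p k) (p (k + 1)) := by
  rw [h.mod_eq, h.eq_iff.mpr (Nat.mod_add_mod k m 1)]

lemma mem_Bd_lt (h : IsSimpleLoop p m) {x : Plane} :
    x ∈ Bd p ↔ ∃ k < m, x ∈ segment ℝ (p k) (p (k + 1)) := by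
  rw [mem_Bd]
  constructor
  · rintro ⟨k, hk⟩
    exact ⟨k % m, Nat.mod_lt _ (by have := h.three_le; omega), by rwa [h.edge_mod]⟩
  · rintro ⟨k, -, hk⟩; exact ⟨k, hk⟩

lemma Bd_shift (h : IsSimpleLoop p m) (s : ℕ) : Bd (fun k => p (k + s)) = Bd p := by
  ext x
  rw [mem_Bd, mem_Bd]
  constructor
  · rintro ⟨k, hk⟩
    exact ⟨k + s, by simpa [add_right_comm] using hk⟩
  · rintro ⟨k, hk⟩
    have h3 := h.three_le
    -- Modulo `m`, adding `(m - 1) * s` is subtracting `s`.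
    refine ⟨k + (m - 1) * s, ?_⟩
    have e : k + (m - 1) * s + s = k + m * s := by
      obtain ⟨m, rfl⟩ : ∃ m', m = m' + 1 := ⟨m - 1, by omega⟩
      simp; ring
    have e' : k + (m - 1) * s + 1 + s = (k + 1) + m * s := by omega
    simp only [e, e', h.per_mul]
    exact hk

lemma isCompact_Bd (h : IsSimpleLoop p m) : IsCompact (Bd p) := by
  have : Bd p = ⋃ k ∈ Finset.range m, segment ℝ (p k) (p (k + 1)) := by
    ext x; rw [h.mem_Bd_lt]; simp
  rw [this]
  exact (Finset.range m).isCompact_biUnion fun k _ => isCompact_segment _ _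

lemma isPreconnected_Bd (p : ℕ → Plane) : IsPreconnected (Bd p) := by
  apply IsPreconnected.iUnion_of_chain
  · intro k; exact (convex_segment _ _).isPreconnected
  · intro k
    exact ⟨p (k + 1), right_mem_segment ℝ _ _, by
      rw [Order.succ_eq_add_one]; exact left_mem_segment ℝ _ _⟩

/-- The finitely many edges that miss `w` form a closed set, so a small ball about `w` meets only
edges through `w`. -/
lemma exists_ball (h : IsSimpleLoop p m) {w : Plane} {s : Set Plane}
    (hs : ∀ k, w ∈ segment ℝ (p k) (p (k + 1)) → segment ℝ (p k) (p (k + 1)) ⊆ s) :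
    ∃ r > 0, Bd p ∩ Metric.ball w r ⊆ s := by
  classical
  set K : Set Plane := ⋃ k ∈ (Finset.range m).filter
    (fun k => w ∉ segment ℝ (p k) (p (k + 1))), segment ℝ (p k) (p (k + 1)) with hK
  have hKc : IsClosed K := (Finset.isCompact_biUnion _ fun k _ => isCompact_segment _ _).isClosed
  have hwK : w ∈ Kᶜ := by
    intro hw
    simp only [hK, Set.mem_iUnion, Finset.mem_filter] at hw
    obtain ⟨k, ⟨-, h1⟩, h2⟩ := hw
    exact h1 h2
  obtain ⟨r, hr, hrK⟩ := Metric.isOpen_iff.mp hKc.isOpen_compl w hwK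
  refine ⟨r, hr, ?_⟩
  rintro z ⟨hz, hzb⟩
  obtain ⟨k, hk, hzk⟩ := h.mem_Bd_lt.mp hz
  apply hs k _ hzk
  by_contra hcon
  apply hrK hzb
  simp only [hK, Set.mem_iUnion, Finset.mem_filter, Finset.mem_range]
  exact ⟨k, ⟨hk, hcon⟩, hzk⟩

lemma openSegment_edge (h : IsSimpleLoop p m) {k j : ℕ} {z : Plane}
    (hz : z ∈ openSegment ℝ (p k) (p (k + 1))) (hj : z ∈ segment ℝ (p j) (p (j + 1))) :
    p j = p k := by
  have hne := h.ne_succ k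
  have hz1 : z ≠ p k := by
    rintro rfl; exact hne (left_mem_openSegment_iff.mp hz)
  have hz2 : z ≠ p (k + 1) := by
    rintro rfl; exact hne (right_mem_openSegment_iff.mp hz)
  rcases h.edges k j z (openSegment_subset_segment ℝ _ _ hz) hj with e | ⟨e1, e2⟩ | ⟨e1, e2⟩
  · exact e.symm
  · exact absurd (e1.trans e2) hz2
  · exact absurd e1 hz1

lemma vertex_notMem_openSegment (h : IsSimpleLoop p m)
    (k l : ℕ) : p k ∉ openSegment ℝ (p l) (p (l + 1)) := by
  intro hl
  have e := h.openSegment_edge hl (left_mem_segment ℝ (p k) (p (k + 1)))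
  rw [e] at hl
  exact h.ne_succ l ((left_mem_openSegment_iff (𝕜 := ℝ)).mp hl)

lemma succ_eq (h : IsSimpleLoop p m) {i j : ℕ} (e : p i = p j) : p (i + 1) = p (j + 1) :=
  h.eq_iff.mpr (Nat.ModEq.add_right 1 (h.eq_iff.mp e))

lemma vertex_edge (h : IsSimpleLoop p m) {k j : ℕ} (hj : p (k + 1) ∈ segment ℝ (p j) (p (j + 1))) :
    p j = p k ∨ p j = p (k + 1) := by
  rcases h.edges k j _ (right_mem_segment ℝ _ _) hj with e | ⟨e1, e2⟩ | ⟨e1, e2⟩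
  · exact Or.inl e.symm
  · exact Or.inr e2
  · exact absurd e1.symm (h.ne_succ k)

/-- Consecutive edges of a simple polygon do not overlap. -/
lemma corner (h : IsSimpleLoop p m) (k : ℕ) : orient (p k) (p (k + 1)) (p (k + 2)) ≠ 0 ∨
    ∃ c < (0:ℝ), p k - p (k + 1) = c • (p (k + 2) - p (k + 1)) := by
  by_cases ho : orient (p k) (p (k + 1)) (p (k + 2)) = 0
  · right
    have hb : p (k + 2) - p (k + 1) ≠ 0 := sub_ne_zero.mpr (h.ne_succ (k + 1)).symm
    have hcr : cross (p (k + 2) - p (k + 1)) (p k - p (k + 1)) = 0 := by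
      rw [← ho]; simp [cross, orient]; ring
    obtain ⟨c, hc⟩ := exists_smul_of_cross_eq_zero hb hcr
    refine ⟨c, ?_, hc⟩
    -- With a nonnegative factor both edges leave the corner in the same direction, and the far end
    -- of the shorter edge lies on the longer one.
    by_contra! hc0
    have hcne : c ≠ 0 := by
      rintro rfl
      rw [zero_smul, sub_eq_zero] at hc
      exact h.ne_succ k hc
    rcases le_total c 1 with h1 | h1
    · have : p k ∈ segment ℝ (p (k + 1)) (p (k + 1 + 1)) :=
        mem_segment_iff_smul.mpr ⟨c, hc0, h1, by rw [← hc]; abel⟩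
      rcases h.edges k (k + 1) _ (left_mem_segment ℝ _ _) this with e | ⟨e1, e2⟩ | ⟨e1, e2⟩
      · exact h.ne_succ k e
      · exact h.ne_succ k e1
      · exact h.ne_succ2 k e2
    · have : p (k + 2) ∈ segment ℝ (p k) (p (k + 1)) := by
        rw [segment_symm]
        refine mem_segment_iff_smul.mpr ⟨c⁻¹, by positivity, inv_le_one_of_one_le₀ h1, ?_⟩
        rw [hc, smul_smul, inv_mul_cancel₀ hcne, one_smul]; abel
      rcases h.edges k (k + 1) _ this (right_mem_segment ℝ _ _) with e | ⟨e1, e2⟩ | ⟨e1, e2⟩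
      · exact h.ne_succ k e
      · exact h.ne_succ (k + 1) e1.symm
      · exact h.ne_succ2 k e1.symm
  · exact Or.inl ho

/-- Near each of its points the polygon consists of two segments: the adjacent edges at a vertex,
the two halves of the edge elsewhere. The radius supplied by `sector_closure` does not depend on the
component `C`. -/
lemma local_closure (h : IsSimpleLoop p m) {w : Plane} (hw : w ∈ Bd p) :
    ∃ r > 0, ∀ C : Set Plane, C ⊆ (Bd p)ᶜ →
      (∀ S : Set Plane, IsPreconnected S → S ⊆ (Bd p)ᶜ → (S ∩ C).Nonempty → S ⊆ C) →
      w ∈ closure C → Bd p ∩ Metric.ball w r ⊆ closure C := by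
  have main : ∀ a b : Plane, a ≠ w → b ≠ w → segment ℝ a w ∪ segment ℝ w b ⊆ Bd p →
      (orient a w b ≠ 0 ∨ ∃ k < (0:ℝ), a - w = k • (b - w)) →
      (∀ k, w ∈ segment ℝ (p k) (p (k + 1)) →
        segment ℝ (p k) (p (k + 1)) ⊆ segment ℝ a w ∪ segment ℝ w b) →
      ∃ r > 0, ∀ C : Set Plane, C ⊆ (Bd p)ᶜ →
      (∀ S : Set Plane, IsPreconnected S → S ⊆ (Bd p)ᶜ → (S ∩ C).Nonempty → S ⊆ C) →
      w ∈ closure C → Bd p ∩ Metric.ball w r ⊆ closure C := by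
    intro a b ha hb hsub hang hk
    obtain ⟨r, hr, hrB⟩ := h.exists_ball hk
    have hna := norm_pos_iff.mpr (sub_ne_zero.mpr ha)
    have hnb := norm_pos_iff.mpr (sub_ne_zero.mpr hb)
    refine ⟨min r (min ‖a - w‖ ‖b - w‖), by positivity, fun C h1 h2 h3 => ?_⟩
    refine sector_closure ?_ hsub ha hb ?_ ?_ hang h1 h2 h3 (by positivity)
    · exact fun z hz => hrB ⟨hz.1, Metric.ball_subset_ball (min_le_left _ _) hz.2⟩
    · exact (min_le_right _ _).trans (min_le_left _ _)
    · exact (min_le_right _ _).trans (min_le_right _ _)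
  obtain ⟨k, hk⟩ := mem_Bd.mp hw
  have vert : ∀ k, w = p (k + 1) → ∃ r > 0, ∀ C : Set Plane, C ⊆ (Bd p)ᶜ →
      (∀ S : Set Plane, IsPreconnected S → S ⊆ (Bd p)ᶜ → (S ∩ C).Nonempty → S ⊆ C) →
      w ∈ closure C → Bd p ∩ Metric.ball w r ⊆ closure C := by
    rintro k rfl
    refine main (p k) (p (k + 2)) (h.ne_succ k) (h.ne_succ (k + 1)).symm
      (Set.union_subset (edge_subset p k) (edge_subset p (k + 1))) (h.corner k) ?_
    intro j hj
    rcases h.vertex_edge hj with e | e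
    · rw [e, h.succ_eq e]; exact Set.subset_union_left
    · rw [e, h.succ_eq e]; exact Set.subset_union_right
  by_cases h1 : w = p (k + 1)
  · exact vert k h1
  by_cases h0 : w = p k
  -- By periodicity `p k` is the successor of the vertex with number `k + (m - 1)`.
  · apply vert (k + (m - 1))
    rw [h0, ← h.per k]; congr 1; have := h.three_le; omega
  have ho : w ∈ openSegment ℝ (p k) (p (k + 1)) :=
    mem_openSegment_of_ne_left_right (Ne.symm h0) (Ne.symm h1) hk
  have hu : segment ℝ (p k) w ∪ segment ℝ w (p (k + 1)) = segment ℝ (p k) (p (k + 1)) := by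
    apply Set.Subset.antisymm
    · exact Set.union_subset ((convex_segment _ _).segment_subset (left_mem_segment ℝ _ _) hk)
        ((convex_segment _ _).segment_subset hk (right_mem_segment ℝ _ _))
    · intro z hz
      obtain ⟨t, ht0, ht1, rfl⟩ := mem_segment_iff_smul.mp hk
      obtain ⟨s, hs0, hs1, rfl⟩ := mem_segment_iff_smul.mp hz
      rcases le_total s t with hst | hst
      · left
        by_cases ht : t = 0
        · obtain rfl : s = 0 := by linarith
          subst ht; simp
        · refine mem_segment_iff_smul.mpr ⟨s / t, by positivity, div_le_one_of_le₀ hst ht0, ?_⟩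
          rw [add_sub_cancel_left, smul_smul, div_mul_cancel₀ _ ht]
      · right
        by_cases ht : t = 1
        · obtain rfl : s = 1 := by linarith
          subst ht; simp
        · have : t < 1 := lt_of_le_of_ne ht1 ht
          refine mem_segment_iff_smul.mpr ⟨(s - t) / (1 - t), by
            apply div_nonneg <;> linarith, div_le_one_of_le₀ (by linarith) (by linarith), ?_⟩
          have e : p (k + 1) - (p k + t • (p (k + 1) - p k)) = (1 - t) • (p (k + 1) - p k) := by
            rw [sub_smul, one_smul]; abel
          rw [e, smul_smul, div_mul_cancel₀ _ (by linarith), sub_smul]; abel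
  refine main (p k) (p (k + 1)) (Ne.symm h0) (Ne.symm h1) (hu ▸ edge_subset p k) (Or.inr ?_) ?_
  · obtain ⟨t, h0, h1, ht⟩ := mem_openSegment_iff_smul.mp ho
    refine ⟨-(t / (1 - t)), by rw [neg_lt_zero]; apply div_pos <;> linarith, ?_⟩
    have e : p (k + 1) - w = (1 - t) • (p (k + 1) - p k) := by
      rw [ht, sub_smul, one_smul]; abel
    rw [e, smul_smul, neg_mul, div_mul_cancel₀ _ (by linarith), ht, neg_smul]; abel
  · intro j hj
    have e := h.openSegment_edge ho hj
    rw [hu, e, h.succ_eq e]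

/-- Every component of the complement is adherent to the whole polygon. -/
lemma Bd_subset_closure (h : IsSimpleLoop p m) {x : Plane} (hx : x ∉ Bd p) :
    Bd p ⊆ closure (connectedComponentIn (Bd p)ᶜ x) := by
  set C := connectedComponentIn (Bd p)ᶜ x with hCdef
  have hopen : IsOpen (Bd p)ᶜ := h.isCompact_Bd.isClosed.isOpen_compl
  have hCo : IsOpen C := hopen.connectedComponentIn
  have hxC : x ∈ C := mem_connectedComponentIn hx
  have hCB : C ⊆ (Bd p)ᶜ := connectedComponentIn_subset _ _
  have hC : ∀ S : Set Plane, IsPreconnected S → S ⊆ (Bd p)ᶜ → (S ∩ C).Nonempty → S ⊆ C := by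
    rintro S hS hSB ⟨y, hyS, hyC⟩
    rw [hCdef, connectedComponentIn_eq hyC]
    exact hS.subset_connectedComponentIn hyS hSB
  -- Otherwise `C` would be open and closed in the plane, hence the whole plane.
  have hne : (closure C ∩ Bd p).Nonempty := by
    by_contra hcon
    rw [Set.not_nonempty_iff_eq_empty, ← Set.disjoint_iff_inter_eq_empty] at hcon
    have hsub : closure C ⊆ C := by
      apply hC _ isPreconnected_connectedComponentIn.closure
      · exact Set.subset_compl_iff_disjoint_right.mpr hcon
      · exact ⟨x, subset_closure hxC, hxC⟩
    have hcl : IsClosed C := isClosed_of_closure_subset hsub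
    have huniv := IsClopen.eq_univ ⟨hcl, hCo⟩ ⟨x, hxC⟩
    exact hCB (huniv ▸ Set.mem_univ (p 0)) (vertex_mem p 0)
  choose! r hr hloc using fun w (hw : w ∈ Bd p) => h.local_closure hw
  -- By `local_closure` the points of the polygon adherent to `C` form an open subset of it, and
  -- also a closed one; the polygon is connected.
  set u : Set Plane := ⋃ w ∈ Bd p ∩ closure C, Metric.ball w (r w) with hu
  have huo : IsOpen u := isOpen_biUnion fun w _ => Metric.isOpen_ball
  by_contra hcon
  obtain ⟨z, hzB, hz⟩ := Set.not_subset.mp hcon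
  have hpre := isPreconnected_Bd p u (closure C)ᶜ huo isClosed_closure.isOpen_compl (by
    intro w hw
    by_cases hwC : w ∈ closure C
    · left
      exact Set.mem_biUnion (⟨hw, hwC⟩ : w ∈ Bd p ∩ closure C) (Metric.mem_ball_self (hr w hw))
    · exact Or.inr hwC) (by
    obtain ⟨w, hwC, hw⟩ := hne
    exact ⟨w, hw, Set.mem_biUnion (⟨hw, hwC⟩ : w ∈ Bd p ∩ closure C)
      (Metric.mem_ball_self (hr w hw))⟩) ⟨z, hzB, hz⟩
  obtain ⟨y, hyB, hyu, hyC⟩ := hpre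
  simp only [hu, Set.mem_iUnion] at hyu
  obtain ⟨w, ⟨hw, hwC⟩, hyw⟩ := hyu
  exact hyC (hloc w hw C hCB hC hwC ⟨hyB, hyw⟩)

end IsSimpleLoop


/-! ### Regions of closed sets -/

lemma opn_of_mem_component {B : Set Plane} {x y : Plane}
    (hy : y ∈ connectedComponentIn Bᶜ x) : (y ∈ opn B ↔ x ∈ opn B) := by
  have e := connectedComponentIn_eq hy
  have hyB : y ∉ B := connectedComponentIn_subset _ _ hy
  have hxB : x ∉ B := by
    intro hx
    rw [connectedComponentIn_eq_empty (by simpa using hx)] at hy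
    exact hy
  simp [opn, hyB, hxB, e]

lemma isOpen_opn {B : Set Plane} (hB : IsClosed B) : IsOpen (opn B) := by
  rw [isOpen_iff_mem_nhds]
  intro x hx
  filter_upwards [hB.isOpen_compl.connectedComponentIn.mem_nhds
    (mem_connectedComponentIn (show x ∈ Bᶜ from hx.1))] with y hy
  exact (opn_of_mem_component hy).mpr hx

lemma isClosed_cls {B : Set Plane} (hB : IsClosed B) : IsClosed (cls B) := by
  rw [← isOpen_compl_iff, isOpen_iff_mem_nhds]
  intro x hx
  have hxB : x ∉ B := fun h => hx (Or.inl h)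
  filter_upwards [hB.isOpen_compl.connectedComponentIn.mem_nhds
    (mem_connectedComponentIn (show x ∈ Bᶜ from hxB))] with y hy
  rintro (h | h)
  · exact connectedComponentIn_subset _ _ hy h
  · exact hx (Or.inr ((opn_of_mem_component hy).mp h))

lemma opn_of_isPreconnected {B S : Set Plane} (hS : IsPreconnected S) (hSB : S ⊆ Bᶜ) {x y : Plane}
    (hx : x ∈ S) (hy : y ∈ S) (hxo : x ∈ opn B) : y ∈ opn B :=
  (opn_of_mem_component (hS.subset_connectedComponentIn hx hSB hy)).mpr hxo

lemma mem_opn_of_mem_cls {B : Set Plane} {x : Plane} (h : x ∈ cls B) (hx : x ∉ B) : x ∈ opn B :=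
  h.resolve_left hx

/-! ### The total angle off the polygon and its jump across an edge -/

namespace IsSimpleLoop

variable {p : ℕ → Plane} {m : ℕ}

lemma per_zero (h : IsSimpleLoop p m) : p m = p 0 := by simpa using h.per 0

lemma isClosed_Bd (h : IsSimpleLoop p m) : IsClosed (Bd p) := h.isCompact_Bd.isClosed

lemma tot_int (h : IsSimpleLoop p m) {x : Plane} (hx : x ∉ Bd p) :
    ∃ N : ℤ, tot p m x = N * (2 * Real.pi) :=
  _root_.tot_int h.per_zero fun k e => hx (e ▸ vertex_mem p k)

lemma notMem_edge {x : Plane} (hx : x ∉ Bd p) (k : ℕ) : x ∉ segment ℝ (p k) (p (k + 1)) :=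
  fun hk => hx (edge_subset p k hk)

lemma continuousOn_tot (p : ℕ → Plane) (m : ℕ) : ContinuousOn (tot p m) (Bd p)ᶜ := by
  intro x hx
  apply ContinuousAt.continuousWithinAt
  unfold tot
  exact tendsto_finsetSum _ fun k _ => continuousAt_ang (notMem_edge hx k)

/-- The total angle is continuous off the polygon with values in `2πℤ`. If it decreased from `x` to
`y`, it would take the value halfway between two consecutive multiples of `2π`. -/
lemma tot_le (h : IsSimpleLoop p m) {S : Set Plane} (hS : IsPreconnected S) (hSB : S ⊆ (Bd p)ᶜ)
    {x y : Plane} (hx : x ∈ S) (hy : y ∈ S) : tot p m x ≤ tot p m y := by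
  by_contra! hlt
  obtain ⟨N, hN⟩ := h.tot_int (hSB hx)
  obtain ⟨M, hM⟩ := h.tot_int (hSB hy)
  have hpi := Real.pi_pos
  have hMN : M < N := by
    by_contra! hle
    have : (N:ℝ) ≤ M := by exact_mod_cast hle
    nlinarith
  have hMN' : (M:ℝ) + 1 ≤ N := by exact_mod_cast hMN
  have hiv := hS.intermediate_value hy hx ((continuousOn_tot p m).mono hSB)
  obtain ⟨z, hz, hzv⟩ := hiv (show ((M:ℝ) + 1 / 2) * (2 * Real.pi) ∈ _ by
    constructor
    · rw [hM]; nlinarith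
    · rw [hN]; nlinarith)
  obtain ⟨K, hK⟩ := h.tot_int (hSB hz)
  rw [hK] at hzv
  have := mul_right_cancel₀ (by positivity) hzv
  have h2 : (2 * K : ℝ) = 2 * M + 1 := by linarith
  have h3 : 2 * K = 2 * M + 1 := by exact_mod_cast h2
  omega

lemma tot_const (h : IsSimpleLoop p m) {S : Set Plane} (hS : IsPreconnected S)
    (hSB : S ⊆ (Bd p)ᶜ) {x y : Plane} (hx : x ∈ S) (hy : y ∈ S) : tot p m x = tot p m y :=
  le_antisymm (h.tot_le hS hSB hx hy) (h.tot_le hS hSB hy hx)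

end IsSimpleLoop

/-- At an inner point of the segment the complex number is a negative real. Its argument tends to
`π` from the left side of the segment and to `-π` from the right side; this is the source of the
jump. -/
lemma tendsto_ang_left {z a b d : Plane} (hz : z ∈ openSegment ℝ a b) (hab : a ≠ b)
    (hd : 0 < cross (b - a) d) :
    Tendsto (fun t : ℝ => ang (z + t • d) a b) (𝓝[>] 0) (𝓝 Real.pi) ∧
    Tendsto (fun t : ℝ => ang (z + t • (-d)) a b) (𝓝[>] 0) (𝓝 (-Real.pi)) := by
  have hre : (⟨dotp (a - z) (b - z), cross (a - z) (b - z)⟩ : ℂ).re < 0 := by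
    obtain ⟨t, h0, h1, rfl⟩ := mem_openSegment_iff_smul.mp hz
    have hp := dotp_self_pos (sub_ne_zero.mpr hab.symm)
    have : dotp (a - (a + t • (b - a))) (b - (a + t • (b - a))) =
        -(t * (1 - t)) * dotp (b - a) (b - a) := by simp [dotp]; ring
    simp only [this]
    have : 0 < t * (1 - t) := mul_pos h0 (by linarith)
    nlinarith
  have ho := orient_of_mem_segment (openSegment_subset_segment ℝ _ _ hz)
  have e : ∀ x : Plane, cross (a - x) (b - x) = orient a b x := by
    intro x; simp [cross, orient]; ring
  have him : (⟨dotp (a - z) (b - z), cross (a - z) (b - z)⟩ : ℂ).im = 0 := by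
    simp only [e, ho]
  have hcont : ∀ v : Plane, Tendsto (fun t : ℝ => (⟨dotp (a - (z + t • v)) (b - (z + t • v)),
      cross (a - (z + t • v)) (b - (z + t • v))⟩ : ℂ)) (𝓝[>] 0)
      (𝓝 ⟨dotp (a - z) (b - z), cross (a - z) (b - z)⟩) := by
    intro v
    have h1 : Continuous fun t : ℝ => (z + t • v) := by fun_prop
    have := ((continuous_angArg a b).comp h1).tendsto 0
    simp only [Function.comp_def, zero_smul, add_zero] at this
    exact this.mono_left nhdsWithin_le_nhds
  constructor
  · refine (Complex.tendsto_arg_nhdsWithin_im_nonneg_of_re_neg_of_im_zero hre him).comp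
      (tendsto_nhdsWithin_iff.mpr ⟨hcont d, ?_⟩)
    filter_upwards [self_mem_nhdsWithin] with t ht
    have ht' : 0 < t := ht
    show 0 ≤ cross (a - (z + t • d)) (b - (z + t • d))
    rw [e, orient_add_smul, ho]; nlinarith [mul_pos ht' hd]
  · refine (Complex.tendsto_arg_nhdsWithin_im_neg_of_re_neg_of_im_zero hre him).comp
      (tendsto_nhdsWithin_iff.mpr ⟨hcont (-d), ?_⟩)
    filter_upwards [self_mem_nhdsWithin] with t ht
    have ht' : 0 < t := ht
    show cross (a - (z + t • -d)) (b - (z + t • -d)) < 0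
    have : cross (b - a) (-d) = -cross (b - a) d := by simp [cross]; ring
    rw [e, orient_add_smul, ho, this]; nlinarith [mul_pos ht' hd]

namespace IsSimpleLoop

variable {p : ℕ → Plane} {m : ℕ}

/-- Only the edge through `z` contributes, since the angles of all the other edges are continuous at
`z`. -/
lemma tendsto_jump (h : IsSimpleLoop p m) {k : ℕ} {z d : Plane}
    (hz : z ∈ openSegment ℝ (p k) (p (k + 1))) (hd : 0 < cross (p (k + 1) - p k) d) :
    Tendsto (fun t : ℝ => tot p m (z + t • d) - tot p m (z + t • (-d))) (𝓝[>] 0)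
      (𝓝 (2 * Real.pi)) := by
  classical
  have hm := h.three_le
  have hsum : 2 * Real.pi = ∑ j ∈ Finset.range m, if j = k % m then 2 * Real.pi else 0 := by
    rw [Finset.sum_ite_eq' (Finset.range m) (k % m), if_pos]
    exact Finset.mem_range.mpr (Nat.mod_lt _ (by omega))
  rw [hsum]
  simp only [tot, ← Finset.sum_sub_distrib]
  apply tendsto_finsetSum
  intro j hj
  split_ifs with hjk
  · have e : p j = p k := by rw [hjk, h.mod_eq]
    rw [e, h.succ_eq e]
    obtain ⟨h1, h2⟩ := tendsto_ang_left hz (h.ne_succ k) hd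
    convert h1.sub h2 using 2
    ring
  · have hzj : z ∉ segment ℝ (p j) (p (j + 1)) := by
      intro hzj
      apply hjk
      have := h.inj _ _ (h.openSegment_edge hz hzj)
      rwa [Nat.mod_eq_of_lt (Finset.mem_range.mp hj)] at this
    have hc := continuousAt_ang hzj
    have hline : ∀ v : Plane, Tendsto (fun t : ℝ => z + t • v) (𝓝[>] 0) (𝓝 z) := by
      intro v
      have h1 : Continuous fun t : ℝ => (z + t • v) := by fun_prop
      have := h1.tendsto 0
      simp only [zero_smul, add_zero] at this
      exact this.mono_left nhdsWithin_le_nhds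
    have := (hc.tendsto.comp (hline d)).sub (hc.tendsto.comp (hline (-d)))
    simpa [Function.comp_def] using this

/-- Near an inner point of an edge the polygon is a line, and the total angle jumps by `2π` across
it. -/
lemma jump (h : IsSimpleLoop p m) {k : ℕ} {z : Plane}
    (hz : z ∈ openSegment ℝ (p k) (p (k + 1))) :
    ∃ r > 0, (∀ x ∈ Metric.ball z r, orient (p k) (p (k + 1)) x ≠ 0 → x ∉ Bd p) ∧
      (∀ x ∈ Metric.ball z r, orient (p k) (p (k + 1)) x = 0 → x ∈ Bd p) ∧
      ∀ x ∈ Metric.ball z r, ∀ y ∈ Metric.ball z r, 0 < orient (p k) (p (k + 1)) x →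
        orient (p k) (p (k + 1)) y < 0 → tot p m x = tot p m y + 2 * Real.pi := by
  have hne := h.ne_succ k
  obtain ⟨r1, hr1, hB⟩ := h.exists_ball (w := z) (s := segment ℝ (p k) (p (k + 1)))
    (fun j hj => by
      have e := h.openSegment_edge hz hj
      rw [e, h.succ_eq e])
  obtain ⟨t0, ht0, ht1, hzt⟩ := mem_openSegment_iff_smul.mp hz
  have hn : 0 < ‖p (k + 1) - p k‖ := norm_pos_iff.mpr (sub_ne_zero.mpr hne.symm)
  -- The second bound keeps the points of the ball that are on the line of the edge within the edge.
  set r := min r1 (min t0 (1 - t0) * ‖p (k + 1) - p k‖) with hr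
  have hrpos : 0 < r := lt_min hr1 (mul_pos (lt_min ht0 (by linarith)) hn)
  have hoff : ∀ x ∈ Metric.ball z r, orient (p k) (p (k + 1)) x ≠ 0 → x ∉ Bd p := by
    intro x hx ho hxB
    exact ho (orient_of_mem_segment
      (hB ⟨hxB, Metric.ball_subset_ball (min_le_left _ _) hx⟩))
  refine ⟨r, hrpos, hoff, ?_, ?_⟩
  · intro x hx ho
    have hcr : cross (p (k + 1) - p k) (x - z) = 0 := by
      have h0 := orient_of_mem_segment (openSegment_subset_segment ℝ _ _ hz)
      have : cross (p (k + 1) - p k) (x - z) =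
        orient (p k) (p (k + 1)) x - orient (p k) (p (k + 1)) z := by
        simp [cross, orient]; ring
      rw [this, ho, h0, sub_zero]
    obtain ⟨s, hs⟩ := exists_smul_of_cross_eq_zero (sub_ne_zero.mpr hne.symm) hcr
    have hxe : x = p k + (t0 + s) • (p (k + 1) - p k) := by
      rw [add_smul, ← hs, hzt]; abel
    have hx2 : ‖x - z‖ < min t0 (1 - t0) * ‖p (k + 1) - p k‖ :=
      lt_of_lt_of_le (mem_ball_iff_norm.mp hx) (min_le_right _ _)
    rw [hs, norm_smul, Real.norm_eq_abs] at hx2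
    have hs2 := lt_of_mul_lt_mul_right hx2 hn.le
    have hs3 := abs_lt.mp (lt_of_lt_of_le hs2 (min_le_left _ _))
    have hs4 := abs_lt.mp (lt_of_lt_of_le hs2 (min_le_right _ _))
    exact edge_subset p k (mem_segment_iff_smul.mpr ⟨t0 + s, by linarith [hs3.1],
      by linarith [hs4.2], hxe⟩)
  · intro x hx y hy hxo hyo
    have hd := dotp_self_pos (sub_ne_zero.mpr hne.symm)
    set d : Plane := (-(p (k + 1) - p k).2, (p (k + 1) - p k).1) with hdd
    have hcd : 0 < cross (p (k + 1) - p k) d := by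
      convert hd using 1; simp [cross, dotp, hdd]; ring
    have hcd' : cross (p (k + 1) - p k) (-d) = -cross (p (k + 1) - p k) d := by
      simp [cross]; ring
    have hz0 := orient_of_mem_segment (openSegment_subset_segment ℝ _ _ hz)
    have hlim := h.tendsto_jump hz hcd
    -- The total angle is constant on each half of the ball, so the difference across the edge
    -- equals its limit.
    have hconst : (fun t : ℝ => tot p m (z + t • d) - tot p m (z + t • (-d))) =ᶠ[𝓝[>] 0]
        fun _ => tot p m x - tot p m y := by
      have hzb : z ∈ Metric.ball z r := Metric.mem_ball_self hrpos
      filter_upwards [eventually_ball (d := d) hzb, eventually_ball (d := -d) hzb,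
        self_mem_nhdsWithin] with t h1 h2 ht
      have ht' : 0 < t := ht
      have hp : tot p m (z + t • d) = tot p m x := by
        apply h.tot_const ((convex_orient_pos (p k) (p (k + 1))).inter
          (convex_ball z r)).isPreconnected
        · rintro w ⟨hw1, hw2⟩
          exact hoff w hw2 (ne_of_gt hw1)
        · refine ⟨?_, h1⟩
          show 0 < orient _ _ _
          rw [orient_add_smul, hz0]; nlinarith [mul_pos ht' hcd]
        · exact ⟨hxo, hx⟩
      have hq : tot p m (z + t • -d) = tot p m y := by
        apply h.tot_const ((convex_orient_neg (p k) (p (k + 1))).inter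
          (convex_ball z r)).isPreconnected
        · rintro w ⟨hw1, hw2⟩
          exact hoff w hw2 (ne_of_lt hw1)
        · refine ⟨?_, h2⟩
          show orient _ _ _ < 0
          rw [orient_add_smul, hz0, hcd']; nlinarith [mul_pos ht' hcd]
        · exact ⟨hyo, hy⟩
      rw [hp, hq]
    have := tendsto_nhds_unique (hlim.congr' hconst) tendsto_const_nhds
    linarith

end IsSimpleLoop

/-! ### The Jordan curve theorem for polygons -/

/-- A simple closed chain with orientation sign `ε`: the total angle is `2πε` at the inner points
and zero at the outer points. -/
structure IsOrientedLoop (p : ℕ → Plane) (m : ℕ) (ε : ℝ) : Prop extends IsSimpleLoop p m where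
  sign : ε = 1 ∨ ε = -1
  tot_inside : ∀ x ∈ opn (Bd p), tot p m x = ε * (2 * Real.pi)
  tot_outside : ∀ x, x ∉ cls (Bd p) → tot p m x = 0

namespace IsSimpleLoop

variable {p : ℕ → Plane} {m : ℕ}

/-- A distant point is separated from the polygon by a horizontal or vertical line. -/
lemma tot_eq_zero_of_far (h : IsSimpleLoop p m) :
    ∃ R : ℝ, ∀ x : Plane, R < ‖x‖ → tot p m x = 0 := by
  obtain ⟨R, hR⟩ := h.isCompact_Bd.isBounded.exists_norm_le
  refine ⟨R, fun x hx => ?_⟩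
  have hv : ∀ k, |(p k).1| ≤ R ∧ |(p k).2| ≤ R := by
    intro k
    have := hR _ (vertex_mem p k)
    rw [Prod.norm_def, max_le_iff] at this
    exact this
  rw [Prod.norm_def, lt_max_iff, Real.norm_eq_abs, Real.norm_eq_abs, lt_abs, lt_abs] at hx
  rcases hx with (hx | hx) | (hx | hx)
  · apply tot_eq_zero_of_halfplane (u := (-1, 0)) h.per_zero
    intro k _
    simp [dotp]; linarith [(abs_le.mp (hv k).1).2]
  · apply tot_eq_zero_of_halfplane (u := (1, 0)) h.per_zero
    intro k _
    simp [dotp]; linarith [(abs_le.mp (hv k).1).1]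
  · apply tot_eq_zero_of_halfplane (u := (0, -1)) h.per_zero
    intro k _
    simp [dotp]; linarith [(abs_le.mp (hv k).2).2]
  · apply tot_eq_zero_of_halfplane (u := (0, 1)) h.per_zero
    intro k _
    simp [dotp]; linarith [(abs_le.mp (hv k).2).1]

/-- An unbounded component contains distant points, and the total angle is constant on it. -/
lemma tot_eq_zero_of_notMem_cls (h : IsSimpleLoop p m) {x : Plane} (hx : x ∉ cls (Bd p)) :
    tot p m x = 0 := by
  obtain ⟨R, hR⟩ := h.tot_eq_zero_of_far
  have hxB : x ∉ Bd p := fun hB => hx (Or.inl hB)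
  have hunb : ¬ Bornology.IsBounded (connectedComponentIn (Bd p)ᶜ x) :=
    fun hb => hx (Or.inr ⟨hxB, hb⟩)
  obtain ⟨y, hyC, hy⟩ : ∃ y ∈ connectedComponentIn (Bd p)ᶜ x, R < ‖y‖ := by
    by_contra! hcon
    exact hunb (isBounded_iff_forall_norm_le.mpr ⟨R, hcon⟩)
  rw [← hR y hy]
  exact h.tot_const isPreconnected_connectedComponentIn (connectedComponentIn_subset _ _)
    (mem_connectedComponentIn hxB) hyC

lemma exists_notMem_cls (h : IsSimpleLoop p m) : ∃ x, x ∉ cls (Bd p) := by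
  obtain ⟨R, hR⟩ := h.isCompact_Bd.isBounded.exists_norm_le
  have hR0 : 0 ≤ R := (norm_nonneg _).trans (hR _ (vertex_mem p 0))
  let S : Set Plane := {y | R < y.1}
  have hSc : Convex ℝ S := by
    intro a ha b hb s t hs ht hst
    have ha' : R < a.1 := ha
    have hb' : R < b.1 := hb
    show R < s * a.1 + t * b.1
    obtain rfl : s = 1 - t := by linarith
    rcases ht.eq_or_lt with rfl | ht
    · simpa using ha'
    · nlinarith
  have hS : IsPreconnected S := hSc.isPreconnected
  have hSB : S ⊆ (Bd p)ᶜ := by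
    intro y hy hyB
    have hy' : R < y.1 := hy
    have := hR y hyB
    rw [Prod.norm_def, max_le_iff, Real.norm_eq_abs] at this
    linarith [le_abs_self y.1]
  have hx : ((R + 1, 0) : Plane) ∈ S := by show R < R + 1; linarith
  refine ⟨(R + 1, 0), ?_⟩
  rintro (hB | ⟨-, hb⟩)
  · exact hSB hx hB
  · obtain ⟨R', hR'⟩ := (hb.subset (hS.subset_connectedComponentIn hx hSB)).exists_norm_le
    have := hR' (max (R + 1) (R' + 1), 0) (by
      show R < max (R + 1) (R' + 1)
      exact lt_max_of_lt_left (by linarith))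
    rw [Prod.norm_def, max_le_iff, Real.norm_eq_abs] at this
    linarith [le_abs_self (max (R + 1) (R' + 1)), le_max_right (R + 1) (R' + 1), this.1]

lemma exists_mid (_ : IsSimpleLoop p m) (k : ℕ) : ∃ z, z ∈ openSegment ℝ (p k) (p (k + 1)) :=
  ⟨_, midpoint_mem_openSegment _ _⟩

/-- The Jordan curve theorem for simple polygons. -/
theorem exists_isOrientedLoop (h : IsSimpleLoop p m) : ∃ ε, IsOrientedLoop p m ε := by
  obtain ⟨z, hz⟩ := h.exists_mid 0
  obtain ⟨r, hr, hoff, hon, hjump⟩ := h.jump hz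
  have hd := dotp_self_pos (sub_ne_zero.mpr (h.ne_succ 0).symm)
  set d : Plane := (-(p 1 - p 0).2, (p 1 - p 0).1) with hdd
  have hcd : 0 < cross (p 1 - p 0) d := by
    convert hd using 1; simp [cross, dotp, hdd]; ring
  have hcd' : cross (p 1 - p 0) (-d) = -cross (p 1 - p 0) d := by
    simp [cross]; ring
  have hz0 := orient_of_mem_segment (openSegment_subset_segment ℝ _ _ hz)
  have hzb : z ∈ Metric.ball z r := Metric.mem_ball_self hr
  obtain ⟨t, ⟨h1, h2⟩, ht⟩ := ((eventually_ball (d := d) hzb).and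
    (eventually_ball (d := -d) hzb)).and self_mem_nhdsWithin |>.exists
  have ht' : 0 < t := ht
  set x1 := z + t • d with hx1
  set x2 := z + t • -d with hx2
  have o1 : 0 < orient (p 0) (p 1) x1 := by
    rw [hx1, orient_add_smul, hz0]; nlinarith [mul_pos ht' hcd]
  have o2 : orient (p 0) (p 1) x2 < 0 := by
    rw [hx2, orient_add_smul, hz0, hcd']; nlinarith [mul_pos ht' hcd]
  have hj := hjump x1 h1 x2 h2 o1 o2
  have n1 : x1 ∉ Bd p := hoff x1 h1 o1.ne'
  have n2 : x2 ∉ Bd p := hoff x2 h2 o2.ne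
  -- every point off the polygon is in the component of `x1` or `x2`
  have key : ∀ x, x ∉ Bd p → (tot p m x = tot p m x1 ∧ (x ∈ opn (Bd p) ↔ x1 ∈ opn (Bd p))) ∨
      (tot p m x = tot p m x2 ∧ (x ∈ opn (Bd p) ↔ x2 ∈ opn (Bd p))) := by
    intro x hx
    have hzc : z ∈ closure (connectedComponentIn (Bd p)ᶜ x) :=
      h.Bd_subset_closure hx (edge_subset p 0 (openSegment_subset_segment ℝ _ _ hz))
    obtain ⟨y, hyb, hyC⟩ := mem_closure_iff.mp hzc _ Metric.isOpen_ball hzb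
    have hyB : y ∉ Bd p := connectedComponentIn_subset _ _ hyC
    have hxy : tot p m x = tot p m y :=
      h.tot_const isPreconnected_connectedComponentIn (connectedComponentIn_subset _ _)
        (mem_connectedComponentIn hx) hyC
    have hxo := opn_of_mem_component hyC
    rw [hxy, ← hxo]
    rcases lt_trichotomy (orient (p 0) (p 1) y) 0 with ho | ho | ho
    · right
      have hS := ((convex_orient_neg (p 0) (p 1)).inter (convex_ball z r)).isPreconnected
      have hSB : {y | orient (p 0) (p 1) y < 0} ∩ Metric.ball z r ⊆ (Bd p)ᶜ :=
        fun w hw => hoff w hw.2 (ne_of_lt hw.1)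
      exact ⟨h.tot_const hS hSB ⟨ho, hyb⟩ ⟨o2, h2⟩,
        opn_of_isPreconnected hS hSB ⟨ho, hyb⟩ ⟨o2, h2⟩,
        opn_of_isPreconnected hS hSB ⟨o2, h2⟩ ⟨ho, hyb⟩⟩
    · exact absurd (hon y hyb ho) hyB
    · left
      have hS := ((convex_orient_pos (p 0) (p 1)).inter (convex_ball z r)).isPreconnected
      have hSB : {y | 0 < orient (p 0) (p 1) y} ∩ Metric.ball z r ⊆ (Bd p)ᶜ :=
        fun w hw => hoff w hw.2 (ne_of_gt hw.1)
      exact ⟨h.tot_const hS hSB ⟨ho, hyb⟩ ⟨o1, h1⟩,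
        opn_of_isPreconnected hS hSB ⟨ho, hyb⟩ ⟨o1, h1⟩,
        opn_of_isPreconnected hS hSB ⟨o1, h1⟩ ⟨ho, hyb⟩⟩
  have hpi := Real.pi_pos
  obtain ⟨x0, hx0⟩ := h.exists_notMem_cls
  have hx0B : x0 ∉ Bd p := fun hB => hx0 (Or.inl hB)
  have hx0o : x0 ∉ opn (Bd p) := fun hB => hx0 (Or.inr hB)
  have t0 := h.tot_eq_zero_of_notMem_cls hx0
  have hin : ∀ x, x ∉ Bd p → tot p m x ≠ 0 → x ∈ opn (Bd p) := by
    intro x hxB hx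
    by_contra hxo
    exact hx (h.tot_eq_zero_of_notMem_cls (fun hc => hc.elim hxB hxo))
  -- The outer point `x0` has total angle zero and shares it with one side of the edge. The jump
  -- makes the total angle on the other side `±2π`, and this sign is the orientation.
  rcases key x0 hx0B with ⟨e1, e2⟩ | ⟨e1, e2⟩
  · have e3 : tot p m x2 = -(2 * Real.pi) := by linarith
    refine ⟨-1, { h with sign := Or.inr rfl, tot_inside := ?_, tot_outside := ?_ }⟩
    · intro x hx
      rcases key x hx.1 with ⟨f1, f2⟩ | ⟨f1, f2⟩
      · exact absurd (e2.mpr (f2.mp hx)) hx0o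
      · rw [f1, e3]; ring
    · exact fun x hx => h.tot_eq_zero_of_notMem_cls hx
  · have e3 : tot p m x1 = 2 * Real.pi := by linarith
    refine ⟨1, { h with sign := Or.inl rfl, tot_inside := ?_, tot_outside := ?_ }⟩
    · intro x hx
      rcases key x hx.1 with ⟨f1, f2⟩ | ⟨f1, f2⟩
      · rw [f1, e3]; ring
      · exact absurd (e2.mpr (f2.mp hx)) hx0o
    · exact fun x hx => h.tot_eq_zero_of_notMem_cls hx

lemma mem_opn_of_tot_ne_zero (h : IsSimpleLoop p m) {x : Plane} (hx : x ∉ Bd p)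
    (ht : tot p m x ≠ 0) : x ∈ opn (Bd p) := by
  by_contra hxo
  exact ht (h.tot_eq_zero_of_notMem_cls (fun hc => hc.elim hx hxo))

end IsSimpleLoop

namespace IsOrientedLoop

variable {p : ℕ → Plane} {m : ℕ} {ε : ℝ}

lemma sign_ne (h : IsOrientedLoop p m ε) : ε ≠ 0 := by
  rcases h.sign with rfl | rfl <;> norm_num

lemma tot_ne (h : IsOrientedLoop p m ε) {x : Plane} (hx : x ∈ opn (Bd p)) : tot p m x ≠ 0 := by
  rw [h.tot_inside x hx]
  exact mul_ne_zero h.sign_ne (by positivity)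

lemma tot_dichotomy (h : IsOrientedLoop p m ε) {x : Plane} (hx : x ∉ Bd p) :
    tot p m x = ε * (2 * Real.pi) ∨ tot p m x = 0 := by
  by_cases hxo : x ∈ opn (Bd p)
  · exact Or.inl (h.tot_inside x hxo)
  · exact Or.inr (h.tot_outside x (fun hc => hc.elim hx hxo))

/-- The inner side of an edge is on its left iff the orientation sign is positive. -/
lemma side (h : IsOrientedLoop p m ε) {k : ℕ} {z y : Plane}
    (hz : z ∈ openSegment ℝ (p k) (p (k + 1))) (hy : orient (p k) (p (k + 1)) y ≠ 0)
    (hzy : openSegment ℝ z y ⊆ cls (Bd p)) : 0 < ε * orient (p k) (p (k + 1)) y := by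
  obtain ⟨r, hr, hoff, -, hjump⟩ := h.jump hz
  have hzb : z ∈ Metric.ball z r := Metric.mem_ball_self hr
  have hz0 := orient_of_mem_segment (openSegment_subset_segment ℝ _ _ hz)
  have hlt : ∀ᶠ t : ℝ in 𝓝[>] 0, t < 1 :=
    (Iio_mem_nhds (show (0:ℝ) < 1 by norm_num)) |> mem_nhdsWithin_of_mem_nhds
  -- Two points of the line through `z` and `y` on either side of the edge are compared. The one
  -- towards `y` is inside, with total angle `2πε`; the jump then determines on which side of the
  -- edge it lies.
  obtain ⟨t, ⟨⟨h1, h2⟩, ht1⟩, ht⟩ := (((eventually_ball (d := y - z) hzb).and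
    (eventually_ball (d := -(y - z)) hzb)).and hlt).and self_mem_nhdsWithin |>.exists
  have ht' : 0 < t := ht
  have e1 : orient (p k) (p (k + 1)) (z + t • (y - z)) = t * orient (p k) (p (k + 1)) y := by
    have : cross (p (k + 1) - p k) (y - z) =
        orient (p k) (p (k + 1)) y - orient (p k) (p (k + 1)) z := by
      simp [cross, orient]; ring
    rw [orient_add_smul, this, hz0]; ring
  have e2 : orient (p k) (p (k + 1)) (z + t • -(y - z)) = -(t * orient (p k) (p (k + 1)) y) := by
    rw [← e1, orient_add_smul, orient_add_smul, hz0]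
    simp [cross]; ring
  have hx : z + t • (y - z) ∈ cls (Bd p) :=
    hzy (mem_openSegment_iff_smul.mpr ⟨t, ht', ht1, rfl⟩)
  have hxB : z + t • (y - z) ∉ Bd p := hoff _ h1 (by rw [e1]; exact mul_ne_zero ht'.ne' hy)
  have hx'B : z + t • -(y - z) ∉ Bd p :=
    hoff _ h2 (by rw [e2]; exact neg_ne_zero.mpr (mul_ne_zero ht'.ne' hy))
  have hxt := h.tot_inside _ (mem_opn_of_mem_cls hx hxB)
  have hpi := Real.pi_pos
  rcases lt_or_gt_of_ne hy with hy | hy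
  · have hj := hjump _ h2 _ h1 (by rw [e2]; nlinarith [mul_pos_of_neg_of_neg hy (neg_lt_zero.mpr ht')])
      (by rw [e1]; exact mul_neg_of_pos_of_neg ht' hy)
    rcases h.sign with rfl | rfl
    · rcases h.tot_dichotomy hx'B with e | e <;> nlinarith
    · linarith
  · have hj := hjump _ h1 _ h2 (by rw [e1]; positivity) (by rw [e2]; nlinarith [mul_pos ht' hy])
    rcases h.sign with rfl | rfl
    · linarith
    · rcases h.tot_dichotomy hx'B with e | e <;> nlinarith

/-- The total angles on the two sides of an edge differ by `2π`, so they are not both zero. -/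
lemma opn_nonempty (h : IsOrientedLoop p m ε) : (opn (Bd p)).Nonempty := by
  obtain ⟨z, hz⟩ := h.exists_mid 0
  obtain ⟨r, hr, hoff, -, hjump⟩ := h.jump hz
  have hzb : z ∈ Metric.ball z r := Metric.mem_ball_self hr
  have hz0 := orient_of_mem_segment (openSegment_subset_segment ℝ _ _ hz)
  have hd := dotp_self_pos (sub_ne_zero.mpr (h.ne_succ 0).symm)
  set d : Plane := (-(p 1 - p 0).2, (p 1 - p 0).1) with hdd
  have hcd : 0 < cross (p 1 - p 0) d := by
    convert hd using 1; simp [cross, dotp, hdd]; ring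
  have hcd' : cross (p 1 - p 0) (-d) = -cross (p 1 - p 0) d := by
    simp [cross]; ring
  obtain ⟨t, ⟨h1, h2⟩, ht⟩ := ((eventually_ball (d := d) hzb).and
    (eventually_ball (d := -d) hzb)).and self_mem_nhdsWithin |>.exists
  have ht' : 0 < t := ht
  have o1 : 0 < orient (p 0) (p 1) (z + t • d) := by
    rw [orient_add_smul, hz0]; nlinarith [mul_pos ht' hcd]
  have o2 : orient (p 0) (p 1) (z + t • -d) < 0 := by
    rw [orient_add_smul, hz0, hcd']; nlinarith [mul_pos ht' hcd]
  have hj := hjump _ h1 _ h2 o1 o2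
  have hpi := Real.pi_pos
  by_cases h0 : tot p m (z + t • -d) = 0
  · exact ⟨_, h.mem_opn_of_tot_ne_zero (hoff _ h1 o1.ne') (by rw [hj, h0]; positivity)⟩
  · exact ⟨_, h.mem_opn_of_tot_ne_zero (hoff _ h2 o2.ne) h0⟩

lemma Bd_subset_closure_opn (h : IsOrientedLoop p m ε) : Bd p ⊆ closure (opn (Bd p)) := by
  obtain ⟨x, hx⟩ := h.opn_nonempty
  refine (h.Bd_subset_closure hx.1).trans (closure_mono fun y hy => ?_)
  exact (opn_of_mem_component hy).mpr hx

end IsOrientedLoop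


/-! ### Cutting a polygon along a diagonal -/

/-- The closed chain formed by the vertices `p i, …, p j`. -/
def subchain (p : ℕ → Plane) (i j : ℕ) : ℕ → Plane := fun k => p (i + k % (j - i + 1))

lemma succ_mod_cases (k : ℕ) {M : ℕ} (hM : 1 < M) :
    (k % M + 1 < M ∧ (k + 1) % M = k % M + 1) ∨ (k % M + 1 = M ∧ (k + 1) % M = 0) := by
  have hlt := Nat.mod_lt k (show 0 < M by omega)
  rw [Nat.add_mod k 1, Nat.mod_eq_of_lt hM]
  rcases Nat.lt_or_ge (k % M + 1) M with h | h
  · exact Or.inl ⟨h, Nat.mod_eq_of_lt h⟩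
  · have e : k % M + 1 = M := by omega
    exact Or.inr ⟨e, by rw [e, Nat.mod_self]⟩

lemma subchain_of_le {p : ℕ → Plane} {i j k : ℕ} (hk : k ≤ j - i) :
    subchain p i j k = p (i + k) := by
  unfold subchain; rw [Nat.mod_eq_of_lt (by omega)]

lemma subchain_per (p : ℕ → Plane) (i j k : ℕ) :
    subchain p i j (k + (j - i + 1)) = subchain p i j k := by
  unfold subchain; rw [Nat.add_mod_right]

lemma subchain_last {p : ℕ → Plane} {i j : ℕ} (hij : i < j) : subchain p i j (j - i) = p j := by
  rw [subchain_of_le le_rfl]; congr 1; omega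

lemma subchain_close (p : ℕ → Plane) (i j : ℕ) : subchain p i j (j - i + 1) = p i := by
  unfold subchain; simp

lemma subchain_edge {p : ℕ → Plane} {i j : ℕ} (hij : i < j) (k : ℕ) :
    (∃ a, i ≤ a ∧ a < j ∧ subchain p i j k = p a ∧ subchain p i j (k + 1) = p (a + 1)) ∨
      (subchain p i j k = p j ∧ subchain p i j (k + 1) = p i) := by
  rcases succ_mod_cases k (M := j - i + 1) (by omega) with ⟨h1, h2⟩ | ⟨h1, h2⟩
  · left
    exact ⟨i + k % (j - i + 1), by omega, by omega, rfl, by unfold subchain; rw [h2]; rfl⟩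
  · right
    constructor
    · unfold subchain; congr 1; omega
    · unfold subchain; rw [h2]; rfl

lemma mem_Bd_subchain {p : ℕ → Plane} {i j : ℕ} (hij : i < j) {x : Plane} :
    x ∈ Bd (subchain p i j) ↔
      (∃ k, i ≤ k ∧ k < j ∧ x ∈ segment ℝ (p k) (p (k + 1))) ∨ x ∈ segment ℝ (p i) (p j) := by
  rw [IsSimpleLoop.mem_Bd]
  constructor
  · rintro ⟨k, hk⟩
    rcases subchain_edge hij k with ⟨a, h1, h2, e1, e2⟩ | ⟨e1, e2⟩
    · rw [e1, e2] at hk; exact Or.inl ⟨a, h1, h2, hk⟩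
    · rw [e1, e2, segment_symm] at hk; exact Or.inr hk
  · rintro (⟨k, h1, h2, hk⟩ | hk)
    · refine ⟨k - i, ?_⟩
      rw [subchain_of_le (by omega), subchain_of_le (by omega)]
      have e : i + (k - i) = k := by omega
      have e' : i + (k - i + 1) = k + 1 := by omega
      rwa [e, e']
    · refine ⟨j - i, ?_⟩
      rwa [subchain_last hij, subchain_close, segment_symm]

lemma tot_subchain {p : ℕ → Plane} {i j : ℕ} (hij : i < j) (x : Plane) :
    tot (subchain p i j) (j - i + 1) x =
      ∑ k ∈ Finset.Ico i j, ang x (p k) (p (k + 1)) + ang x (p j) (p i) := by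
  unfold tot
  rw [Finset.sum_range_succ, subchain_last hij, subchain_close, Finset.sum_Ico_eq_sum_range]
  congr 1
  apply Finset.sum_congr rfl
  intro k hk
  have := Finset.mem_range.mp hk
  rw [subchain_of_le (by omega), subchain_of_le (by omega), add_assoc]

namespace IsSimpleLoop

variable {p : ℕ → Plane} {m : ℕ}

lemma window_inj (h : IsSimpleLoop p m) {i k l : ℕ} (hk : i ≤ k) (hk' : k < i + m) (hl : i ≤ l)
    (hl' : l < i + m) (e : p k = p l) : k = l := by
  have h1 : i + (k - i) ≡ i + (l - i) [MOD m] := by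
    rw [Nat.add_sub_cancel' hk, Nat.add_sub_cancel' hl]
    exact h.inj _ _ e
  have h2 := Nat.ModEq.add_left_cancel' i h1
  have h3 := Nat.ModEq.eq_of_lt_of_lt h2 (by omega) (by omega)
  omega

lemma exists_window (h : IsSimpleLoop p m) (i k : ℕ) :
    ∃ l, i ≤ l ∧ l < i + m ∧ p l = p k := by
  have h3 := h.three_le
  refine ⟨i + (k + (m - 1) * i) % m, by omega, ?_, ?_⟩
  · have := Nat.mod_lt (k + (m - 1) * i) (show 0 < m by omega); omega
  · rw [h.eq_iff, Nat.add_mod_mod]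
    have : i + (k + (m - 1) * i) = k + m * i := by
      obtain ⟨m, rfl⟩ : ∃ m', m = m' + 1 := ⟨m - 1, by omega⟩
      simp; ring
    rw [this, Nat.add_mul_mod_self_left]

lemma mem_Bd_window (h : IsSimpleLoop p m) (i : ℕ) {x : Plane} (hx : x ∈ Bd p) :
    ∃ k, i ≤ k ∧ k < i + m ∧ x ∈ segment ℝ (p k) (p (k + 1)) := by
  obtain ⟨k, hk⟩ := mem_Bd.mp hx
  obtain ⟨l, h1, h2, e⟩ := h.exists_window i k
  exact ⟨l, h1, h2, by rwa [e, h.succ_eq e]⟩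

lemma sum_window (h : IsSimpleLoop p m) (x : Plane) (i : ℕ) :
    ∑ k ∈ Finset.Ico i (i + m), ang x (p k) (p (k + 1)) = tot p m x := by
  have h3 := h.three_le
  induction i with
  | zero => simp [tot, Finset.sum_range]
  | succ i ih =>
    rw [← ih, Finset.sum_eq_sum_Ico_succ_bot (a := i) (by omega), add_right_comm,
      Finset.sum_Ico_succ_top (by omega), h.per, add_right_comm, h.per, add_comm]

/-- A chord that meets the polygon only in its endpoints cuts off a simple polygon. -/
lemma isSimpleLoop_subchain (h : IsSimpleLoop p m) {i j : ℕ} (hij : i + 2 ≤ j) (hjm : j < i + m)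
    (hd : Disjoint (openSegment ℝ (p i) (p j)) (Bd p)) :
    IsSimpleLoop (subchain p i j) (j - i + 1) := by
  -- The open chord misses the polygon, so an edge can meet the closing chord only in an endpoint of
  -- the chord.
  have hclose : ∀ a z, i ≤ a → a < j → z ∈ segment ℝ (p a) (p (a + 1)) →
      z ∈ segment ℝ (p j) (p i) →
      p a = p j ∨ (z = p j ∧ p j = p (a + 1)) ∨ (z = p a ∧ p a = p i) := by
    intro a z ha haj hz hz'
    have hzB : z ∈ Bd p := edge_subset p a hz
    have hz2 : z = p j ∨ z = p i := by
      by_contra! hcon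
      rw [segment_symm] at hz'
      exact Set.disjoint_left.mp hd
        (mem_openSegment_of_ne_left_right hcon.2.symm hcon.1.symm hz') hzB
    rcases hz2 with rfl | rfl
    · rcases h.edges a j _ hz (left_mem_segment ℝ _ _) with e | ⟨e1, e2⟩ | ⟨e1, e2⟩
      · exact Or.inl e
      · exact Or.inr (Or.inl ⟨rfl, e2⟩)
      · exact Or.inl e1.symm
    · rcases h.edges a i _ hz (left_mem_segment ℝ _ _) with e | ⟨e1, e2⟩ | ⟨e1, e2⟩
      · exact Or.inr (Or.inr ⟨e.symm, e⟩)
      · have := h.window_inj (i := i) le_rfl (by omega) (by omega) (by omega) e2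
        omega
      · exact Or.inr (Or.inr ⟨e1, e1.symm⟩)
  refine ⟨by omega, subchain_per p i j, ?_, ?_⟩
  · intro k l e
    have hk := Nat.mod_lt k (show 0 < j - i + 1 by omega)
    have hl := Nat.mod_lt l (show 0 < j - i + 1 by omega)
    have := h.window_inj (i := i) (by omega) (by omega) (by omega) (by omega) e
    omega
  · intro k l z hk hl
    rcases subchain_edge (by omega : i < j) k with ⟨a, h1, h2, e1, e2⟩ | ⟨e1, e2⟩ <;>
    rcases subchain_edge (by omega : i < j) l with ⟨b, g1, g2, f1, f2⟩ | ⟨f1, f2⟩ <;>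
    rw [e1, e2] at hk <;> rw [f1, f2] at hl <;> rw [e1, e2, f1, f2]
    · exact h.edges a b z hk hl
    · exact hclose a z h1 h2 hk hl
    · rcases hclose b z g1 g2 hl hk with e | ⟨h1, h2⟩ | ⟨h1, h2⟩
      · exact Or.inl e.symm
      · exact Or.inr (Or.inr ⟨h1, h2⟩)
      · exact Or.inr (Or.inl ⟨h1, h2⟩)
    · exact Or.inl rfl

/-- The two chains run through the chord in opposite directions, so its angles cancel. No diagonal
is needed: this holds for any chord that misses `x`. -/
lemma tot_split (h : IsSimpleLoop p m) {i j : ℕ} (hij : i < j) (hjm : j < i + m) {x : Plane}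
    (hx : x ∉ segment ℝ (p i) (p j)) :
    tot p m x = tot (subchain p i j) (j - i + 1) x +
      tot (subchain p j (i + m)) (i + m - j + 1) x := by
  rw [tot_subchain hij, tot_subchain hjm, h.per, ang_swap (a := p i) (b := p j) hx,
    ← h.sum_window x i, ← Finset.sum_Ico_consecutive _ hij.le hjm.le]
  ring

end IsSimpleLoop

/-- The chord `p i p j` is a diagonal: its interior lies in the open polygon. -/
def IsDiag (p : ℕ → Plane) (i j : ℕ) : Prop := openSegment ℝ (p i) (p j) ⊆ opn (Bd p)

namespace IsDiag

variable {p : ℕ → Plane} {m i j : ℕ} {ε : ℝ}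

lemma disjoint (h : IsDiag p i j) : Disjoint (openSegment ℝ (p i) (p j)) (Bd p) :=
  Set.disjoint_left.mpr fun _ hx => (h hx).1

lemma symm (h : IsDiag p i j) : IsDiag p j i := by
  unfold IsDiag at *; rwa [openSegment_symm]

lemma symm_per (hp : IsSimpleLoop p m) (h : IsDiag p i j) : IsDiag p j (i + m) := by
  unfold IsDiag at *; rwa [hp.per, openSegment_symm]

end IsDiag

namespace IsOrientedLoop

variable {p : ℕ → Plane} {m i j : ℕ} {ε : ℝ}

/-- At a point just to the left of the chord, the jump across the chord gives the first part the
total angle `0` or `-2π` according as its sign is `1` or `-1`, and the second part `2π` or `0`. The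
sum must be `2πε`, which forces both signs to be `ε`. -/
lemma orientation_subchains (h : IsOrientedLoop p m ε) (hij : i + 2 ≤ j) (hjm : j + 2 ≤ i + m)
    (hd : IsDiag p i j) : IsOrientedLoop (subchain p i j) (j - i + 1) ε ∧
      IsOrientedLoop (subchain p j (i + m)) (i + m - j + 1) ε := by
  have s1 := h.isSimpleLoop_subchain hij (by omega) hd.disjoint
  have s2 := h.isSimpleLoop_subchain (i := j) (j := i + m) (by omega) (by omega)
    (hd.symm_per h.toIsSimpleLoop).disjoint
  obtain ⟨ε1, o1⟩ := s1.exists_isOrientedLoop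
  obtain ⟨ε2, o2⟩ := s2.exists_isOrientedLoop
  have hne : p i ≠ p j := by
    intro e
    have := h.window_inj (i := i) le_rfl (by omega) (by omega) (by omega) e
    omega
  obtain ⟨z, hz⟩ : ∃ z, z ∈ openSegment ℝ (p i) (p j) := ⟨_, midpoint_mem_openSegment _ _⟩
  have hz0 := orient_of_mem_segment (openSegment_subset_segment ℝ _ _ hz)
  obtain ⟨r1, hr1, hoff1, -, hj1⟩ := s1.jump (k := j - i) (z := z) (by
    rwa [subchain_last (by omega), subchain_close, openSegment_symm])
  obtain ⟨r2, hr2, hoff2, -, hj2⟩ := s2.jump (k := i + m - j) (z := z) (by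
    rwa [subchain_last (by omega), subchain_close, h.per])
  rw [subchain_last (by omega), subchain_close] at hoff1 hj1
  rw [subchain_last (by omega), subchain_close, h.per] at hoff2 hj2
  obtain ⟨r3, hr3, hop⟩ := Metric.isOpen_iff.mp (isOpen_opn h.isClosed_Bd) z (hd hz)
  have hdp := dotp_self_pos (sub_ne_zero.mpr hne.symm)
  set d : Plane := (-(p j - p i).2, (p j - p i).1) with hdd
  have hcd : 0 < cross (p j - p i) d := by
    convert hdp using 1; simp [cross, dotp, hdd]; ring
  have hcd' : cross (p j - p i) (-d) = -cross (p j - p i) d := by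
    simp [cross]; ring
  have hb : ∀ r > 0, ∀ v : Plane, ∀ᶠ t : ℝ in 𝓝[>] 0, z + t • v ∈ Metric.ball z r :=
    fun r hr v => eventually_ball (Metric.mem_ball_self hr)
  obtain ⟨t, ⟨⟨⟨b1, b2⟩, b3⟩, b1', b2'⟩, ht⟩ := ((((hb r1 hr1 d).and (hb r2 hr2 d)).and
    (hb r3 hr3 d)).and ((hb r1 hr1 (-d)).and (hb r2 hr2 (-d)))).and self_mem_nhdsWithin |>.exists
  have ht' : 0 < t := ht
  have ox : 0 < orient (p i) (p j) (z + t • d) := by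
    rw [orient_add_smul, hz0]; nlinarith [mul_pos ht' hcd]
  have oy : orient (p i) (p j) (z + t • -d) < 0 := by
    rw [orient_add_smul, hz0, hcd']; nlinarith [mul_pos ht' hcd]
  have e2 := hj2 _ b2 _ b2' ox oy
  have e1 := hj1 _ b1' _ b1 (by rw [orient_swap]; linarith) (by rw [orient_swap]; linarith)
  have nx1 := hoff1 _ b1 (by rw [orient_swap]; exact neg_ne_zero.mpr ox.ne')
  have ny1 := hoff1 _ b1' (by rw [orient_swap]; exact neg_ne_zero.mpr oy.ne)
  have nx2 := hoff2 _ b2 ox.ne'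
  have ny2 := hoff2 _ b2' oy.ne
  have hsum := h.tot_split (i := i) (j := j) (by omega) (by omega) (x := z + t • d)
    (fun hs => ox.ne' (orient_of_mem_segment hs))
  rw [h.tot_inside _ (hop b3)] at hsum
  have hpi := Real.pi_pos
  have hh1 : (ε1 = 1 ∧ tot (subchain p i j) (j - i + 1) (z + t • d) = 0) ∨
      (ε1 = -1 ∧ tot (subchain p i j) (j - i + 1) (z + t • d) = -(2 * Real.pi)) := by
    rcases o1.sign with rfl | rfl
    · left
      refine ⟨rfl, ?_⟩
      rcases o1.tot_dichotomy nx1 with f | f <;> rcases o1.tot_dichotomy ny1 with g | g <;> linarith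
    · right
      refine ⟨rfl, ?_⟩
      rcases o1.tot_dichotomy nx1 with f | f <;> rcases o1.tot_dichotomy ny1 with g | g <;> linarith
  have hh2 : (ε2 = 1 ∧ tot (subchain p j (i + m)) (i + m - j + 1) (z + t • d) = 2 * Real.pi) ∨
      (ε2 = -1 ∧ tot (subchain p j (i + m)) (i + m - j + 1) (z + t • d) = 0) := by
    rcases o2.sign with rfl | rfl
    · left
      refine ⟨rfl, ?_⟩
      rcases o2.tot_dichotomy nx2 with f | f <;> rcases o2.tot_dichotomy ny2 with g | g <;> linarith
    · right
      refine ⟨rfl, ?_⟩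
      rcases o2.tot_dichotomy nx2 with f | f <;> rcases o2.tot_dichotomy ny2 with g | g <;> linarith
  have : ε1 = ε ∧ ε2 = ε := by
    rcases h.sign with rfl | rfl <;> rcases hh1 with ⟨rfl, f⟩ | ⟨rfl, f⟩ <;>
      rcases hh2 with ⟨rfl, g⟩ | ⟨rfl, g⟩ <;>
      first
      | exact ⟨rfl, rfl⟩
      | (exfalso; rw [f, g] at hsum; linarith)
  obtain ⟨rfl, rfl⟩ := this
  exact ⟨o1, o2⟩

lemma subchain_isOrientedLoop (h : IsOrientedLoop p m ε) (hij : i + 2 ≤ j) (hjm : j + 2 ≤ i + m)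
    (hd : IsDiag p i j) : IsOrientedLoop (subchain p i j) (j - i + 1) ε :=
  (h.orientation_subchains hij hjm hd).1

lemma chord_subset_Bd_subchain (hij : i < j) :
    segment ℝ (p i) (p j) ⊆ Bd (subchain p i j) :=
  fun _ hx => (mem_Bd_subchain hij).mpr (Or.inr hx)

lemma mem_Bd_of_subchains (h : IsOrientedLoop p m ε) (hij : i < j) (hjm : j < i + m) {x : Plane} :
    x ∈ Bd p → x ∈ Bd (subchain p i j) ∨ x ∈ Bd (subchain p j (i + m)) := by
  intro hx
  obtain ⟨k, h1, h2, hk⟩ := h.mem_Bd_window i hx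
  rcases Nat.lt_or_ge k j with hkj | hkj
  · exact Or.inl ((mem_Bd_subchain hij).mpr (Or.inl ⟨k, h1, hkj, hk⟩))
  · exact Or.inr ((mem_Bd_subchain hjm).mpr (Or.inl ⟨k, hkj, h2, hk⟩))

/-- With respect to the whole polygon, a common inner point would have total angle `4πε`. -/
lemma disjoint_opn_subchains (h : IsOrientedLoop p m ε) (hij : i + 2 ≤ j) (hjm : j + 2 ≤ i + m)
    (hd : IsDiag p i j) :
    Disjoint (opn (Bd (subchain p i j))) (opn (Bd (subchain p j (i + m)))) := by
  obtain ⟨o1, o2⟩ := h.orientation_subchains hij hjm hd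
  rw [Set.disjoint_left]
  intro x h1 h2
  have hxB : x ∉ Bd p := fun hx =>
    (h.mem_Bd_of_subchains (by omega) (by omega) hx).elim h1.1 h2.1
  have hxc : x ∉ segment ℝ (p i) (p j) := fun hx =>
    h1.1 (chord_subset_Bd_subchain (by omega) hx)
  have := h.tot_split (by omega) (by omega) hxc
  rw [o1.tot_inside x h1, o2.tot_inside x h2] at this
  have hpi := Real.pi_pos
  rcases h.tot_dichotomy hxB with e | e <;> rw [e] at this <;>
    rcases h.sign with rfl | rfl <;> linarith

/-- The two parts of a polygon on either side of a diagonal share only the diagonal. -/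
lemma cls_inter_subset (h : IsOrientedLoop p m ε) (hij : i + 2 ≤ j) (hjm : j + 2 ≤ i + m)
    (hd : IsDiag p i j) {x : Plane} (h1 : x ∈ cls (Bd (subchain p i j)))
    (h2 : x ∈ cls (Bd (subchain p j (i + m)))) : x ∈ segment ℝ (p i) (p j) := by
  obtain ⟨o1, o2⟩ := h.orientation_subchains hij hjm hd
  have hdis := h.disjoint_opn_subchains hij hjm hd
  -- A boundary point of one part is a limit of inner points of this part, so it is not in the open
  -- region of the other part.
  have key : ∀ {A B : Set Plane}, IsOpen (opn B) → A ⊆ closure (opn A) →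
      Disjoint (opn A) (opn B) → x ∈ A → x ∈ opn B → False := by
    intro A B hBo hA hAB hxA hxB
    obtain ⟨y, hy1, hy2⟩ := mem_closure_iff.mp (hA hxA) _ hBo hxB
    exact Set.disjoint_left.mp hAB hy2 hy1
  rcases h1 with h1 | h1 <;> rcases h2 with h2 | h2
  · rcases (mem_Bd_subchain (by omega)).mp h1 with ⟨k, k1, k2, hk⟩ | hk
    · rcases (mem_Bd_subchain (by omega)).mp h2 with ⟨l, l1, l2, hl⟩ | hl
      · rcases h.edges k l x hk hl with e | ⟨e1, e2⟩ | ⟨e1, e2⟩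
        · have := h.window_inj (i := i) k1 (by omega) (by omega) (by omega) e
          omega
        · have := h.window_inj (i := i) (by omega) (by omega) (by omega) (by omega) e2
          obtain rfl : l = j := by omega
          rw [e1]; exact right_mem_segment ℝ _ _
        · rw [← h.per k] at e2
          have := h.window_inj (i := j) (by omega) (by omega) (by omega) (by omega) e2
          obtain rfl : k = i := by omega
          rw [e1]; exact left_mem_segment ℝ _ _
      · rwa [h.per, segment_symm] at hl
    · exact hk
  · exact (key (isOpen_opn o2.isClosed_Bd) o1.Bd_subset_closure_opn hdis h1 h2).elim
  · exact (key (isOpen_opn o1.isClosed_Bd) o2.Bd_subset_closure_opn hdis.symm h2 h1).elim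
  · exact (Set.disjoint_left.mp hdis h1 h2).elim

/-- At an inner point the sum of the two partial angles is not zero, so one of them is not. -/
lemma cls_subset_union (h : IsOrientedLoop p m ε) (hij : i + 2 ≤ j) (hjm : j + 2 ≤ i + m)
    (hd : IsDiag p i j) :
    cls (Bd p) ⊆ cls (Bd (subchain p i j)) ∪ cls (Bd (subchain p j (i + m))) := by
  obtain ⟨o1, o2⟩ := h.orientation_subchains hij hjm hd
  rintro x (hx | hx)
  · exact (h.mem_Bd_of_subchains (by omega) (by omega) hx).imp Or.inl Or.inl
  · by_cases h1 : x ∈ Bd (subchain p i j)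
    · exact Or.inl (Or.inl h1)
    by_cases h2 : x ∈ Bd (subchain p j (i + m))
    · exact Or.inr (Or.inl h2)
    have hxc : x ∉ segment ℝ (p i) (p j) := fun hx => h1 (chord_subset_Bd_subchain (by omega) hx)
    have hs := h.tot_split (by omega) (by omega) hxc
    by_cases t1 : tot (subchain p i j) (j - i + 1) x = 0
    · refine Or.inr (Or.inr (o2.mem_opn_of_tot_ne_zero h2 ?_))
      rw [t1, zero_add] at hs
      rw [← hs]; exact h.tot_ne hx
    · exact Or.inl (Or.inr (o1.mem_opn_of_tot_ne_zero h1 t1))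

/-- A point inside one part is outside the other, whose total angle vanishes there, so the angles of
this part and of the whole polygon agree. -/
lemma opn_subchain_subset (h : IsOrientedLoop p m ε) (hij : i + 2 ≤ j) (hjm : j + 2 ≤ i + m)
    (hd : IsDiag p i j) : opn (Bd (subchain p i j)) ⊆ opn (Bd p) := by
  obtain ⟨o1, o2⟩ := h.orientation_subchains hij hjm hd
  intro x hx
  have hxc : x ∉ segment ℝ (p i) (p j) := fun hx' =>
    hx.1 (chord_subset_Bd_subchain (by omega) hx')
  have hx2 : x ∉ cls (Bd (subchain p j (i + m))) := fun h2 =>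
    hxc (h.cls_inter_subset hij hjm hd (Or.inr hx) h2)
  have hxB : x ∉ Bd p := fun hB =>
    (h.mem_Bd_of_subchains (by omega) (by omega) hB).elim hx.1 (fun h2 => hx2 (Or.inl h2))
  apply h.mem_opn_of_tot_ne_zero hxB
  rw [h.tot_split (by omega) (by omega) hxc, o2.tot_outside x hx2, add_zero]
  exact o1.tot_ne hx

end IsOrientedLoop


/-! ### Triangles -/

/-- The total angle swept by the triangle `a b c`. -/
noncomputable def triTot (x a b c : Plane) : ℝ := ang x a b + ang x b c + ang x c a

lemma triTot_eq_tot (x a b c : Plane) :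
    triTot x a b c = tot (fun k => if k % 3 = 0 then a else if k % 3 = 1 then b else c) 3 x := by
  simp [tot, triTot, Finset.sum_range_succ]

lemma triTot_int {x a b c : Plane} (ha : x ≠ a) (hb : x ≠ b) (hc : x ≠ c) :
    ∃ N : ℤ, triTot x a b c = N * (2 * Real.pi) := by
  rw [triTot_eq_tot]
  apply tot_int
  · simp
  · intro k
    split_ifs
    exacts [ha.symm, hb.symm, hc.symm]

lemma ang_neg {x a b : Plane} (h : orient a b x < 0) : ang x a b < 0 ∧ -Real.pi < ang x a b := by
  have hx : x ∉ segment ℝ a b := fun hx => h.ne (orient_of_mem_segment hx)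
  have h' : 0 < orient b a x := by rw [orient_swap]; linarith
  have := ang_pos h'
  rw [ang_swap hx] at this
  constructor <;> linarith

/-- The three angles have the same sign and are smaller than `π` in absolute value. Their sum is a
multiple of `2π` strictly between `0` and `3π`, up to sign. -/
lemma triTot_inside {x a b c : Plane} {s : ℝ} (hs : s = 1 ∨ s = -1)
    (h0 : 0 < s * orient a b x) (h1 : 0 < s * orient b c x) (h2 : 0 < s * orient c a x) :
    triTot x a b c = s * (2 * Real.pi) := by
  have ne : ∀ {u v : Plane}, 0 < s * orient u v x → x ≠ u := by
    rintro u v h rfl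
    rw [orient_self_left, mul_zero] at h
    exact lt_irrefl _ h
  obtain ⟨N, hN⟩ := triTot_int (ne h0) (ne h1) (ne h2)
  have hpi := Real.pi_pos
  rw [hN]
  unfold triTot at hN
  rcases hs with rfl | rfl
  · rw [one_mul] at h0 h1 h2
    have a0 := ang_pos h0
    have a1 := ang_pos h1
    have a2 := ang_pos h2
    have hN1 : (0:ℝ) < N := by by_contra! hle; nlinarith
    have hN2 : (N:ℝ) < 2 := by by_contra! hle; nlinarith
    have : N = 1 := by
      have h1 : (0:ℤ) < N := by exact_mod_cast hN1
      have h2 : N < 2 := by exact_mod_cast hN2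
      omega
    rw [this]; simp
  · have a0 := ang_neg (show orient a b x < 0 by linarith)
    have a1 := ang_neg (show orient b c x < 0 by linarith)
    have a2 := ang_neg (show orient c a x < 0 by linarith)
    have hN1 : (N:ℝ) < 0 := by by_contra! hle; nlinarith
    have hN2 : (-2:ℝ) < N := by by_contra! hle; nlinarith
    have : N = -1 := by
      have h1 : N < 0 := by exact_mod_cast hN1
      have h2 : -2 < N := by exact_mod_cast hN2
      omega
    rw [this]; simp

lemma triTot_rotate (x a b c : Plane) : triTot x b c a = triTot x a b c := by
  unfold triTot; ring

lemma triTot_outside {x a b c : Plane} {s : ℝ}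
    (habc : 0 < s * orient a b c) (h : s * orient a b x < 0) : triTot x a b c = 0 := by
  rw [triTot_eq_tot]
  -- The normal to the line `a b` on the side of `c`.
  apply tot_eq_zero_of_halfplane (u := s • (-(b - a).2, (b - a).1))
  · simp
  have e : ∀ y : Plane, dotp (s • (-(b - a).2, (b - a).1)) (y - x) =
      s * orient a b y - s * orient a b x := by
    intro y; simp [dotp, orient]; ring
  intro k _
  split_ifs
  · rw [e, orient_self_left]; linarith
  · rw [e, orient_self_right]; linarith
  · rw [e]; linarith

/-! ### Existence of a diagonal -/

namespace IsOrientedLoop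

variable {p : ℕ → Plane} {m : ℕ} {ε : ℝ}

/-- A point of a corner triangle beyond all the other vertices lies inside. -/
lemma mem_opn_of_extreme (h : IsOrientedLoop p m ε) (hm : 4 ≤ m) {ν x : Plane}
    {s : ℝ} (hs : s = 1 ∨ s = -1) (hν : ∀ k, p k ≠ p 1 → dotp ν (p k) < dotp ν x)
    (h0 : 0 < s * orient (p 0) (p 1) x) (h1 : 0 < s * orient (p 1) (p 2) x)
    (h2 : 0 < s * orient (p 2) (p 0) x) (hx : x ∉ Bd p) : x ∈ opn (Bd p) := by
  apply h.mem_opn_of_tot_ne_zero hx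
  have hxc : x ∉ segment ℝ (p 0) (p 2) := by
    intro hc
    rw [segment_symm] at hc
    rw [orient_of_mem_segment hc, mul_zero] at h2
    exact lt_irrefl _ h2
  -- The corner triangle contributes `±2π`, while the rest of the chain lies strictly behind `x`
  -- with respect to `ν` and contributes nothing. The chord from `p 0` to `p 2` need not be a
  -- diagonal.
  rw [h.tot_split (i := 0) (j := 2) (by omega) (by omega) hxc]
  have e1 : tot (subchain p 0 2) (2 - 0 + 1) x = triTot x (p 0) (p 1) (p 2) := by
    rw [tot_subchain (by omega)]
    have : Finset.Ico 0 2 = {0, 1} := by decide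
    rw [this]; simp [triTot]
  have e2 : tot (subchain p 2 (0 + m)) (0 + m - 2 + 1) x = 0 := by
    apply tot_eq_zero_of_halfplane (u := -ν)
    · rw [subchain_close, subchain_of_le (by omega)]
    · intro k hk
      have key : ∀ y, p y ≠ p 1 → 0 < dotp (-ν) (p y - x) := by
        intro y hy
        have := hν y hy
        have e : dotp (-ν) (p y - x) = dotp ν x - dotp ν (p y) := by simp [dotp]; ring
        rw [e]; linarith
      rcases Nat.lt_or_ge (0 + m - 2) k with hk' | hk'
      · obtain rfl : k = 0 + m - 2 + 1 := by omega
        rw [subchain_close]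
        exact key 2 (h.ne_succ 1).symm
      · rw [subchain_of_le hk']
        apply key
        intro e
        have := h.window_inj (i := 1) (by omega) (by omega) (by omega) (by omega) e
        omega
  rw [e1, e2, triTot_inside hs h0 h1 h2, add_zero]
  rcases hs with rfl | rfl <;> simp [Real.pi_ne_zero]

end IsOrientedLoop

/-- The coordinates of `x` with respect to the triangle `a v b`, scaled by its signed area. -/
lemma bary_comb (a v b x : Plane) : orient a v b • x =
    orient v b x • a + orient a v x • b + orient b a x • v := by
  ext
  · simp [orient]; ring
  · simp [orient]; ring

lemma bary_sum (a v b x : Plane) :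
    orient v b x + orient a v x + orient b a x = orient a v b := by
  unfold orient; ring

lemma mem_segment_of_bary {a v b x : Plane} {s : ℝ} (hD : 0 < s * orient a v b)
    (h1 : s * orient v b x = 0) (h2 : 0 ≤ s * orient a v x) (h3 : 0 ≤ s * orient b a x) :
    x ∈ segment ℝ v b := by
  have hs : s ≠ 0 := by rintro rfl; simp at hD
  have hDne : orient a v b ≠ 0 := by intro h; simp [h] at hD
  have h1' : orient v b x = 0 := (mul_eq_zero.mp h1).resolve_left hs
  have e := bary_comb a v b x
  have e' := bary_sum a v b x
  rw [h1', zero_add] at e'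
  rw [h1', zero_smul, zero_add] at e
  refine ⟨s * orient b a x / (s * orient a v b), s * orient a v x / (s * orient a v b),
    by positivity, by positivity, ?_, ?_⟩
  · rw [← add_div, ← mul_add, add_comm, e', div_self hD.ne']
  · have hx : x = (orient a v b)⁻¹ • (orient a v x • b + orient b a x • v) := by
      rw [← e, smul_smul, inv_mul_cancel₀ hDne, one_smul]
    rw [mul_div_mul_left _ _ hs, mul_div_mul_left _ _ hs]
    conv_rhs => rw [hx]
    rw [smul_add, smul_smul, smul_smul, add_comm, div_eq_inv_mul, div_eq_inv_mul]

/-- Leaving a corner triangle without approaching its base, one crosses one of the legs. -/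
lemma exit_triangle {a v b w P : Plane} {s : ℝ} (hD : 0 < s * orient a v b)
    (ha : 0 < s * orient v b w) (hb : 0 < s * orient a v w) (hc : 0 ≤ s * orient b a w)
    (hP : s * orient b a w ≤ s * orient b a P)
    (hout : s * orient v b P < 0 ∨ s * orient a v P < 0) :
    ∃ y ∈ segment ℝ w P, s * orient b a w ≤ s * orient b a y ∧
      (y ∈ segment ℝ v b ∨ y ∈ segment ℝ a v) := by
  have aff : ∀ (t : ℝ) (u u' : Plane), s * orient u u' (w + t • (P - w)) =
      (1 - t) * (s * orient u u' w) + t * (s * orient u u' P) := by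
    intro t u u'; simp [orient]; ring
  -- the first exit through the line `v b` or `a v`
  have key : ∀ {A B A' B' : ℝ}, 0 < A → 0 < A' → B < 0 →
      ∃ t : ℝ, 0 ≤ t ∧ t ≤ 1 ∧ (((1 - t) * A + t * B = 0 ∧ 0 ≤ (1 - t) * A' + t * B') ∨
        (0 ≤ (1 - t) * A + t * B ∧ (1 - t) * A' + t * B' = 0)) := by
    intro A B A' B' hA hA' hB
    have ht : (1 - A / (A - B)) * A + A / (A - B) * B = 0 := by
      have : A - B ≠ 0 := by linarith
      field_simp; ring
    -- If the second coordinate is already negative when the first one vanishes, then it vanishes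
    -- earlier, and that point is taken instead.
    by_cases h' : 0 ≤ (1 - A / (A - B)) * A' + A / (A - B) * B'
    · exact ⟨A / (A - B), by apply div_nonneg <;> linarith,
        div_le_one_of_le₀ (by linarith) (by linarith), Or.inl ⟨ht, h'⟩⟩
    · have hAB : 0 < A - B := by linarith
      have hB' : B' < 0 := by
        by_contra! hB'
        apply h'
        have h1 : 0 ≤ 1 - A / (A - B) := by
          rw [sub_nonneg]; exact div_le_one_of_le₀ (by linarith) (by linarith)
        positivity
      have hAB' : 0 < A' - B' := by linarith
      refine ⟨A' / (A' - B'), by positivity, div_le_one_of_le₀ (by linarith) (by linarith),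
        Or.inr ⟨?_, by field_simp; ring⟩⟩
      have e1 : (1 - A / (A - B)) * A' + A / (A - B) * B' = (A * B' - A' * B) / (A - B) := by
        field_simp; ring
      have e2 : (1 - A' / (A' - B')) * A + A' / (A' - B') * B = -(A * B' - A' * B) / (A' - B') := by
        field_simp; ring
      rw [e1, not_le, div_neg_iff] at h'
      rw [e2]
      apply div_nonneg _ hAB'.le
      rcases h' with h' | h' <;> linarith
  obtain ⟨t, ht0, ht1, ht⟩ : ∃ t : ℝ, 0 ≤ t ∧ t ≤ 1 ∧
      ((s * orient v b (w + t • (P - w)) = 0 ∧ 0 ≤ s * orient a v (w + t • (P - w))) ∨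
      (0 ≤ s * orient v b (w + t • (P - w)) ∧ s * orient a v (w + t • (P - w)) = 0)) := by
    simp only [aff]
    rcases hout with ho | ho
    · exact key ha hb ho
    · obtain ⟨t, h0, h1, h⟩ := key (A := s * orient a v w) (B := s * orient a v P)
        (A' := s * orient v b w) (B' := s * orient v b P) hb ha ho
      exact ⟨t, h0, h1, h.symm.imp And.symm And.symm⟩
  have hcy : s * orient b a w ≤ s * orient b a (w + t • (P - w)) := by
    rw [aff]; nlinarith
  refine ⟨w + t • (P - w), mem_segment_iff_smul.mpr ⟨t, ht0, ht1, rfl⟩, hcy, ?_⟩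
  rcases ht with ⟨h1, h2⟩ | ⟨h1, h2⟩
  · exact Or.inl (mem_segment_of_bary hD h1 h2 (hc.trans hcy))
  · right
    have hD' : 0 < s * orient b a v := by rwa [← orient_rotate b a v]
    apply mem_segment_of_bary (a := b) (v := a) (b := v) hD' h2 (hc.trans hcy) h1

namespace IsSimpleLoop

variable {p : ℕ → Plane} {m : ℕ}

lemma edge_eq (h : IsSimpleLoop p m) {j k : ℕ} (e : p j = p k) :
    segment ℝ (p j) (p (j + 1)) = segment ℝ (p k) (p (k + 1)) := by rw [e, h.succ_eq e]

lemma pred_eq (h : IsSimpleLoop p m) {j k : ℕ} (e : p (j + 1) = p (k + 1)) : p j = p k :=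
  h.eq_iff.mpr (Nat.ModEq.add_right_cancel' 1 (h.eq_iff.mp e))

lemma orient_edge_eq_zero (h : IsSimpleLoop p m) {j k : ℕ} {w : Plane} (e : p j = p k)
    (hw : w ∈ segment ℝ (p j) (p (j + 1))) : orient (p k) (p (k + 1)) w = 0 := by
  rw [h.edge_eq e] at hw
  exact orient_of_mem_segment hw

/-- A point of the corner triangle at `p 1` nearer to the corner than all other vertices in the
triangle is not on the polygon. -/
lemma notMem_corner (h : IsSimpleLoop p m) {s : ℝ}
    (hD : 0 < s * orient (p 0) (p 1) (p 2)) {w : Plane} (ha : 0 < s * orient (p 1) (p 2) w)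
    (hb : 0 < s * orient (p 0) (p 1) w) (hc : 0 < s * orient (p 2) (p 0) w)
    (hV : ∀ k, p k ≠ p 1 → 0 ≤ s * orient (p 1) (p 2) (p k) →
      0 ≤ s * orient (p 0) (p 1) (p k) → s * orient (p 2) (p 0) (p k) < s * orient (p 2) (p 0) w) :
    w ∉ Bd p := by
  intro hwB
  obtain ⟨j, hj⟩ := mem_Bd.mp hwB
  have n0 : p j ≠ p 0 := fun e => by
    rw [h.orient_edge_eq_zero e hj, mul_zero] at hb; exact lt_irrefl _ hb
  have n1 : p j ≠ p 1 := fun e => by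
    rw [h.orient_edge_eq_zero e hj, mul_zero] at ha; exact lt_irrefl _ ha
  -- The distance from the base is affine along the edge, so one end `P` of the edge through `w` is
  -- at least as far from the base as `w`. By `hV` this end is outside the triangle, so the edge
  -- crosses a leg on the way to it, which a simple polygon does not allow.
  obtain ⟨P, hPj, hPv, hP⟩ : ∃ P ∈ segment ℝ (p j) (p (j + 1)), (∃ l, P = p l ∧ p l ≠ p 1) ∧
      s * orient (p 2) (p 0) w ≤ s * orient (p 2) (p 0) P := by
    by_contra! hcon
    have c1 := hcon (p j) (left_mem_segment ℝ _ _) ⟨j, rfl, n1⟩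
    have c2 := hcon (p (j + 1)) (right_mem_segment ℝ _ _) ⟨j + 1, rfl, fun e =>
      n0 (h.pred_eq e)⟩
    obtain ⟨x, y, hx, hy, hxy, rfl⟩ := hj
    rw [orient_comb _ _ _ _ hxy, mul_add] at c1 c2
    have hle : (x + y) * (s * (x * orient (p 2) (p 0) (p j)) +
      s * (y * orient (p 2) (p 0) (p (j + 1)))) ≤ 0 + (s * (x * orient (p 2) (p 0) (p j)) +
      s * (y * orient (p 2) (p 0) (p (j + 1)))) := by rw [hxy]; linarith
    rcases hx.eq_or_lt with rfl | hx
    · obtain rfl : y = 1 := by linarith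
      simp at c2
    · nlinarith
  obtain ⟨l, rfl, hl⟩ := hPv
  have hout : s * orient (p 1) (p 2) (p l) < 0 ∨ s * orient (p 0) (p 1) (p l) < 0 := by
    by_contra! hcon
    have := hV l hl hcon.1 hcon.2
    linarith
  obtain ⟨y, hy, hyc, hy'⟩ := exit_triangle hD ha hb hc.le hP hout
  have hyj : y ∈ segment ℝ (p j) (p (j + 1)) := (convex_segment _ _).segment_subset hj hPj hy
  have hyc' : 0 < s * orient (p 2) (p 0) y := lt_of_lt_of_le hc hyc
  have y2 : y ≠ p 2 := by
    rintro rfl; rw [orient_self_left, mul_zero] at hyc'; exact lt_irrefl _ hyc'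
  have y0 : y ≠ p 0 := by
    rintro rfl; rw [orient_self_right, mul_zero] at hyc'; exact lt_irrefl _ hyc'
  rcases hy' with hy' | hy'
  · rcases h.edges j 1 y hyj hy' with e | ⟨e1, e2⟩ | ⟨e1, e2⟩
    · exact n1 e
    · exact n0 (h.pred_eq e2.symm)
    · exact y2 (e1.trans e2)
  · rcases h.edges j 0 y hyj hy' with e | ⟨e1, e2⟩ | ⟨e1, e2⟩
    · exact n0 e
    · exact y0 e1
    · exact n1 e2

/-- If the corner triangle at `p 1` contains no other vertices, its base does not meet the
polygon. -/
lemma notMem_base (h : IsSimpleLoop p m) (hm : 4 ≤ m) {s : ℝ}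
    (hD : 0 < s * orient (p 0) (p 1) (p 2)) {w : Plane} (ha : 0 < s * orient (p 1) (p 2) w)
    (hb : 0 < s * orient (p 0) (p 1) w) (hc : s * orient (p 2) (p 0) w = 0)
    (hV : ∀ k, p k ≠ p 0 → p k ≠ p 1 → p k ≠ p 2 → 0 ≤ s * orient (p 1) (p 2) (p k) →
      0 ≤ s * orient (p 0) (p 1) (p k) → s * orient (p 2) (p 0) (p k) < 0) :
    w ∉ Bd p := by
  intro hwB
  obtain ⟨j, hj⟩ := mem_Bd.mp hwB
  have n0 : p j ≠ p 0 := fun e => by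
    rw [h.orient_edge_eq_zero e hj, mul_zero] at hb; exact lt_irrefl _ hb
  have n1 : p j ≠ p 1 := fun e => by
    rw [h.orient_edge_eq_zero e hj, mul_zero] at ha; exact lt_irrefl _ ha
  have w0 : w ≠ p 0 := by
    rintro rfl; rw [orient_self_left, mul_zero] at hb; exact lt_irrefl _ hb
  have w2 : w ≠ p 2 := by
    rintro rfl; rw [orient_self_right, mul_zero] at ha; exact lt_irrefl _ ha
  have n1' : p (j + 1) ≠ p 1 := fun e => n0 (h.pred_eq e)
  have n2' : p (j + 1) ≠ p 2 := fun e => n1 (h.pred_eq e)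
  -- an outer endpoint on the side of the corner cannot exist
  have key : ∀ l, (p l = p j ∨ p l = p (j + 1)) → p l ≠ p 0 → p l ≠ p 2 →
      (∀ y ∈ segment ℝ w (p l), y ≠ p 0 ∧ y ≠ p 2) →
      s * orient (p 2) (p 0) (p l) < 0 := by
    intro l hl l0 l2 hseg
    by_contra! hge
    have hlj : p l ∈ segment ℝ (p j) (p (j + 1)) := by
      rcases hl with e | e <;> rw [e]
      · exact left_mem_segment ℝ _ _
      · exact right_mem_segment ℝ _ _
    have l1 : p l ≠ p 1 := by rcases hl with e | e <;> rw [e] <;> assumption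
    have hout : s * orient (p 1) (p 2) (p l) < 0 ∨ s * orient (p 0) (p 1) (p l) < 0 := by
      by_contra! hcon
      have := hV l l0 l1 l2 hcon.1 hcon.2
      linarith
    obtain ⟨y, hy, hyc, hy'⟩ := exit_triangle hD ha hb hc.ge (by rw [hc]; exact hge) hout
    have hyj : y ∈ segment ℝ (p j) (p (j + 1)) := (convex_segment _ _).segment_subset hj hlj hy
    obtain ⟨y0, y2⟩ := hseg y hy
    rcases hy' with hy' | hy'
    · rcases h.edges j 1 y hyj hy' with e | ⟨e1, e2⟩ | ⟨e1, e2⟩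
      · exact n1 e
      · exact n0 (h.pred_eq e2.symm)
      · exact y2 (e1.trans e2)
    · rcases h.edges j 0 y hyj hy' with e | ⟨e1, e2⟩ | ⟨e1, e2⟩
      · exact n0 e
      · exact y0 e1
      · exact n1 e2
  have aff : ∀ (x y : ℝ) (u u' : Plane), x + y = 1 → s * orient u u' (x • p j + y • p (j + 1)) =
      x * (s * orient u u' (p j)) + y * (s * orient u u' (p (j + 1))) := by
    intro x y u u' hxy
    rw [orient_comb _ _ _ _ hxy]; ring
  -- the edge has no endpoint on the base
  have hv : ∀ k y, y ∈ segment ℝ (p j) (p (j + 1)) → y = p (k + 1) → p j = p (k + 1) ∨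
      p (j + 1) = p (k + 1) := by
    rintro k y hy rfl
    rcases h.vertex_edge hy with e | e
    · exact Or.inr (h.succ_eq e)
    · exact Or.inl e
  have per0 : p 0 = p (m - 1 + 1) := by rw [show m - 1 + 1 = m by omega, h.per_zero]
  obtain ⟨x, y, hx, hy, hxy, hw⟩ := hj
  have hj : w ∈ segment ℝ (p j) (p (j + 1)) := ⟨x, y, hx, hy, hxy, hw⟩
  have hx0 : p j = p 2 ∨ p (j + 1) = p 0 → 0 < x ∧ 0 < y := by
    intro hor
    constructor
    · refine lt_of_le_of_ne hx ?_
      rintro rfl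
      obtain rfl : y = 1 := by linarith
      simp only [zero_smul, one_smul, zero_add] at hw
      rcases hor with e | e
      · rw [← hw] at ha hb hc
        have hlt := key (j + 1) (Or.inr rfl) (fun e' => w0 (hw ▸ e')) n2' (by
          intro z hz
          rw [hw, segment_same, Set.mem_singleton_iff] at hz
          rw [hz]; exact ⟨w0, w2⟩)
        linarith
      · exact w0 (hw ▸ e)
    · refine lt_of_le_of_ne hy ?_
      rintro rfl
      obtain rfl : x = 1 := by linarith
      simp only [zero_smul, one_smul, add_zero] at hw
      rcases hor with e | e
      · exact w2 (hw ▸ e)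
      · rw [← hw] at ha hb hc
        have hlt := key j (Or.inl rfl) n0 (fun e' => w2 (hw ▸ e')) (by
          intro z hz
          rw [hw, segment_same, Set.mem_singleton_iff] at hz
          rw [hz]; exact ⟨w0, w2⟩)
        linarith
  have segmem : ∀ l, (p l = p j ∨ p l = p (j + 1)) → segment ℝ w (p l) ⊆
      segment ℝ (p j) (p (j + 1)) := by
    intro l hl
    apply (convex_segment _ _).segment_subset hj
    rcases hl with e | e <;> rw [e]
    · exact left_mem_segment ℝ _ _
    · exact right_mem_segment ℝ _ _
  by_cases c2 : p j = p 2
  · -- the edge leaves `p 2`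
    obtain ⟨hx1, hy1⟩ := hx0 (Or.inl c2)
    have a1 := aff x y (p 2) (p 0) hxy
    rw [hw, hc, c2, orient_self_left, mul_zero, mul_zero, zero_add] at a1
    have a2 := aff x y (p 1) (p 2) hxy
    rw [hw, c2, orient_self_right, mul_zero, mul_zero, zero_add] at a2
    -- An edge that leaves `p 2` and contains the point `w` of the base runs along the line of the
    -- base, so `key` does not leave room for its other end.
    have hz : s * orient (p 2) (p 0) (p (j + 1)) = 0 := by
      rcases mul_eq_zero.mp a1.symm with e | e
      · linarith
      · exact e
    have hne : p (j + 1) ≠ p 0 := by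
      intro e
      have e' := h.succ_eq c2
      rw [e, per0] at e'
      have := h.window_inj (i := 1) (by omega) (by omega) (by omega) (by omega) e'
      omega
    have hlt := key (j + 1) (Or.inr rfl) hne n2' (by
      intro z hz'
      have hzj := segmem (j + 1) (Or.inr rfl) hz'
      constructor
      · intro e
        rcases hv (m - 1) z hzj (e.trans per0) with e1 | e1
        · exact n0 (e1.trans per0.symm)
        · exact hne (e1.trans per0.symm)
      · rintro rfl
        obtain ⟨t, t0, t1, ht⟩ := mem_segment_iff_smul.mp hz'
        have e1 : s * orient (p 1) (p 2) (w + t • (p (j + 1) - w)) =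
            (1 - t) * (s * orient (p 1) (p 2) w) + t * (s * orient (p 1) (p 2) (p (j + 1))) := by
          simp [orient]; ring
        rw [← ht, orient_self_right, mul_zero] at e1
        have hpos : 0 < s * orient (p 1) (p 2) (p (j + 1)) := by
          by_contra! hneg
          nlinarith
        rcases t0.eq_or_lt with rfl | t0
        · linarith
        · nlinarith [mul_pos t0 hpos, mul_nonneg (sub_nonneg.2 t1) ha.le])
    linarith
  by_cases c0 : p (j + 1) = p 0
  · obtain ⟨hx1, hy1⟩ := hx0 (Or.inr c0)
    have a1 := aff x y (p 2) (p 0) hxy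
    rw [hw, hc, c0, orient_self_right, mul_zero, mul_zero, add_zero] at a1
    have a2 := aff x y (p 0) (p 1) hxy
    rw [hw, c0, orient_self_left, mul_zero, mul_zero, add_zero] at a2
    have hz : s * orient (p 2) (p 0) (p j) = 0 := by
      rcases mul_eq_zero.mp a1.symm with e | e
      · linarith
      · exact e
    have hlt := key j (Or.inl rfl) n0 c2 (by
      intro z hz'
      have hzj := segmem j (Or.inl rfl) hz'
      constructor
      · rintro rfl
        obtain ⟨t, t0, t1, ht⟩ := mem_segment_iff_smul.mp hz'
        have e1 : s * orient (p 0) (p 1) (w + t • (p j - w)) =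
            (1 - t) * (s * orient (p 0) (p 1) w) + t * (s * orient (p 0) (p 1) (p j)) := by
          simp [orient]; ring
        rw [← ht, orient_self_left, mul_zero] at e1
        have hpos : 0 < s * orient (p 0) (p 1) (p j) := by
          by_contra! hneg
          nlinarith
        rcases t0.eq_or_lt with rfl | t0
        · linarith
        · nlinarith [mul_pos t0 hpos, mul_nonneg (sub_nonneg.2 t1) hb.le]
      · intro e
        rcases hv 1 z hzj e with e1 | e1
        · exact c2 e1
        · exact n2' e1)
    linarith
  -- the edge avoids both ends of the base
  have hfar : ∀ l, (p l = p j ∨ p l = p (j + 1)) → ∀ y ∈ segment ℝ w (p l), y ≠ p 0 ∧ y ≠ p 2 := by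
    intro l hl z hz
    have hzj := segmem l hl hz
    constructor
    · intro e
      rcases hv (m - 1) z hzj (e.trans per0) with e1 | e1
      · exact n0 (e1.trans per0.symm)
      · exact c0 (e1.trans per0.symm)
    · intro e
      rcases hv 1 z hzj e with e1 | e1
      · exact c2 e1
      · exact n2' e1
  -- Both ends are strictly beyond the base, so no point of the edge is on it.
  have k1 := key j (Or.inl rfl) n0 c2 (hfar j (Or.inl rfl))
  have k2 := key (j + 1) (Or.inr rfl) c0 n2' (hfar (j + 1) (Or.inr rfl))
  have a1 := aff x y (p 2) (p 0) hxy
  rw [hw, hc] at a1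
  rcases hx.eq_or_lt with rfl | hx
  · obtain rfl : y = 1 := by linarith
    linarith
  · nlinarith

end IsSimpleLoop


lemma orient_lerp (a b x y : Plane) (t : ℝ) :
    orient a b (x + t • (y - x)) = (1 - t) * orient a b x + t * orient a b y := by
  simp [orient]; ring

lemma convex_mul_orient_pos (s : ℝ) (a b : Plane) : Convex ℝ {y | 0 < s * orient a b y} := by
  intro x hx y hy t u ht hu htu
  simp only [Set.mem_ofPred_eq] at hx hy ⊢
  rw [orient_comb _ _ _ _ htu]
  rcases ht.eq_or_lt with rfl | ht
  · obtain rfl : u = 1 := by linarith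
    simpa using hy
  · nlinarith [mul_nonneg hu hy.le, mul_pos ht hx]

lemma convex_mul_orient_nonneg (s : ℝ) (a b : Plane) : Convex ℝ {y | 0 ≤ s * orient a b y} := by
  intro x hx y hy t u ht hu htu
  simp only [Set.mem_ofPred_eq] at hx hy ⊢
  rw [orient_comb _ _ _ _ htu]
  nlinarith [mul_nonneg hu hy, mul_nonneg ht hx]

namespace IsOrientedLoop

variable {p : ℕ → Plane} {m : ℕ} {ε : ℝ}

/-- Just inside a convex extreme corner there are points of the polygon. -/
lemma exists_mem_opn_near (h : IsOrientedLoop p m ε) (hm : 4 ≤ m)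
    (hext : ∀ k, p k ≠ p 1 → dotp (p 1) (p k) < dotp (p 1) (p 1)) {s : ℝ} (hs : s = 1 ∨ s = -1)
    (hD : 0 < s * orient (p 0) (p 1) (p 2)) {z : Plane} (ha : 0 < s * orient (p 1) (p 2) z)
    (hb : 0 < s * orient (p 0) (p 1) z) (hc : 0 ≤ s * orient (p 2) (p 0) z) :
    ∃ x ∈ openSegment ℝ (p 1) z, x ∉ Bd p → x ∈ opn (Bd p) := by
  have hcont : Continuous fun t : ℝ => dotp (p 1) (p 1 + t • (z - p 1)) := by
    unfold dotp; fun_prop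
  have hev : ∀ᶠ t : ℝ in 𝓝[>] 0, ∀ k ∈ Finset.range m, p k ≠ p 1 →
      dotp (p 1) (p k) < dotp (p 1) (p 1 + t • (z - p 1)) := by
    rw [Filter.eventually_all_finset]
    intro k _
    by_cases hk : p k = p 1
    · simp [hk]
    · have h0 := hcont.tendsto 0
      simp only [zero_smul, add_zero] at h0
      filter_upwards [nhdsWithin_le_nhds (h0.eventually (lt_mem_nhds (hext k hk)))] with t ht _
        using ht
  have h1 : ∀ᶠ t : ℝ in 𝓝[>] 0, t < 1 := nhdsWithin_le_nhds (gt_mem_nhds one_pos)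
  obtain ⟨t, ⟨ht, ht1⟩, ht0⟩ := ((hev.and h1).and self_mem_nhdsWithin).exists
  have ht0 : 0 < t := ht0
  refine ⟨p 1 + t • (z - p 1), mem_openSegment_iff_smul.mpr ⟨t, ht0, ht1, rfl⟩, ?_⟩
  apply h.mem_opn_of_extreme hm hs (ν := p 1)
  · intro k hk
    rw [← h.mod_eq k] at hk ⊢
    exact ht _ (Finset.mem_range.mpr (Nat.mod_lt _ (by omega))) hk
  · rw [orient_lerp, orient_self_right, mul_zero, zero_add, mul_left_comm]; positivity
  · rw [orient_lerp, orient_self_left, mul_zero, zero_add, mul_left_comm]; positivity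
  · rw [orient_lerp, orient_rotate (p 1) (p 2) (p 0), orient_rotate (p 0) (p 1) (p 2)]
    have := mul_pos (sub_pos.mpr ht1) hD
    have := mul_nonneg ht0.le hc
    nlinarith

/-- The vertex `p 1` is strictly extreme in its own direction, hence a proper corner. If the corner
triangle contains no further vertex, its base is a diagonal; otherwise the vertex in it farthest
from the base is joined to `p 1` by a diagonal. -/
lemma exists_diag_at (h : IsOrientedLoop p m ε) (hm : 4 ≤ m)
    (hext : ∀ k, p k ≠ p 1 → dotp (p 1) (p k) < dotp (p 1) (p 1)) :
    ∃ i j, i + 2 ≤ j ∧ j + 2 ≤ i + m ∧ IsDiag p i j := by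
  have hne : orient (p 0) (p 1) (p 2) ≠ 0 := by
    rcases h.corner 0 with hne | ⟨c, hc, e⟩
    · exact hne
    · exfalso
      have e0 := hext 0 (h.ne_succ 0)
      have e2 := hext 2 (h.ne_succ 1).symm
      simp only [zero_add] at e
      have e' : dotp (p 1) (p 0) - dotp (p 1) (p 1) =
          c * (dotp (p 1) (p 2) - dotp (p 1) (p 1)) := by
        have h1 := congrArg Prod.fst e
        have h2 := congrArg Prod.snd e
        simp at h1 h2
        simp only [dotp]
        linear_combination (p 1).1 * h1 + (p 1).2 * h2
      nlinarith
  obtain ⟨s, hs, hD⟩ : ∃ s : ℝ, (s = 1 ∨ s = -1) ∧ 0 < s * orient (p 0) (p 1) (p 2) := by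
    rcases lt_or_gt_of_ne hne with h1 | h1
    · exact ⟨-1, Or.inr rfl, by linarith⟩
    · exact ⟨1, Or.inl rfl, by linarith⟩
  have hD1 : 0 < s * orient (p 1) (p 2) (p 0) := by rwa [orient_rotate]
  have hD2 : 0 < s * orient (p 2) (p 0) (p 1) := by rwa [orient_rotate, orient_rotate]
  classical
  let V : Finset ℕ := (Finset.range m).filter fun k => p k ≠ p 0 ∧ p k ≠ p 1 ∧ p k ≠ p 2 ∧
    0 ≤ s * orient (p 1) (p 2) (p k) ∧ 0 ≤ s * orient (p 0) (p 1) (p k) ∧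
    0 ≤ s * orient (p 2) (p 0) (p k)
  have memV : ∀ k, p k ≠ p 0 → p k ≠ p 1 → p k ≠ p 2 → 0 ≤ s * orient (p 1) (p 2) (p k) →
      0 ≤ s * orient (p 0) (p 1) (p k) → 0 ≤ s * orient (p 2) (p 0) (p k) → k % m ∈ V := by
    intro k h0 h1 h2 h3 h4 h5
    rw [← h.mod_eq k] at h0 h1 h2 h3 h4 h5
    exact Finset.mem_filter.mpr ⟨Finset.mem_range.mpr (Nat.mod_lt _ (by omega)),
      h0, h1, h2, h3, h4, h5⟩
  rcases V.eq_empty_or_nonempty with hV | hV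
  · -- the corner triangle is empty
    have hemp : ∀ k, p k ≠ p 0 → p k ≠ p 1 → p k ≠ p 2 → 0 ≤ s * orient (p 1) (p 2) (p k) →
      0 ≤ s * orient (p 0) (p 1) (p k) → s * orient (p 2) (p 0) (p k) < 0 := by
      intro k h0 h1 h2 h3 h4
      by_contra! h5
      have := memV k h0 h1 h2 h3 h4 h5
      rw [hV] at this
      exact absurd this (Finset.notMem_empty _)
    refine ⟨0, 2, by omega, by omega, ?_⟩
    -- `S` is the triangle without its two legs. It is convex and misses the polygon, so the points
    -- of it near the corner, which are inside, are connected with the base.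
    let S : Set Plane := {y | 0 < s * orient (p 1) (p 2) y} ∩ {y | 0 < s * orient (p 0) (p 1) y} ∩
      {y | 0 ≤ s * orient (p 2) (p 0) y}
    have hSc : Convex ℝ S := ((convex_mul_orient_pos _ _ _).inter
      (convex_mul_orient_pos _ _ _)).inter (convex_mul_orient_nonneg _ _ _)
    have hSB : S ⊆ (Bd p)ᶜ := by
      rintro w ⟨⟨ha, hb⟩, hc⟩
      simp only [Set.mem_ofPred_eq] at ha hb hc
      rcases hc.eq_or_lt with hc | hc
      · exact h.notMem_base hm hD ha hb hc.symm hemp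
      · refine h.notMem_corner hD ha hb hc ?_
        intro k k1 k2 k3
        by_cases e0 : p k = p 0
        · rw [e0, orient_self_right, mul_zero]; exact hc
        by_cases e2 : p k = p 2
        · rw [e2, orient_self_left, mul_zero]; exact hc
        · exact (hemp k e0 k1 e2 k2 k3).trans hc
    have hSo : openSegment ℝ (p 0) (p 2) ⊆ S := by
      intro y hy
      obtain ⟨t, t0, t1, rfl⟩ := mem_openSegment_iff_smul.mp hy
      have t1' := sub_pos.mpr t1
      refine ⟨⟨?_, ?_⟩, ?_⟩ <;> simp only [Set.mem_ofPred_eq, orient_lerp]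
      · rw [orient_self_right, mul_zero, add_zero, mul_left_comm]; positivity
      · rw [orient_self_left, mul_zero, zero_add, mul_left_comm]; positivity
      · simp [orient_self_left, orient_self_right]
    obtain ⟨z, hz⟩ : (openSegment ℝ (p 0) (p 2)).Nonempty :=
      ⟨_, mem_openSegment_iff_smul.mpr ⟨1 / 2, by norm_num, by norm_num, rfl⟩⟩
    obtain ⟨⟨ha, hb⟩, hc⟩ := hSo hz
    obtain ⟨x, hx, hxo⟩ := h.exists_mem_opn_near hm hext hs hD ha hb hc
    have hxS : x ∈ S := by
      obtain ⟨t, t0, t1, rfl⟩ := mem_openSegment_iff_smul.mp hx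
      have t1' := sub_pos.mpr t1
      simp only [Set.mem_ofPred_eq] at ha hb hc
      refine ⟨⟨?_, ?_⟩, ?_⟩ <;> simp only [Set.mem_ofPred_eq, orient_lerp]
      · rw [orient_self_left, mul_zero, zero_add, mul_left_comm]; positivity
      · rw [orient_self_right, mul_zero, zero_add, mul_left_comm]; positivity
      · rw [mul_add, mul_left_comm, mul_left_comm s t]; positivity
    intro y hy
    exact opn_of_isPreconnected hSc.isPreconnected hSB hxS (hSo hy) (hxo (hSB hxS))
  · obtain ⟨k, hk, hmax⟩ := V.exists_max_image (fun k => s * orient (p 2) (p 0) (p k)) hV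
    obtain ⟨hkm, k0, k1, k2, ha, hb, hc⟩ := Finset.mem_filter.mp hk
    have hkm := Finset.mem_range.mp hkm
    have ha' : 0 < s * orient (p 1) (p 2) (p k) := by
      refine lt_of_le_of_ne ha fun e => ?_
      have := mem_segment_of_bary hD e.symm hb hc
      obtain ⟨j, rfl⟩ : ∃ j, k = j + 1 := by
        refine ⟨k - 1, ?_⟩
        have : k ≠ 0 := by rintro rfl; exact k0 rfl
        omega
      rcases h.vertex_edge (j := 1) this with e | e
      · exact k2 (h.succ_eq e).symm
      · exact k1 e.symm
    have hb' : 0 < s * orient (p 0) (p 1) (p k) := by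
      refine lt_of_le_of_ne hb fun e => ?_
      have := mem_segment_of_bary (a := p 2) hD2 e.symm hc ha
      obtain ⟨j, rfl⟩ : ∃ j, k = j + 1 := by
        refine ⟨k - 1, ?_⟩
        have : k ≠ 0 := by rintro rfl; exact k0 rfl
        omega
      rcases h.vertex_edge (j := 0) this with e | e
      · exact k1 (h.succ_eq e).symm
      · exact k0 e.symm
    have hk0 : k ≠ 0 := by rintro rfl; exact k0 rfl
    have hk1 : k ≠ 1 := by rintro rfl; exact k1 rfl
    have hk2 : k ≠ 2 := by rintro rfl; exact k2 rfl
    refine ⟨1, k, by omega, by omega, ?_⟩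
    have hlt : s * orient (p 2) (p 0) (p k) < s * orient (p 0) (p 1) (p 2) := by
      have := bary_sum (p 0) (p 1) (p 2) (p k)
      rw [← this]; linarith
    have hoff : openSegment ℝ (p 1) (p k) ⊆ (Bd p)ᶜ := by
      intro y hy
      obtain ⟨t, t0, t1, rfl⟩ := mem_openSegment_iff_smul.mp hy
      have t1' := sub_pos.mpr t1
      have hcl : s * orient (p 2) (p 0) (p k) <
          s * orient (p 2) (p 0) (p 1 + t • (p k - p 1)) := by
        rw [orient_lerp, orient_rotate (p 1) (p 2) (p 0), orient_rotate (p 0) (p 1) (p 2)]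
        nlinarith
      refine h.notMem_corner hD ?_ ?_ (hc.trans_lt hcl) ?_
      · rw [orient_lerp, orient_self_left, mul_zero, zero_add, mul_left_comm]; positivity
      · rw [orient_lerp, orient_self_right, mul_zero, zero_add, mul_left_comm]; positivity
      intro l l1 l2 l3
      refine lt_of_le_of_lt ?_ hcl
      by_cases e0 : p l = p 0
      · rw [e0, orient_self_right, mul_zero]; exact hc
      by_cases e2 : p l = p 2
      · rw [e2, orient_self_left, mul_zero]; exact hc
      by_cases e3 : 0 ≤ s * orient (p 2) (p 0) (p l)
      · have := hmax _ (memV l e0 l1 e2 l2 l3 e3)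
        rwa [h.mod_eq] at this
      · exact (not_le.mp e3).le.trans hc
    obtain ⟨x, hx, hxo⟩ := h.exists_mem_opn_near hm hext hs hD ha' hb' hc
    intro y hy
    exact opn_of_isPreconnected (convex_openSegment _ _).isPreconnected hoff hx hy (hxo (hoff hx))

end IsOrientedLoop

namespace IsSimpleLoop

variable {p : ℕ → Plane} {m : ℕ}

/-- A polygon with at least four vertices has a diagonal. -/
lemma exists_diag (h : IsSimpleLoop p m) (hm : 4 ≤ m) :
    ∃ i j, j < m ∧ i + 2 ≤ j ∧ j + 2 ≤ i + m ∧ IsDiag p i j := by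
  -- The vertex farthest from the origin is extreme in its own direction; a shift by `k0 + m - 1`
  -- gives it the number 1.
  obtain ⟨k0, hk0, hmax⟩ := (Finset.range m).exists_max_image (fun k => dotp (p k) (p k))
    ⟨0, Finset.mem_range.mpr (by omega)⟩
  have hmax : ∀ k, dotp (p k) (p k) ≤ dotp (p k0) (p k0) := by
    intro k
    have := hmax (k % m) (Finset.mem_range.mpr (Nat.mod_lt _ (by omega)))
    rwa [h.mod_eq] at this
  obtain ⟨ε, ho⟩ := (h.shift (k0 + m - 1)).exists_isOrientedLoop
  have e1 : p (1 + (k0 + m - 1)) = p k0 := by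
    rw [show 1 + (k0 + m - 1) = k0 + m by omega, h.per]
  obtain ⟨i, j, hij, hji, hd⟩ := ho.exists_diag_at hm (by
    intro k hk
    simp only [e1] at hk ⊢
    set q := p (k + (k0 + m - 1)) with hq
    have h1 : dotp q q ≤ dotp (p k0) (p k0) := hmax _
    have h2 : 0 < dotp (q - p k0) (q - p k0) := dotp_self_pos (sub_ne_zero.mpr hk)
    simp only [dotp, Prod.fst_sub, Prod.snd_sub] at h1 h2 ⊢
    nlinarith)
  have hd' : IsDiag p (i + (k0 + m - 1)) (j + (k0 + m - 1)) := by
    unfold IsDiag at hd ⊢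
    rwa [h.Bd_shift] at hd
  set a := i + (k0 + m - 1) with ha
  set b := j + (k0 + m - 1) with hb
  have hab : b - a = j - i := by omega
  have hpb : p b = p (a % m + (j - i)) := by
    rw [h.eq_iff, Nat.mod_add_mod]; congr 1; omega
  have hd2 : IsDiag p (a % m) (a % m + (j - i)) := by
    unfold IsDiag at hd' ⊢
    rwa [h.mod_eq, ← hpb]
  have ham : a % m < m := Nat.mod_lt _ (by omega)
  -- Back in the original numbering, the ends of the diagonal are exchanged if it passes the vertex
  -- 0.
  rcases Nat.lt_or_ge (a % m + (j - i)) m with hlt | hge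
  · exact ⟨_, _, hlt, by omega, by omega, hd2⟩
  · refine ⟨a % m + (j - i) - m, a % m, ham, by omega, by omega, ?_⟩
    have : p (a % m + (j - i) - m) = p (a % m + (j - i)) := by
      rw [← h.per (a % m + (j - i) - m)]; congr 1; omega
    have := hd2.symm
    unfold IsDiag at this ⊢
    rwa [‹p (a % m + (j - i) - m) = _›]

end IsSimpleLoop


/-! ### Apices of a triangulation -/

/-- The vertices `p i` and `p j` are joined by an edge of the polygon or a diagonal. -/
def IsChord (p : ℕ → Plane) (m i j : ℕ) : Prop :=
  j = i + 1 ∨ (i = 0 ∧ j + 1 = m) ∨ IsDiag p i j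

namespace IsSimpleLoop

variable {p : ℕ → Plane} {m : ℕ}

/-- The apex is that of the triangle on the base from `p 0` to `p (m - 1)` in some triangulation. A
diagonal cuts the polygon, and the part with the base has an apex by induction; its diagonals are
diagonals of the whole, and so is the cut. -/
lemma exists_apex_aux (h : IsSimpleLoop p m) :
    ∃ c, 0 < c ∧ c < m - 1 ∧ (c = 1 ∨ IsDiag p 0 c) ∧ (m - 1 = c + 1 ∨ IsDiag p c (m - 1)) := by
  induction m using Nat.strong_induction_on generalizing p with
  | _ m ih =>
  have h3 := h.three_le
  rcases h3.eq_or_lt with rfl | hm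
  · exact ⟨1, by omega, by omega, Or.inl rfl, Or.inl rfl⟩
  obtain ⟨i, j, hj, hij, hji, hd⟩ := h.exists_diag hm
  obtain ⟨ε, ho⟩ := h.exists_isOrientedLoop
  have hd' : IsDiag p j (i + m) := hd.symm_per h
  have hs := ho.subchain_isOrientedLoop hji (by omega) hd'
  have hsub : opn (Bd fun k => subchain p j (i + m) (k + (m - j))) ⊆ opn (Bd p) := by
    rw [hs.Bd_shift]; exact ho.opn_subchain_subset hji (by omega) hd'
  set M := i + m - j + 1 with hM
  -- The part with the base as the sequence `p 0, …, p i, p j, …, p (m - 1)`, numbered so that the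
  -- base is its last edge again.
  set q : ℕ → Plane := fun k => subchain p j (i + m) (k + (m - j)) with hq
  have q1 : ∀ k, k ≤ i → q k = p k := by
    intro k hk
    rw [hq]; dsimp only
    rw [subchain_of_le (by omega), ← h.per k]; congr 1; omega
  have q2 : ∀ k, i < k → k < M → q k = p (k - i - 1 + j) := by
    intro k hk hkM
    rw [hq]; dsimp only
    have e : k + (m - j) = k - i - 1 + (i + m - j + 1) := by omega
    rw [e, subchain_per, subchain_of_le (by omega)]; congr 1; omega
  obtain ⟨c, hc0, hcM, g1, g2⟩ := ih M (by omega) (hs.shift (m - j))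
  rw [show (0 : ℕ) = 0 from rfl] at g1
  have tr : ∀ {a b a' b' : ℕ}, q a = p a' → q b = p b' → IsDiag q a b → IsDiag p a' b' := by
    intro a b a' b' ea eb hab
    unfold IsDiag at hab ⊢
    rw [← ea, ← eb]
    exact hab.trans hsub
  have e0 := q1 0 (by omega)
  have eM : q (M - 1) = p (m - 1) := by
    rw [q2 _ (by omega) (by omega)]; congr 1; omega
  rcases Nat.lt_or_ge i c with hic | hic
  · have ec := q2 c hic (by omega)
    refine ⟨c - i - 1 + j, by omega, by omega, ?_, ?_⟩
    · rcases g1 with rfl | g1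
      · obtain rfl : i = 0 := by omega
        right; simpa using hd
      · exact Or.inr (tr e0 ec g1)
    · rcases g2 with g2 | g2
      · left; omega
      · exact Or.inr (tr ec eM g2)
  · have ec := q1 c hic
    refine ⟨c, hc0, by omega, ?_, ?_⟩
    · exact g1.imp id (tr e0 ec)
    · rcases g2 with g2 | g2
      · obtain rfl : c = i := by omega
        obtain rfl : j = m - 1 := by omega
        exact Or.inr hd
      · exact Or.inr (tr ec eM g2)

/-- Every edge or diagonal is the side of a triangle formed with edges or diagonals on the side
away from the base. -/
lemma exists_apex (h : IsSimpleLoop p m) {i j : ℕ} (hij : i + 2 ≤ j) (hj : j < m)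
    (hc : IsChord p m i j) :
    ∃ c, i < c ∧ c < j ∧ IsChord p m i c ∧ IsChord p m c j := by
  by_cases htop : i = 0 ∧ j + 1 = m
  · obtain ⟨rfl, rfl⟩ := htop
    obtain ⟨c, h0, h1, g1, g2⟩ := h.exists_apex_aux
    exact ⟨c, h0, h1, g1.imp id Or.inr, g2.imp id Or.inr⟩
  have hd : IsDiag p i j := by
    rcases hc with hc | hc | hc
    · omega
    · exact absurd hc htop
    · exact hc
  obtain ⟨ε, ho⟩ := h.exists_isOrientedLoop
  have hs := ho.subchain_isOrientedLoop hij (by omega) hd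
  have hsub := ho.opn_subchain_subset hij (by omega) hd
  obtain ⟨c, h0, h1, g1, g2⟩ := hs.exists_apex_aux
  have tr : ∀ {a b : ℕ}, a ≤ j - i → b ≤ j - i → IsDiag (subchain p i j) a b →
      IsDiag p (i + a) (i + b) := by
    intro a b ha hb hab
    unfold IsDiag at hab ⊢
    rw [subchain_of_le ha, subchain_of_le hb] at hab
    exact hab.trans hsub
  refine ⟨i + c, by omega, by omega, ?_, ?_⟩
  · rcases g1 with g1 | g1
    · left; omega
    · exact Or.inr (Or.inr (tr (a := 0) (by omega) (by omega) g1))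
  · rcases g2 with g2 | g2
    · left; omega
    · have := tr (by omega) (by omega) g2
      rw [show i + (j - i + 1 - 1) = j by omega] at this
      exact Or.inr (Or.inr this)

end IsSimpleLoop

/-! ### Visibility -/

/-- The points `a`, `b`, `c` are collinear only if one lies between the others. -/
lemma mem_segment_of_orient_eq_zero {a b c : Plane} (h : orient a b c = 0) :
    a ∈ segment ℝ b c ∨ b ∈ segment ℝ c a ∨ c ∈ segment ℝ a b := by
  by_cases hab : b = a
  · left; rw [hab]; exact left_mem_segment ℝ _ _
  obtain ⟨k, hk⟩ := exists_smul_of_cross_eq_zero (sub_ne_zero.mpr hab)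
    (show cross (b - a) (c - a) = 0 by rwa [← orient_eq_cross])
  have hc : c = a + k • (b - a) := by rw [← hk]; abel
  rcases le_total k 0 with k0 | k0
  · left
    refine mem_segment_iff_smul.mpr ⟨1 / (1 - k), by apply div_nonneg <;> linarith,
      div_le_one_of_le₀ (by linarith) (by linarith), ?_⟩
    have : 1 - k ≠ 0 := by linarith
    rw [hc]
    ext <;> simp <;> field_simp <;> ring
  · rcases le_total k 1 with k1 | k1
    · exact Or.inr (Or.inr (mem_segment_iff_smul.mpr ⟨k, k0, k1, hc⟩))
    · right; left
      rw [segment_symm]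
      refine mem_segment_iff_smul.mpr ⟨1 / k, by positivity,
        div_le_one_of_le₀ k1 (by linarith), ?_⟩
      have : k ≠ 0 := by linarith
      rw [hc]
      ext <;> simp <;> field_simp <;> ring

lemma mem_convexHull_of_orient {a b c x : Plane} {s : ℝ} (hD : 0 < s * orient a b c)
    (h0 : 0 ≤ s * orient a b x) (h1 : 0 ≤ s * orient b c x) (h2 : 0 ≤ s * orient c a x) :
    x ∈ convexHull ℝ ({a, b, c} : Set Plane) := by
  have hs : s ≠ 0 := by rintro rfl; simp at hD
  have hne : orient a b c ≠ 0 := by intro h; simp [h] at hD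
  have e := bary_comb a b c x
  have e' := bary_sum a b c x
  have hx : x = (s * orient b c x / (s * orient a b c)) • a +
      (s * orient c a x / (s * orient a b c)) • b + (s * orient a b x / (s * orient a b c)) • c := by
    rw [mul_div_mul_left _ _ hs, mul_div_mul_left _ _ hs, mul_div_mul_left _ _ hs]
    have : x = (orient a b c)⁻¹ • (orient a b c • x) := by
      rw [smul_smul, inv_mul_cancel₀ hne, one_smul]
    conv_lhs => rw [this, e]
    rw [smul_add, smul_add, smul_smul, smul_smul, smul_smul]
    simp only [div_eq_inv_mul]
    abel
  refine mem_convexHull_of_exists_fintype (ι := Fin 3)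
    ![s * orient b c x / (s * orient a b c), s * orient c a x / (s * orient a b c),
      s * orient a b x / (s * orient a b c)] ![a, b, c] ?_ ?_ ?_ ?_
  · intro i; fin_cases i <;> simp <;> positivity
  · simp only [Fin.sum_univ_three, Matrix.cons_val_zero, Matrix.cons_val_one, Matrix.cons_val]
    rw [← add_div, ← add_div, ← mul_add, ← mul_add, div_eq_one_iff_eq hD.ne', ← e']
    ring
  · intro i; fin_cases i <;> simp
  · simpa [Fin.sum_univ_three] using hx.symm

lemma convexHull_triple {a b c : Plane} {s : ℝ} (hD : 0 < s * orient a b c) :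
    convexHull ℝ ({a, b, c} : Set Plane) =
      {x | 0 ≤ s * orient a b x ∧ 0 ≤ s * orient b c x ∧ 0 ≤ s * orient c a x} := by
  apply Set.Subset.antisymm
  · apply convexHull_min
    · have h1 : 0 < s * orient b c a := by rwa [orient_rotate]
      have h2 : 0 < s * orient c a b := by rwa [orient_rotate, orient_rotate]
      rintro x (rfl | rfl | rfl) <;>
        simp [orient_self_left, orient_self_right, hD.le, h1.le, h2.le]
    · exact (convex_mul_orient_nonneg _ _ _).inter
        ((convex_mul_orient_nonneg _ _ _).inter (convex_mul_orient_nonneg _ _ _))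
  · rintro x ⟨h0, h1, h2⟩
    exact mem_convexHull_of_orient hD h0 h1 h2

lemma isOpen_mul_orient_pos (s : ℝ) (a b : Plane) : IsOpen {y | 0 < s * orient a b y} :=
  isOpen_lt continuous_const (continuous_const.mul (continuous_orient a b))

lemma mem_interior_convexHull {a b c x : Plane} {s : ℝ}
    (h0 : 0 < s * orient a b x) (h1 : 0 < s * orient b c x) (h2 : 0 < s * orient c a x) :
    x ∈ interior (convexHull ℝ ({a, b, c} : Set Plane)) := by
  have hD : 0 < s * orient a b c := by rw [← bary_sum a b c x]; linarith
  rw [convexHull_triple hD, mem_interior]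
  refine ⟨{y | 0 < s * orient a b y} ∩ ({y | 0 < s * orient b c y} ∩ {y | 0 < s * orient c a y}),
    fun y hy => ⟨hy.1.le, hy.2.1.le, hy.2.2.le⟩, (isOpen_mul_orient_pos _ _ _).inter
    ((isOpen_mul_orient_pos _ _ _).inter (isOpen_mul_orient_pos _ _ _)), h0, h1, h2⟩

lemma convexHull_triple_subset_segment {a b c : Plane} (h : c ∈ segment ℝ a b) :
    convexHull ℝ ({a, b, c} : Set Plane) ⊆ segment ℝ a b := by
  apply convexHull_min _ (convex_segment _ _)
  rintro x (rfl | rfl | rfl)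
  exacts [left_mem_segment ℝ _ _, right_mem_segment ℝ _ _, h]

/-- A point at which all three barycentric coordinates are positive is interior. A degenerate
triangle is contained in one of its sides. -/
lemma frontier_triangle (a b c : Plane) :
    frontier (convexHull ℝ ({a, b, c} : Set Plane)) ⊆
      segment ℝ a b ∪ segment ℝ b c ∪ segment ℝ c a := by
  have hcl : IsClosed (convexHull ℝ ({a, b, c} : Set Plane)) :=
    ((Set.toFinite _).isCompact_convexHull ℝ).isClosed
  intro x hx
  have hxh := hcl.frontier_subset hx
  by_cases h : orient a b c = 0
  · rcases mem_segment_of_orient_eq_zero h with h | h | h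
    · rw [show ({a, b, c} : Set Plane) = {b, c, a} by ext; simp; tauto] at hxh
      exact Or.inl (Or.inr (convexHull_triple_subset_segment h hxh))
    · rw [show ({a, b, c} : Set Plane) = {c, a, b} by ext; simp; tauto] at hxh
      exact Or.inr (convexHull_triple_subset_segment h hxh)
    · exact Or.inl (Or.inl (convexHull_triple_subset_segment h hxh))
  · obtain ⟨s, hD⟩ : ∃ s : ℝ, 0 < s * orient a b c := ⟨orient a b c, mul_self_pos.mpr h⟩
    have hD1 : 0 < s * orient b c a := by rwa [orient_rotate]
    have hD2 : 0 < s * orient c a b := by rwa [orient_rotate, orient_rotate]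
    rw [convexHull_triple hD] at hxh
    obtain ⟨h0, h1, h2⟩ := hxh
    rcases h0.eq_or_lt with e | h0'
    · left; left; exact mem_segment_of_bary hD2 e.symm h2 h1
    rcases h1.eq_or_lt with e | h1'
    · left; right; exact mem_segment_of_bary hD e.symm h0 h2
    rcases h2.eq_or_lt with e | h2'
    · right; exact mem_segment_of_bary hD1 e.symm h1 h0
    · exact (hx.2 (mem_interior_convexHull h0' h1' h2')).elim

/-- A triangle whose sides lie in the closed polygon lies in the closed polygon. -/
lemma triangle_subset_cls {B : Set Plane} {a b c : Plane} (hab : segment ℝ a b ⊆ cls B)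
    (hbc : segment ℝ b c ⊆ cls B) (hca : segment ℝ c a ⊆ cls B) :
    convexHull ℝ ({a, b, c} : Set Plane) ⊆ cls B := by
  intro x hx
  by_contra hxc
  have hxB : x ∉ B := fun h => hxc (Or.inl h)
  have hunb : ¬ Bornology.IsBounded (connectedComponentIn Bᶜ x) := fun h =>
    hxc (Or.inr ⟨hxB, h⟩)
  have hbd : Bornology.IsBounded (convexHull ℝ ({a, b, c} : Set Plane)) :=
    ((Set.toFinite _).isCompact_convexHull ℝ).isBounded
  -- The component of an outer point `x` is unbounded, so it leaves the triangle through a side. The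
  -- sides are in the closed polygon, so this makes `x` an inner point.
  obtain ⟨y, hy, hyT⟩ := Set.not_subset.mp fun hsub => hunb (hbd.subset hsub)
  obtain ⟨z, hz, hzf⟩ : ∃ z ∈ connectedComponentIn Bᶜ x,
      z ∈ frontier (convexHull ℝ ({a, b, c} : Set Plane)) := by
    have hcl : IsClosed (convexHull ℝ ({a, b, c} : Set Plane)) :=
      ((Set.toFinite _).isCompact_convexHull ℝ).isClosed
    by_contra! hcon
    have hint : ∀ z ∈ connectedComponentIn Bᶜ x, z ∈ convexHull ℝ ({a, b, c} : Set Plane) →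
        z ∈ interior (convexHull ℝ ({a, b, c} : Set Plane)) := by
      intro z hz hzT
      by_contra hzi
      exact hcon z hz ⟨subset_closure hzT, hzi⟩
    obtain ⟨z, -, hz1, hz2⟩ := isPreconnected_connectedComponentIn (x := x) (F := Bᶜ) _ _
      isOpen_interior hcl.isOpen_compl
      (fun z hz => (em _).imp (hint z hz) id) ⟨x, mem_connectedComponentIn hxB,
        hint x (mem_connectedComponentIn hxB) hx⟩ ⟨y, hy, hyT⟩
    exact hz2 (interior_subset hz1)
  have hzc : z ∈ cls B := by
    rcases frontier_triangle a b c hzf with (h | h) | h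
    exacts [hab h, hbc h, hca h]
  have hzB : z ∉ B := connectedComponentIn_subset _ _ hz
  exact hxc (Or.inr ((opn_of_mem_component hz).mp (mem_opn_of_mem_cls hzc hzB)))

/-- Segments from a corner of a visible triangle to the opposite side are visible. -/
lemma segment_subset_cls {B : Set Plane} {a b c y : Plane} (hab : segment ℝ a b ⊆ cls B)
    (hbc : segment ℝ b c ⊆ cls B) (hca : segment ℝ c a ⊆ cls B) (hy : y ∈ segment ℝ b c) :
    segment ℝ a y ⊆ cls B := by
  refine Set.Subset.trans ?_ (triangle_subset_cls hab hbc hca)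
  apply (convex_convexHull ℝ _).segment_subset
  · exact subset_convexHull ℝ _ (by simp)
  · exact segment_subset_convexHull (by simp) (by simp) hy

namespace IsOrientedLoop

variable {p : ℕ → Plane} {m i j : ℕ} {ε : ℝ}

/-- A connected subset of the polygon meeting both parts meets the diagonal. -/
lemma exists_mem_chord (h : IsOrientedLoop p m ε) (hij : i + 2 ≤ j) (hjm : j + 2 ≤ i + m)
    (hd : IsDiag p i j) {S : Set Plane} (hS : IsPreconnected S) (hSc : S ⊆ cls (Bd p))
    (h1 : (S ∩ cls (Bd (subchain p i j))).Nonempty)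
    (h2 : (S ∩ cls (Bd (subchain p j (i + m)))).Nonempty) :
    ∃ x ∈ S, x ∈ segment ℝ (p i) (p j) := by
  obtain ⟨o1, o2⟩ := h.orientation_subchains hij hjm hd
  obtain ⟨x, hx, hx1, hx2⟩ := isPreconnected_closed_iff.mp hS _ _ (isClosed_cls o1.isClosed_Bd)
    (isClosed_cls o2.isClosed_Bd) (hSc.trans (h.cls_subset_union hij hjm hd)) h1 h2
  exact ⟨x, hx, h.cls_inter_subset hij hjm hd hx1 hx2⟩

/-- The part beyond the diagonal is a polygon with the edge `p i p j`, and `side` applies to it. The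
segment from `z` to `y` stays in that part: to change parts it would have to meet the chord again,
but `y` is off the line of the chord. -/
lemma chord_side (h : IsOrientedLoop p m ε) (hij : i + 2 ≤ j) (hjm : j + 2 ≤ i + m)
    (hd : IsDiag p i j) {y z : Plane} (hy : y ∈ cls (Bd (subchain p j (i + m))))
    (hz : z ∈ openSegment ℝ (p i) (p j)) (hzy : openSegment ℝ z y ⊆ cls (Bd p))
    (hne : orient (p i) (p j) y ≠ 0) : 0 < ε * orient (p i) (p j) y := by
  obtain ⟨o1, o2⟩ := h.orientation_subchains hij hjm hd
  have e1 : subchain p j (i + m) (i + m - j) = p i := by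
    rw [subchain_last (by omega), h.per]
  have e2 : subchain p j (i + m) (i + m - j + 1) = p j := subchain_close _ _ _
  have key : openSegment ℝ z y ⊆ cls (Bd (subchain p j (i + m))) := by
    intro w hw
    rcases h.cls_subset_union hij hjm hd (hzy hw) with h1 | h2
    · exfalso
      have hsub : segment ℝ w y ⊆ cls (Bd p) := by
        intro v hv
        by_cases hvy : v = y
        · rw [hvy]
          refine closure_minimal hzy (isClosed_cls h.isClosed_Bd) ?_
          rw [closure_openSegment]; exact right_mem_segment ℝ _ _
        · apply hzy
          obtain ⟨t, t0, t1, rfl⟩ := mem_openSegment_iff_smul.mp hw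
          obtain ⟨u, u0, u1, rfl⟩ := mem_segment_iff_smul.mp hv
          have u1' : u < 1 := by
            refine lt_of_le_of_ne u1 ?_
            rintro rfl; apply hvy; simp
          refine mem_openSegment_iff_smul.mpr ⟨t + u * (1 - t), by nlinarith, by nlinarith, ?_⟩
          ext <;> simp <;> ring
      obtain ⟨x, hx, hxc⟩ := h.exists_mem_chord hij hjm hd (convex_segment w y).isPreconnected
        hsub ⟨w, left_mem_segment ℝ _ _, h1⟩ ⟨y, right_mem_segment ℝ _ _, hy⟩
      have hx0 := orient_of_mem_segment hxc
      obtain ⟨t, t0, t1, rfl⟩ := mem_openSegment_iff_smul.mp hw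
      obtain ⟨u, u0, u1, rfl⟩ := mem_segment_iff_smul.mp hx
      rw [orient_lerp, orient_lerp, orient_of_mem_segment (openSegment_subset_segment _ _ _ hz),
        mul_zero, zero_add, ← mul_assoc, ← add_mul] at hx0
      rcases mul_eq_zero.mp hx0 with h0 | h0
      · nlinarith [mul_nonneg (sub_nonneg.mpr u1) t0.le]
      · exact hne h0
    · exact h2
  have := o2.side (k := i + m - j) (z := z) (y := y) (by rwa [e1, e2]) (by rwa [e1, e2]) key
  rwa [e1, e2] at this

/-- A visible pair of vertices with no vertex in between is an edge or a diagonal. -/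
lemma isDiag_of_visible (h : IsOrientedLoop p m ε) (hij : i < j) (hjm : j < i + m)
    (hv : segment ℝ (p i) (p j) ⊆ cls (Bd p)) (hno : ∀ l, p l ∉ openSegment ℝ (p i) (p j)) :
    j = i + 1 ∨ j + 1 = i + m ∨ IsDiag p i j := by
  by_contra! hcon
  obtain ⟨h1, h2, h3⟩ := hcon
  obtain ⟨x, hx, hxo⟩ := Set.not_subset.mp h3
  have hxB : x ∈ Bd p := (hv (openSegment_subset_segment _ _ _ hx)).resolve_right hxo
  obtain ⟨k, hk⟩ := IsSimpleLoop.mem_Bd.mp hxB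
  have hko : x ∈ openSegment ℝ (p k) (p (k + 1)) :=
    mem_openSegment_of_ne_left_right (fun e => hno k (e ▸ hx)) (fun e => hno (k + 1) (e ▸ hx)) hk
  have hvi : openSegment ℝ x (p i) ⊆ cls (Bd p) := by
    refine Set.Subset.trans ?_ hv
    exact (openSegment_subset_segment _ _ _).trans ((convex_segment _ _).segment_subset
      (openSegment_subset_segment _ _ _ hx) (left_mem_segment ℝ _ _))
  have hvj : openSegment ℝ x (p j) ⊆ cls (Bd p) := by
    refine Set.Subset.trans ?_ hv
    exact (openSegment_subset_segment _ _ _).trans ((convex_segment _ _).segment_subset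
      (openSegment_subset_segment _ _ _ hx) (right_mem_segment ℝ _ _))
  have hx0 := orient_of_mem_segment hk
  obtain ⟨t, t0, t1, hxt⟩ := mem_openSegment_iff_smul.mp hx
  rw [hxt, orient_lerp] at hx0
  -- Otherwise `p i` and `p j` would be on different sides of the edge, both seen from its inner
  -- point `x`, contrary to `side`.
  have hi0 : orient (p k) (p (k + 1)) (p i) = 0 := by
    by_contra hi
    have hj : orient (p k) (p (k + 1)) (p j) ≠ 0 := by
      intro hj
      rw [hj, mul_zero, add_zero] at hx0
      rcases mul_eq_zero.mp hx0 with e | e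
      · linarith
      · exact hi e
    have si := h.side hko hi hvi
    have sj := h.side hko hj hvj
    have : (1 - t) * (ε * orient (p k) (p (k + 1)) (p i)) +
        t * (ε * orient (p k) (p (k + 1)) (p j)) = 0 := by linear_combination ε * hx0
    nlinarith [mul_pos (sub_pos.mpr t1) si, mul_pos t0 sj]
  have hj0 : orient (p k) (p (k + 1)) (p j) = 0 := by
    rw [hi0, mul_zero, zero_add] at hx0
    exact (mul_eq_zero.mp hx0).resolve_left t0.ne'
  have hd : p (k + 1) - p k ≠ 0 := sub_ne_zero.mpr (h.ne_succ k).symm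
  -- Now everything is on one line; `a` and `b` are the coordinates of `p i` and `p j` when the edge
  -- is `[0, 1]`. No vertex is in the interior of the edge or of the chord, and the two overlap, so
  -- they coincide.
  obtain ⟨a, ha⟩ := exists_smul_of_cross_eq_zero hd
    (w := p i - p k) (by rwa [← orient_eq_cross])
  obtain ⟨b, hb⟩ := exists_smul_of_cross_eq_zero hd
    (w := p j - p k) (by rwa [← orient_eq_cross])
  have ha' : p i = p k + a • (p (k + 1) - p k) := by rw [← ha]; abel
  have hb' : p j = p k + b • (p (k + 1) - p k) := by rw [← hb]; abel
  obtain ⟨τ, τ0, τ1, hxτ⟩ := mem_openSegment_iff_smul.mp hko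
  have hτ : τ = a + t * (b - a) := by
    have e : (τ - (a + t * (b - a))) • (p (k + 1) - p k) = 0 := by
      have : x - x = 0 := sub_self x
      nth_rewrite 1 [hxτ] at this
      rw [hxt, ha', hb'] at this
      rw [← this]
      ext <;> simp <;> ring
    have := (smul_eq_zero.mp e).resolve_right hd
    linarith
  have nv : ∀ l, p l ∉ openSegment ℝ (p k) (p (k + 1)) := by
    intro l hl
    have := h.openSegment_edge hl (left_mem_segment ℝ (p l) (p (l + 1)))
    rw [this] at hl
    have := (left_mem_openSegment_iff (𝕜 := ℝ)).mp hl
    exact h.ne_succ k this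
  have na : ¬ (0 < a ∧ a < 1) := fun ⟨a0, a1⟩ =>
    nv i (mem_openSegment_iff_smul.mpr ⟨a, a0, a1, ha'⟩)
  have nb : ¬ (0 < b ∧ b < 1) := fun ⟨b0, b1⟩ =>
    nv j (mem_openSegment_iff_smul.mpr ⟨b, b0, b1, hb'⟩)
  have nk : ∀ c : ℝ, (∃ l, p l = p k + c • (p (k + 1) - p k)) → ¬ (a < c ∧ c < b) ∧
      ¬ (b < c ∧ c < a) := by
    rintro c ⟨l, hl⟩
    have main : ∀ s : ℝ, 0 < s → s < 1 → c = a + s * (b - a) → False := by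
      intro s s0 s1 hs
      apply hno l
      refine mem_openSegment_iff_smul.mpr ⟨s, s0, s1, ?_⟩
      rw [hl, hs, ha', hb']
      ext <;> simp <;> ring
    constructor
    · rintro ⟨c1, c2⟩
      refine main ((c - a) / (b - a)) (div_pos (by linarith) (by linarith))
        ((div_lt_one (by linarith)).mpr (by linarith)) ?_
      have : b - a ≠ 0 := by linarith
      field_simp; ring
    · rintro ⟨c1, c2⟩
      refine main ((a - c) / (a - b)) (div_pos (by linarith) (by linarith))
        ((div_lt_one (by linarith)).mpr (by linarith)) ?_
      have : a - b ≠ 0 := by linarith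
      field_simp; ring
  obtain ⟨nk0, nk0'⟩ := nk 0 ⟨k, by simp⟩
  obtain ⟨nk1, nk1'⟩ := nk 1 ⟨k + 1, by simp⟩
  rcases lt_trichotomy a b with hab | hab | hab
  · have a0 : a < τ := by nlinarith
    have b0 : τ < b := by nlinarith
    have ea : a = 0 := by
      rcases lt_trichotomy a 0 with e | e | e
      · exact (nk0 ⟨e, by linarith⟩).elim
      · exact e
      · exact (na ⟨e, by linarith⟩).elim
    have eb : b = 1 := by
      rcases lt_trichotomy b 1 with e | e | e
      · exact (nb ⟨by linarith, e⟩).elim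
      · exact e
      · exact (nk1 ⟨by linarith, e⟩).elim
    have ei : p i = p k := by rw [ha', ea]; simp
    have ej : p j = p (i + 1) := by rw [h.succ_eq ei, hb', eb]; simp
    exact h1 (h.window_inj (i := i) (by omega) (by omega) (by omega) (by omega) ej)
  · rw [← hab] at hτ; apply na; constructor <;> linarith
  · have a0 : τ < a := by nlinarith
    have b0 : b < τ := by nlinarith
    have eb : b = 0 := by
      rcases lt_trichotomy b 0 with e | e | e
      · exact (nk0' ⟨e, by linarith⟩).elim
      · exact e
      · exact (nb ⟨e, by linarith⟩).elim
    have ea : a = 1 := by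
      rcases lt_trichotomy a 1 with e | e | e
      · exact (na ⟨by linarith, e⟩).elim
      · exact e
      · exact (nk1' ⟨by linarith, e⟩).elim
    have ej : p j = p k := by rw [hb', eb]; simp
    have ei : p (j + 1) = p (i + m) := by rw [h.succ_eq ej, h.per, ha', ea]; simp
    exact h2 (h.window_inj (i := j) (by omega) (by omega) (by omega) (by omega) ei)

/-- By induction on the number of vertices strictly between `p i` and `p j`. If there are none, the
pair is an edge or a diagonal, and the visible vertex `p k` is on its inner or far side. Otherwise a
vertex in between also sees `p k`, and it replaces `p i` or `p j` without changing the sign of the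
orientation. -/
lemma orient_nonneg_of_visible (h : IsOrientedLoop p m ε) {i j k : ℕ} (hij : i < j) (hjk : j < k)
    (hk : k < i + m) (vij : segment ℝ (p i) (p j) ⊆ cls (Bd p))
    (vjk : segment ℝ (p j) (p k) ⊆ cls (Bd p)) (vki : segment ℝ (p k) (p i) ⊆ cls (Bd p)) :
    0 ≤ ε * orient (p i) (p j) (p k) := by
  classical
  generalize hN : ((Finset.range m).filter fun l => p l ∈ openSegment ℝ (p i) (p j)).card = N
  induction N using Nat.strong_induction_on generalizing i j k with
  | _ N ih =>
  by_contra! hneg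
  have hne : orient (p i) (p j) (p k) ≠ 0 := by intro e; simp [e] at hneg
  by_cases hno : ∀ l, p l ∉ openSegment ℝ (p i) (p j)
  · obtain ⟨z, hz⟩ : (openSegment ℝ (p i) (p j)).Nonempty :=
      ⟨_, mem_openSegment_iff_smul.mpr ⟨1 / 2, by norm_num, by norm_num, rfl⟩⟩
    have hzk : openSegment ℝ z (p k) ⊆ cls (Bd p) := by
      rw [openSegment_symm]
      exact (openSegment_subset_segment _ _ _).trans
        (segment_subset_cls vki vij vjk (openSegment_subset_segment _ _ _ hz))
    have hp : 0 < ε * orient (p i) (p j) (p k) := by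
      rcases h.isDiag_of_visible hij (by omega) vij hno with rfl | e | hd
      · exact h.side hz hne hzk
      · omega
      · rcases Nat.lt_or_ge j (i + 2) with hlt | hge
        · obtain rfl : j = i + 1 := by omega
          exact h.side hz hne hzk
        · refine h.chord_side hge (by omega) hd ?_ hz hzk hne
          left
          have : subchain p j (i + m) (k - j) = p k := by
            rw [subchain_of_le (by omega)]; congr 1; omega
          rw [← this]; exact IsSimpleLoop.vertex_mem _ _
    linarith
  · push Not at hno
    obtain ⟨l, hl⟩ := hno
    obtain ⟨l', hl1, hl2, e⟩ := h.exists_window i l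
    rw [← e] at hl
    clear e l
    have hpij : p i ≠ p j := fun e => hne (by rw [e, orient_same])
    obtain ⟨t, t0, t1, ht⟩ := mem_openSegment_iff_smul.mp hl
    have hli : l' ≠ i := by
      rintro rfl
      exact hpij ((left_mem_openSegment_iff (𝕜 := ℝ)).mp hl)
    have hlj : l' ≠ j := by
      rintro rfl
      exact hpij ((right_mem_openSegment_iff (𝕜 := ℝ)).mp hl)
    have hcard : ∀ a b : Plane, openSegment ℝ a b ⊆ openSegment ℝ (p i) (p j) →
        p l' ∉ openSegment ℝ a b →
        ((Finset.range m).filter fun l => p l ∈ openSegment ℝ a b).card < N := by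
      intro a b hab hlab
      rw [← hN]
      apply Finset.card_lt_card
      refine Finset.ssubset_iff_subset_ne.mpr ⟨fun x hx => ?_, fun e => ?_⟩
      · simp only [Finset.mem_filter] at hx ⊢
        exact ⟨hx.1, hab hx.2⟩
      · have : l' % m ∈ (Finset.range m).filter fun l => p l ∈ openSegment ℝ (p i) (p j) := by
          simp only [Finset.mem_filter, Finset.mem_range, h.mod_eq]
          exact ⟨Nat.mod_lt _ (by omega), hl⟩
        rw [← e] at this
        simp only [Finset.mem_filter, h.mod_eq] at this
        exact hlab this.2
    have hls := openSegment_subset_segment ℝ _ _ hl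
    have vkl : segment ℝ (p k) (p l') ⊆ cls (Bd p) := segment_subset_cls vki vij vjk hls
    have s1 : segment ℝ (p i) (p l') ⊆ segment ℝ (p i) (p j) :=
      (convex_segment _ _).segment_subset (left_mem_segment ℝ _ _) hls
    have s2 : segment ℝ (p l') (p j) ⊆ segment ℝ (p i) (p j) :=
      (convex_segment _ _).segment_subset hls (right_mem_segment ℝ _ _)
    have hc1 : openSegment ℝ (p i) (p l') ⊆ openSegment ℝ (p i) (p j) := by
      intro y hy
      obtain ⟨u, u0, u1, rfl⟩ := mem_openSegment_iff_smul.mp hy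
      refine mem_openSegment_iff_smul.mpr ⟨u * t, by positivity, by nlinarith, ?_⟩
      rw [ht]; ext <;> simp <;> ring
    have hc2 : openSegment ℝ (p l') (p j) ⊆ openSegment ℝ (p i) (p j) := by
      intro y hy
      obtain ⟨u, u0, u1, rfl⟩ := mem_openSegment_iff_smul.mp hy
      refine mem_openSegment_iff_smul.mpr ⟨t + u * (1 - t), by nlinarith, by nlinarith, ?_⟩
      rw [ht]; ext <;> simp <;> ring
    rcases Nat.lt_or_ge l' k with hlk | hlk
    · have hil : p i ≠ p l' := fun e => hli
        (h.window_inj (i := i) (by omega) (by omega) (by omega) (by omega) e).symm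
      have := ih _ (hcard (p i) (p l') hc1
          (fun e => hil ((right_mem_openSegment_iff (𝕜 := ℝ)).mp e)))
        (i := i) (j := l') (k := k) (by omega) hlk hk (s1.trans vij)
        (by rw [segment_symm]; exact vkl) vki rfl
      have e : orient (p i) (p l') (p k) = t * orient (p i) (p j) (p k) := by
        rw [ht]; simp [orient]; ring
      rw [e] at this
      nlinarith [mul_neg_of_pos_of_neg t0 hneg]
    -- If the intermediate vertex comes after `k` in the cyclic order, it takes the place of `i`,
    -- and the triple is `l', j + m, k + m`.
    · rcases hlk.eq_or_lt with rfl | hlk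
      · exact hne (orient_of_mem_segment hls)
      · have hlj' : p l' ≠ p j := fun e => hlj
          (h.window_inj (i := i) (by omega) (by omega) (by omega) (by omega) e)
        have := ih _ (hcard (p l') (p j) hc2
            (fun e => hlj' ((left_mem_openSegment_iff (𝕜 := ℝ)).mp e)))
          (i := l') (j := j + m) (k := k + m) (by omega) (by omega) (by omega)
          (by rw [h.per]; exact s2.trans vij) (by rwa [h.per, h.per])
          (by rwa [h.per]) (by rw [h.per])
        rw [h.per, h.per] at this
        have e : orient (p l') (p j) (p k) = (1 - t) * orient (p i) (p j) (p k) := by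
          rw [ht]; simp [orient]; ring
        rw [e] at this
        nlinarith [mul_neg_of_pos_of_neg (sub_pos.mpr t1) hneg]

end IsOrientedLoop


/-! ### Stabbing a sleeve -/

/-- The vertices `p a` and `p b` see each other. -/
def Sees (p : ℕ → Plane) (a b : ℕ) : Prop := segment ℝ (p a) (p b) ⊆ cls (Bd p)

lemma Sees.symm {p : ℕ → Plane} {a b : ℕ} (h : Sees p a b) : Sees p b a := by
  unfold Sees at h ⊢; rwa [segment_symm]

/-- A sequence of chords of an `m`-gon, each separating the vertex `u` from the edge joining the
last vertex and vertex `0`; two consecutive chords have a common endpoint. -/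
structure IsSleeve (m u K : ℕ) (L R : ℕ → ℕ) : Prop where
  left_lt : ∀ k ≤ K, L k < u
  lt_right : ∀ k ≤ K, u < R k
  right_lt : ∀ k ≤ K, R k < m
  step : ∀ k < K, (L (k + 1) = L k ∧ R k ≤ R (k + 1)) ∨ (R (k + 1) = R k ∧ L (k + 1) ≤ L k)

/-- The sides of the triangles of a sleeve are visible. -/
structure SleeveVisible (p : ℕ → Plane) (u K : ℕ) (L R : ℕ → ℕ) : Prop where
  left : Sees p u (L 0)
  right : Sees p u (R 0)
  chord : ∀ k ≤ K, Sees p (L k) (R k)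
  left_side : ∀ k < K, Sees p (L k) (L (k + 1))
  right_side : ∀ k < K, Sees p (R k) (R (k + 1))

/-- The line through `p u` with direction `w` stabs all the chords of a sleeve. -/
structure Stabs (p : ℕ → Plane) (ε : ℝ) (u K : ℕ) (L R : ℕ → ℕ) (w : Plane) : Prop where
  left : ∀ k ≤ K, 0 ≤ ε * cross w (p (L k) - p u)
  right : ∀ k ≤ K, ε * cross w (p (R k) - p u) ≤ 0
  orient : ∀ k ≤ K, 0 ≤ ε * orient (p u) (p (R k)) (p (L k))

/-- For collinear points, the segment from `a` to `c` is covered by the other two, whatever the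
order of the points. -/
lemma segment_subset_of_orient_eq_zero {a b c : Plane} {S : Set Plane} (h : orient a b c = 0)
    (hab : segment ℝ a b ⊆ S) (hbc : segment ℝ b c ⊆ S) : segment ℝ a c ⊆ S := by
  rcases mem_segment_of_orient_eq_zero h with h | h | h
  · exact ((convex_segment _ _).segment_subset h (right_mem_segment ℝ _ _)).trans hbc
  · rw [segment_symm] at h
    obtain ⟨t, t0, t1, rfl⟩ := mem_segment_iff_smul.mp h
    intro x hx
    obtain ⟨τ, τ0, τ1, rfl⟩ := mem_segment_iff_smul.mp hx
    rcases le_total τ t with hle | hle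
    · apply hab
      rcases t0.eq_or_lt with rfl | t0
      · obtain rfl : τ = 0 := le_antisymm hle τ0
        simp
      · refine mem_segment_iff_smul.mpr ⟨τ / t, by positivity, div_le_one_of_le₀ hle t0.le, ?_⟩
        have := t0.ne'
        ext <;> simp <;> field_simp
    · apply hbc
      rcases t1.eq_or_lt with rfl | t1
      · obtain rfl : τ = 1 := le_antisymm τ1 hle
        simp
      · have t1' := sub_pos.mpr t1
        refine mem_segment_iff_smul.mpr ⟨(τ - t) / (1 - t), div_nonneg (by linarith) t1'.le,
          div_le_one_of_le₀ (by linarith) t1'.le, ?_⟩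
        have := t1'.ne'
        ext <;> simp <;> field_simp <;> ring
  · exact ((convex_segment _ _).segment_subset (left_mem_segment ℝ _ _) h).trans hab

lemma orient_eq_zero_of_cross {u w y z : Plane} (hw : w ≠ 0) (hy : cross w (y - u) = 0)
    (hz : cross w (z - u) = 0) : orient u y z = 0 := by
  obtain ⟨a, ha⟩ := exists_smul_of_cross_eq_zero hw hy
  obtain ⟨b, hb⟩ := exists_smul_of_cross_eq_zero hw hz
  rw [orient_eq_cross, ha, hb]
  simp [cross, mul_left_comm, mul_comm]

/-- A line with the endpoints of a segment on different sides meets the segment. -/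
lemma exists_mem_segment_cross {w u a b : Plane} {ε : ℝ} (hε : ε ≠ 0)
    (ha : 0 ≤ ε * cross w (a - u)) (hb : ε * cross w (b - u) ≤ 0) :
    ∃ y ∈ segment ℝ a b, cross w (y - u) = 0 := by
  have key : ∀ t : ℝ, cross w (a + t • (b - a) - u) =
      (1 - t) * cross w (a - u) + t * cross w (b - u) := by
    intro t; simp [cross]; ring
  by_cases h : ε * cross w (a - u) = 0
  · exact ⟨a, left_mem_segment ℝ _ _, (mul_eq_zero.mp h).resolve_left hε⟩
  · have ha' : 0 < ε * cross w (a - u) := lt_of_le_of_ne ha (Ne.symm h)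
    set A := ε * cross w (a - u) with hA
    set B := ε * cross w (b - u) with hB
    refine ⟨_, mem_segment_iff_smul.mpr ⟨A / (A - B), div_nonneg ha (by linarith),
      div_le_one_of_le₀ (by linarith) (by linarith), rfl⟩, ?_⟩
    apply mul_left_cancel₀ hε
    rw [key, mul_zero, mul_add, mul_left_comm, mul_left_comm ε, ← hA, ← hB]
    have : A - B ≠ 0 := by linarith
    field_simp; ring

namespace Stabs

variable {p : ℕ → Plane} {m u K : ℕ} {L R : ℕ → ℕ} {ε : ℝ} {w : Plane}

lemma smul (h : Stabs p ε u K L R w) {c : ℝ} (hc : 0 ≤ c) : Stabs p ε u K L R (c • w) := by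
  have e : ∀ v : Plane, ε * cross (c • w) v = c * (ε * cross w v) := by
    intro v; simp [cross]; ring
  exact ⟨fun k hk => by rw [e]; exact mul_nonneg hc (h.left k hk),
    fun k hk => by rw [e]; exact mul_nonpos_of_nonneg_of_nonpos hc (h.right k hk), h.orient⟩

/-- The line stabbing a sleeve is contained in the polygon. -/
lemma segment_subset (h : Stabs p ε u K L R w) (hε : ε ≠ 0) (hw : w ≠ 0) (hs : IsSleeve m u K L R)
    (hv : SleeveVisible p u K L R) {k : ℕ} (hk : k ≤ K) {y : Plane}
    (hy : y ∈ segment ℝ (p (L k)) (p (R k))) (hyw : cross w (y - p u) = 0) :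
    segment ℝ (p u) y ⊆ cls (Bd p) := by
  induction k generalizing y with
  | zero => exact segment_subset_cls hv.left (hv.chord 0 hk) hv.right.symm hy
  | succ k ih =>
    -- The piece of the line from `z` to `y` lies in the visible triangle between two consecutive
    -- chords. The order of `p u`, `z` and `y` on the line does not matter.
    obtain ⟨z, hz, hzw⟩ := exists_mem_segment_cross hε (h.left k (by omega)) (h.right k (by omega))
    have h1 := ih (by omega) hz hzw
    refine segment_subset_of_orient_eq_zero (orient_eq_zero_of_cross hw hzw hyw) h1 ?_
    have c0 := hv.chord k (by omega)
    have c1 := hv.chord (k + 1) hk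
    rcases hs.step k (by omega) with ⟨e, -⟩ | ⟨e, -⟩
    · refine Set.Subset.trans ?_ (triangle_subset_cls c0 (hv.right_side k (by omega))
        (by rw [← e]; exact c1.symm))
      rw [e] at hy
      exact (convex_convexHull ℝ _).segment_subset
        (segment_subset_convexHull (by simp) (by simp) hz)
        (segment_subset_convexHull (by simp) (by simp) hy)
    · refine Set.Subset.trans ?_ (triangle_subset_cls c0.symm (hv.left_side k (by omega))
        (by rw [← e]; exact c1))
      rw [e] at hy
      exact (convex_convexHull ℝ _).segment_subset
        (segment_subset_convexHull (by simp) (by simp) hz)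
        (segment_subset_convexHull (by simp) (by simp) hy)

end Stabs

lemma lagrange_cross (w a b : Plane) :
    cross a b * dotp w w = dotp w a * cross w b - cross w a * dotp w b := by
  unfold cross dotp; ring

lemma lagrange_dotp (w a b : Plane) :
    dotp a b * dotp w w = dotp w a * dotp w b + cross w a * cross w b := by
  unfold cross dotp; ring

/-- The slope of a perturbed stabbing line: the largest of the lower bounds, or else the smallest of
the upper bounds. It is as small as the bounds are. -/
lemma exists_threshold {ι : Type*} (S T : Finset ι) (f : ι → ℝ) {δ : ℝ} (hδ : 0 < δ)
    (hS : ∀ i ∈ S, |f i| < δ) (hT : ∀ i ∈ T, |f i| < δ) (hST : ∀ i ∈ S, ∀ j ∈ T, f i ≤ f j) :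
    ∃ σ : ℝ, |σ| < δ ∧ (∀ i ∈ S, f i ≤ σ) ∧ ∀ j ∈ T, σ ≤ f j := by
  rcases S.eq_empty_or_nonempty with rfl | hne
  · rcases T.eq_empty_or_nonempty with rfl | hne
    · exact ⟨0, by simpa using hδ, by simp, by simp⟩
    · obtain ⟨j, hj, hmin⟩ := T.exists_min_image f hne
      exact ⟨f j, hT j hj, by simp, hmin⟩
  · obtain ⟨i, hi, hmax⟩ := S.exists_max_image f hne
    exact ⟨f i, hS i hi, hmax, fun j hj => hST i hi j hj⟩

namespace Stabs

variable {p : ℕ → Plane} {m u K : ℕ} {L R : ℕ → ℕ} {ε : ℝ} {w : Plane}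

/-- If the line contained both ends of a chord, `p u` would see both of them along the line. -/
lemma not_both_zero (h : Stabs p ε u K L R w) (ho : IsOrientedLoop p m ε) (hw : w ≠ 0)
    (hs : IsSleeve m u K L R) (hv : SleeveVisible p u K L R) {k : ℕ} (hk : k ≤ K)
    (hno : ¬ (Sees p u (L k) ∧ Sees p u (R k)))
    (hl : cross w (p (L k) - p u) = 0) (hr : cross w (p (R k) - p u) = 0) : False :=
  hno ⟨h.segment_subset ho.sign_ne hw hs hv hk (left_mem_segment ℝ _ _) hl,
    h.segment_subset ho.sign_ne hw hs hv hk (right_mem_segment ℝ _ _) hr⟩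

/-- With the right end strictly on its own side, the orientation of the chord seen from `p u` forces
the line to meet the chord in front of `p u`. -/
lemma left_pos (h : Stabs p ε u K L R w) (ho : IsOrientedLoop p m ε) (hw : w ≠ 0)
    (hs : IsSleeve m u K L R) (hv : SleeveVisible p u K L R) {k : ℕ} (hk : k ≤ K)
    (hno : ¬ (Sees p u (L k) ∧ Sees p u (R k)))
    (hl : cross w (p (L k) - p u) = 0) : 0 < dotp w (p (L k) - p u) := by
  have hne : cross w (p (R k) - p u) ≠ 0 := h.not_both_zero ho hw hs hv hk hno hl
  have ho1 := h.orient k hk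
  have hr := h.right k hk
  have hww := dotp_self_pos hw
  have hd : p (L k) - p u ≠ 0 := by
    intro e
    have := ho.window_inj (i := 0) (by omega) (by have := hs.left_lt k hk; have := hs.lt_right k hk; have := hs.right_lt k hk; omega)
      (by omega) (by have := hs.lt_right k hk; have := hs.right_lt k hk; omega)
      (sub_eq_zero.mp e)
    exact (hs.left_lt k hk).ne this
  have hA : dotp w (p (L k) - p u) ≠ 0 := by
    intro e
    have := lagrange_dotp w (p (L k) - p u) (p (L k) - p u)
    rw [e, hl] at this
    nlinarith [dotp_self_pos hd]
  refine lt_of_le_of_ne ?_ hA.symm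
  by_contra! hneg
  rw [orient_eq_cross] at ho1
  have e := lagrange_cross w (p (R k) - p u) (p (L k) - p u)
  rw [hl, mul_zero, zero_sub] at e
  have hr' : ε * cross w (p (R k) - p u) < 0 :=
    lt_of_le_of_ne hr (mul_ne_zero ho.sign_ne hne)
  have : ε * cross (p (R k) - p u) (p (L k) - p u) * dotp w w =
      -(ε * cross w (p (R k) - p u) * dotp w (p (L k) - p u)) := by
    rw [mul_assoc, e]; ring
  nlinarith [mul_pos_of_neg_of_neg hr' hneg, mul_nonneg ho1 hww.le]

lemma right_pos (h : Stabs p ε u K L R w) (ho : IsOrientedLoop p m ε) (hw : w ≠ 0)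
    (hs : IsSleeve m u K L R) (hv : SleeveVisible p u K L R) {k : ℕ} (hk : k ≤ K)
    (hno : ¬ (Sees p u (L k) ∧ Sees p u (R k)))
    (hr : cross w (p (R k) - p u) = 0) : 0 < dotp w (p (R k) - p u) := by
  have hne : cross w (p (L k) - p u) ≠ 0 := fun hl => h.not_both_zero ho hw hs hv hk hno hl hr
  have ho1 := h.orient k hk
  have hl := h.left k hk
  have hww := dotp_self_pos hw
  have hd : p (R k) - p u ≠ 0 := by
    intro e
    have := ho.window_inj (i := 0) (by omega) (by have := hs.right_lt k hk; omega)
      (by omega) (by have := hs.lt_right k hk; have := hs.right_lt k hk; omega)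
      (sub_eq_zero.mp e)
    exact (hs.lt_right k hk).ne this.symm
  have hA : dotp w (p (R k) - p u) ≠ 0 := by
    intro e
    have := lagrange_dotp w (p (R k) - p u) (p (R k) - p u)
    rw [e, hr] at this
    nlinarith [dotp_self_pos hd]
  refine lt_of_le_of_ne ?_ hA.symm
  by_contra! hneg
  rw [orient_eq_cross] at ho1
  have e := lagrange_cross w (p (R k) - p u) (p (L k) - p u)
  rw [hr, zero_mul, sub_zero] at e
  have hl' : 0 < ε * cross w (p (L k) - p u) :=
    lt_of_le_of_ne hl (mul_ne_zero ho.sign_ne hne).symm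
  have : ε * cross (p (R k) - p u) (p (L k) - p u) * dotp w w =
      dotp w (p (R k) - p u) * (ε * cross w (p (L k) - p u)) := by
    rw [mul_assoc, e]; ring
  nlinarith [mul_neg_of_neg_of_pos hneg hl', mul_nonneg ho1 hww.le]

/-- If `p u` were on the line of the chord, the side conditions would place it on the chord itself,
from where it sees both ends. -/
lemma orient_pos (h : Stabs p ε u K L R w) (ho : IsOrientedLoop p m ε) (hw : w ≠ 0)
    (hs : IsSleeve m u K L R) (hv : SleeveVisible p u K L R) {k : ℕ} (hk : k ≤ K)
    (hno : ¬ (Sees p u (L k) ∧ Sees p u (R k))) :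
    0 < ε * _root_.orient (p u) (p (R k)) (p (L k)) := by
  refine lt_of_le_of_ne (h.orient k hk) fun e => ?_
  have hc : cross (p (R k) - p u) (p (L k) - p u) = 0 :=
    (mul_eq_zero.mp e.symm).resolve_left ho.sign_ne
  have hl := h.left k hk
  have hr := h.right k hk
  have hww := dotp_self_pos hw
  have e1 := lagrange_cross w (p (R k) - p u) (p (L k) - p u)
  have e2 := lagrange_dotp w (p (R k) - p u) (p (L k) - p u)
  rw [hc, zero_mul] at e1
  have hmul : cross w (p (R k) - p u) * cross w (p (L k) - p u) ≤ 0 := by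
    have := mul_nonpos_of_nonpos_of_nonneg hr hl
    have hε : ε * ε = 1 := by rcases ho.sign with rfl | rfl <;> norm_num
    calc _ = (ε * ε) * (cross w (p (R k) - p u) * cross w (p (L k) - p u)) := by rw [hε, one_mul]
      _ ≤ 0 := by linarith
  have hdot : dotp (p (R k) - p u) (p (L k) - p u) ≤ 0 := by
    by_cases hz : cross w (p (R k) - p u) = 0
    · have hzl : cross w (p (L k) - p u) ≠ 0 := fun hl => h.not_both_zero ho hw hs hv hk hno hl hz
      rw [hz, zero_mul, sub_zero] at e1
      have := (mul_eq_zero.mp e1.symm).resolve_right hzl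
      rw [this, hz] at e2
      nlinarith
    · set Ar := dotp w (p (R k) - p u)
      set Br := cross w (p (R k) - p u)
      set Al := dotp w (p (L k) - p u)
      set Bl := cross w (p (L k) - p u)
      have hz2 : 0 < Br * Br := mul_self_pos.mpr hz
      have e3 : Br * Br * (Ar * Al + Br * Bl) = (Ar * Ar + Br * Br) * (Br * Bl) := by
        linear_combination (Br * Ar) * e1
      have : Br * Br * (Ar * Al + Br * Bl) ≤ 0 := by
        rw [e3]
        exact mul_nonpos_of_nonneg_of_nonpos
          (add_nonneg (mul_self_nonneg _) (mul_self_nonneg _)) hmul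
      have : Ar * Al + Br * Bl ≤ 0 := by
        by_contra! hpos
        nlinarith [mul_pos hz2 hpos]
      by_contra! hpos
      nlinarith [mul_pos hpos hww]
  have hu := mem_segment_of_cross_dotp hc hdot
  have hc := hv.chord k hk
  unfold Sees at hc
  rw [segment_symm] at hc
  exact hno ⟨((convex_segment _ _).segment_subset hu (right_mem_segment ℝ _ _)).trans hc,
    ((convex_segment _ _).segment_subset hu (left_mem_segment ℝ _ _)).trans hc⟩

end Stabs

/-! ### Monotone motions and the transport of stabbing lines -/

/-- A motion of a polygon that does not create visible pairs of vertices. -/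
structure IsMonotoneMotion (p : ℝ → ℕ → Plane) (m : ℕ) (ε : ℝ) : Prop where
  continuous : ∀ k, Continuous fun t => p t k
  oriented : ∀ t, IsOrientedLoop (p t) m ε
  mono : ∀ s t, s ≤ t → ∀ a b, Sees (p t) a b → Sees (p s) a b

lemma SleeveVisible.mono {p : ℝ → ℕ → Plane} {m u K : ℕ} {L R : ℕ → ℕ} {ε : ℝ}
    (hp : IsMonotoneMotion p m ε) {s t : ℝ} (hst : s ≤ t) (h : SleeveVisible (p t) u K L R) :
    SleeveVisible (p s) u K L R :=
  ⟨hp.mono s t hst _ _ h.left, hp.mono s t hst _ _ h.right,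
    fun k hk => hp.mono s t hst _ _ (h.chord k hk),
    fun k hk => hp.mono s t hst _ _ (h.left_side k hk),
    fun k hk => hp.mono s t hst _ _ (h.right_side k hk)⟩

lemma IsSleeve.left_le {m u K : ℕ} {L R : ℕ → ℕ} (h : IsSleeve m u K L R) {k : ℕ} (hk : k ≤ K) :
    L k ≤ L 0 := by
  induction k with
  | zero => exact le_rfl
  | succ k ih =>
    have := ih (by omega)
    rcases h.step k (by omega) with ⟨e, -⟩ | ⟨-, e⟩ <;> omega

lemma IsSleeve.le_right {m u K : ℕ} {L R : ℕ → ℕ} (h : IsSleeve m u K L R) {k : ℕ} (hk : k ≤ K) :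
    R 0 ≤ R k := by
  induction k with
  | zero => exact le_rfl
  | succ k ih =>
    have := ih (by omega)
    rcases h.step k (by omega) with ⟨-, e⟩ | ⟨e, -⟩ <;> omega

lemma IsSleeve.truncate {m u K : ℕ} {L R : ℕ → ℕ} (h : IsSleeve m u K L R) {a : ℕ} (ha : a ≤ K) :
    IsSleeve m u (K - a) (fun k => L (k + a)) (fun k => R (k + a)) where
  left_lt k hk := h.left_lt _ (by omega)
  lt_right k hk := h.lt_right _ (by omega)
  right_lt k hk := h.right_lt _ (by omega)
  step k hk := by
    have := h.step (k + a) (by omega)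
    rwa [show k + a + 1 = k + 1 + a by omega] at this

/-- As soon as `p u` sees both ends of chord `a`, these sides close a triangle with that chord, and
the sleeve may start there. -/
lemma SleeveVisible.truncate {p : ℕ → Plane} {u K : ℕ} {L R : ℕ → ℕ}
    (h : SleeveVisible p u K L R) {a : ℕ} (ha : a ≤ K) (hl : Sees p u (L a)) (hr : Sees p u (R a)) :
    SleeveVisible p u (K - a) (fun k => L (k + a)) (fun k => R (k + a)) where
  left := by simpa using hl
  right := by simpa using hr
  chord k hk := h.chord _ (by omega)
  left_side k hk := by
    have := h.left_side (k + a) (by omega)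
    rwa [show k + a + 1 = k + 1 + a by omega] at this
  right_side k hk := by
    have := h.right_side (k + a) (by omega)
    rwa [show k + a + 1 = k + 1 + a by omega] at this

lemma Stabs.truncate {p : ℕ → Plane} {u K : ℕ} {L R : ℕ → ℕ} {ε : ℝ} {w : Plane}
    (h : Stabs p ε u K L R w) {a : ℕ} (ha : a ≤ K) :
    Stabs p ε u (K - a) (fun k => L (k + a)) (fun k => R (k + a)) w where
  left k hk := h.left _ (by omega)
  right k hk := h.right _ (by omega)
  orient k hk := h.orient _ (by omega)


/-- The sign of the constraint that a vertex of a sleeve puts on a stabbing line. -/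
noncomputable def sideSign (u v : ℕ) : ℝ := if v < u then 1 else -1

lemma sideSign_of_lt {u v : ℕ} (h : v < u) : sideSign u v = 1 := if_pos h

lemma sideSign_of_gt {u v : ℕ} (h : u < v) : sideSign u v = -1 := if_neg (by omega)

/-- The vertices of a sleeve. -/
def sleeveVertices (K : ℕ) (L R : ℕ → ℕ) : Finset ℕ :=
  (Finset.range (K + 1)).image L ∪ (Finset.range (K + 1)).image R

lemma mem_sleeveVertices {K : ℕ} {L R : ℕ → ℕ} {v : ℕ} :
    v ∈ sleeveVertices K L R ↔ ∃ k ≤ K, v = L k ∨ v = R k := by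
  simp only [sleeveVertices, Finset.mem_union, Finset.mem_image, Finset.mem_range]
  constructor
  · rintro (⟨k, hk, rfl⟩ | ⟨k, hk, rfl⟩)
    · exact ⟨k, by omega, Or.inl rfl⟩
    · exact ⟨k, by omega, Or.inr rfl⟩
  · rintro ⟨k, hk, rfl | rfl⟩
    · exact Or.inl ⟨k, by omega, rfl⟩
    · exact Or.inr ⟨k, by omega, rfl⟩

/-- The normal to `w` on the side given by `ε`. -/
def normalTo (ε : ℝ) (w : Plane) : Plane := (-(ε * w.2), ε * w.1)

/-- Turning the line changes the constraint of a vertex at a rate given by its position `dotp w d`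
along the line. Hence vertices in front of and behind `p u` bound the slope from opposite sides. -/
lemma cross_add_normalTo {ε : ℝ} (hε : ε = 1 ∨ ε = -1) (w d : Plane) (σ : ℝ) :
    ε * cross (w + σ • normalTo ε w) d = ε * cross w d - σ * dotp w d := by
  rcases hε with rfl | rfl <;> simp [cross, dotp, normalTo] <;> ring

lemma add_normalTo_ne_zero {ε : ℝ} {w : Plane} (hw : w ≠ 0) (σ : ℝ) :
    w + σ • normalTo ε w ≠ 0 := by
  intro h
  have : dotp w (w + σ • normalTo ε w) = dotp w w := by simp [dotp, normalTo]; ring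
  rw [h] at this
  have h2 := dotp_self_pos hw
  rw [← this] at h2
  simp [dotp] at h2

lemma IsSleeve.stabs_iff {p : ℕ → Plane} {m u K : ℕ} {L R : ℕ → ℕ} {ε : ℝ} {w : Plane}
    (hs : IsSleeve m u K L R) : Stabs p ε u K L R w ↔
      (∀ v ∈ sleeveVertices K L R, 0 ≤ sideSign u v * (ε * cross w (p v - p u))) ∧
      ∀ k ≤ K, 0 ≤ ε * orient (p u) (p (R k)) (p (L k)) := by
  constructor
  · intro h
    refine ⟨fun v hv => ?_, h.orient⟩
    obtain ⟨k, hk, rfl | rfl⟩ := mem_sleeveVertices.mp hv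
    · rw [sideSign_of_lt (hs.left_lt k hk), one_mul]; exact h.left k hk
    · rw [sideSign_of_gt (hs.lt_right k hk)]; linarith [h.right k hk]
  · rintro ⟨h, h'⟩
    refine ⟨fun k hk => ?_, fun k hk => ?_, h'⟩
    · have := h _ (mem_sleeveVertices.mpr ⟨k, hk, Or.inl rfl⟩)
      rwa [sideSign_of_lt (hs.left_lt k hk), one_mul] at this
    · have := h _ (mem_sleeveVertices.mpr ⟨k, hk, Or.inr rfl⟩)
      rw [sideSign_of_gt (hs.lt_right k hk)] at this
      linarith

/-- The constraint `0 ≤ s * (B - σ * A)` bounds `σ` by `B / A`, from below if `s * A < 0` and from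
above if `0 < s * A`. A lower and an upper bound are compatible if the determinant, which will be an
orientation, has the right sign. -/
lemma threshold_le {A B A' B' s s' : ℝ} (hs : s * s = 1) (hs' : s' * s' = 1) (h : s * A < 0)
    (h' : 0 < s' * A') (hc : 0 ≤ s * s' * (B * A' - B' * A)) : B / A ≤ B' / A' := by
  have hA : A ≠ 0 := by rintro rfl; simp at h
  have hA' : A' ≠ 0 := by rintro rfl; simp at h'
  have e : B / A = (s * B) / (s * A) := by
    rw [mul_div_mul_left]; rintro rfl; simp at hs
  have e' : B' / A' = (s' * B') / (s' * A') := by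
    rw [mul_div_mul_left]; rintro rfl; simp at hs'
  rw [e, e', ← neg_div_neg_eq (s * B), div_le_div_iff₀ (by linarith) h']
  nlinarith

lemma orient_eq_dotp_cross (w u a b : Plane) : orient u a b * dotp w w =
    dotp w (a - u) * cross w (b - u) - cross w (a - u) * dotp w (b - u) := by
  rw [orient_eq_cross, lagrange_cross]

namespace IsMonotoneMotion

variable {p : ℝ → ℕ → Plane} {m u K : ℕ} {L R : ℕ → ℕ} {ε t : ℝ} {w : Plane}

/-- A stabbing line that is critical at no chord but the first can be moved back in time. -/
lemma eventually_stabs (hp : IsMonotoneMotion p m ε) (hs : IsSleeve m u K L R) (hK : 1 ≤ K)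
    (hv : SleeveVisible (p t) u K L R) (hw : w ≠ 0) (h : Stabs (p t) ε u K L R w)
    (hno : ∀ k, 1 ≤ k → k ≤ K → ¬ (Sees (p t) u (L k) ∧ Sees (p t) u (R k))) :
    ∀ᶠ s in 𝓝[<] t, ∃ w', w' ≠ 0 ∧ Stabs (p s) ε u K L R w' := by
  have ho := hp.oriented t
  have hww := dotp_self_pos hw
  set V := sleeveVertices K L R with hV
  -- Relative to `p u` at time `s`, `A` is the coordinate of a vertex along `w` and `B` the signed
  -- one across it, both scaled by the length of `w`. A vertex is critical if `B t v = 0`.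
  set A : ℝ → ℕ → ℝ := fun s v => dotp w (p s v - p s u) with hA
  set B : ℝ → ℕ → ℝ := fun s v => ε * cross w (p s v - p s u) with hB
  have hAc : ∀ v, Continuous fun s => A s v := by
    intro v
    have h1 := hp.continuous v
    have h2 := hp.continuous u
    simp only [hA, dotp]; fun_prop
  have hBc : ∀ v, Continuous fun s => B s v := by
    intro v
    have h1 := hp.continuous v
    have h2 := hp.continuous u
    simp only [hB, cross]; fun_prop
  have hOc : ∀ k, Continuous fun s => ε * orient (p s u) (p s (R k)) (p s (L k)) := by
    intro k
    have h1 := hp.continuous (L k)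
    have h2 := hp.continuous u
    have h3 := hp.continuous (R k)
    simp only [orient]; fun_prop
  obtain ⟨hQ, -⟩ := hs.stabs_iff.mp h
  have hsq : ∀ v, sideSign u v * sideSign u v = 1 := by
    intro v; unfold sideSign; split_ifs <;> norm_num
  have crit : ∀ v, B t v = 0 → cross w (p t v - p t u) = 0 := fun v e =>
    (mul_eq_zero.mp e).resolve_left ho.sign_ne
  -- critical vertices of later chords are in front
  have front : ∀ k, 1 ≤ k → k ≤ K → ∀ v, (v = L k ∨ v = R k) → B t v = 0 → 0 < A t v := by
    rintro k h1 hk v (rfl | rfl) e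
    · exact h.left_pos ho hw hs hv hk (hno k h1 hk) (crit _ e)
    · exact h.right_pos ho hw hs hv hk (hno k h1 hk) (crit _ e)
  have hAne : ∀ v ∈ V, B t v = 0 → A t v ≠ 0 := by
    intro v hvV e eA
    have hd : p t v - p t u ≠ 0 := by
      intro e'
      have hvu : v ≠ u ∧ v < m ∧ u < m := by
        obtain ⟨k, hk, rfl | rfl⟩ := mem_sleeveVertices.mp hvV
        · have := hs.left_lt k hk; have := hs.lt_right k hk; have := hs.right_lt k hk
          omega
        · have := hs.lt_right k hk; have := hs.right_lt k hk
          omega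
      exact hvu.1 (ho.window_inj (i := 0) (by omega) (by omega) (by omega) (by omega)
        (sub_eq_zero.mp e'))
    have := lagrange_dotp w (p t v - p t u) (p t v - p t u)
    rw [crit v e, show dotp w (p t v - p t u) = 0 from eA] at this
    nlinarith [dotp_self_pos hd]
  have behind : ∀ v ∈ V, B t v = 0 → A t v < 0 → ∀ k, 1 ≤ k → k ≤ K → v ≠ L k ∧ v ≠ R k := by
    intro v _ e eA k h1 hk
    constructor
    · intro e'; linarith [front k h1 hk v (Or.inl e') e]
    · intro e'; linarith [front k h1 hk v (Or.inr e') e]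
  -- uniform bound for the noncritical vertices
  have hnc : ∀ᶠ x : ℝ × ℝ in 𝓝 (t, 0), ∀ v ∈ V, B t v ≠ 0 →
      0 < sideSign u v * (B x.1 v - x.2 * A x.1 v) := by
    rw [Filter.eventually_all_finset]
    intro v hvV
    by_cases e : B t v = 0
    · simp [e]
    · have hc : Continuous fun x : ℝ × ℝ => sideSign u v * (B x.1 v - x.2 * A x.1 v) := by
        have := (hAc v).comp continuous_fst (X := ℝ × ℝ)
        have := (hBc v).comp continuous_fst (X := ℝ × ℝ)
        simp only [Function.comp_def] at *
        fun_prop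
      have h0 : 0 < sideSign u v * (B (t, (0:ℝ)).1 v - (t, (0:ℝ)).2 * A (t, (0:ℝ)).1 v) := by
        simp only [zero_mul, sub_zero]
        refine lt_of_le_of_ne (hQ v hvV) (Ne.symm (mul_ne_zero ?_ e))
        intro e'; have := hsq v; rw [e'] at this; simp at this
      filter_upwards [hc.tendsto _ |>.eventually (lt_mem_nhds h0)] with x hx _ using hx
  obtain ⟨δ, hδ, hball⟩ := Metric.eventually_nhds_iff.mp hnc
  have ev1 : ∀ᶠ s in 𝓝 t, ∀ v ∈ V, B t v = 0 → |B s v / A s v| < δ ∧ 0 < A s v * A t v := by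
    rw [Filter.eventually_all_finset]
    intro v hvV
    by_cases e : B t v = 0
    · have hne := hAne v hvV e
      have h1 : Tendsto (fun s => |B s v / A s v|) (𝓝 t) (𝓝 |B t v / A t v|) :=
        (((hBc v).tendsto t).div ((hAc v).tendsto t) hne).abs
      have h2 : Tendsto (fun s => A s v * A t v) (𝓝 t) (𝓝 (A t v * A t v)) :=
        ((hAc v).tendsto t).mul_const _
      rw [e, zero_div, abs_zero] at h1
      filter_upwards [h1.eventually (gt_mem_nhds hδ),
        h2.eventually (lt_mem_nhds (mul_self_pos.mpr hne))] with s a b _ using ⟨a, b⟩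
    · simp [e]
  have ev2 : ∀ᶠ s in 𝓝 t, ∀ k ∈ Finset.Icc 1 K,
      0 < ε * orient (p s u) (p s (R k)) (p s (L k)) := by
    rw [Filter.eventually_all_finset]
    intro k hk
    obtain ⟨h1, hk⟩ := Finset.mem_Icc.mp hk
    exact (hOc k).tendsto t |>.eventually
      (lt_mem_nhds (h.orient_pos ho hw hs hv hk (hno k h1 hk)))
  have ev3 : ∀ᶠ s in 𝓝 t, dist s t < δ := Metric.ball_mem_nhds t hδ
  filter_upwards [nhdsWithin_le_nhds ev1, nhdsWithin_le_nhds ev2, nhdsWithin_le_nhds ev3,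
    self_mem_nhdsWithin] with s e1 e2 e3 hst
  have hst : s ≤ t := le_of_lt hst
  have hos := hp.oriented s
  have hvs := hv.mono hp hst
  -- critical vertices and `u` see each other
  have seen : ∀ v ∈ V, B t v = 0 → Sees (p t) u v := by
    intro v hvV e
    obtain ⟨k, hk, rfl | rfl⟩ := mem_sleeveVertices.mp hvV
    · exact h.segment_subset ho.sign_ne hw hs hv hk (left_mem_segment ℝ _ _) (crit _ e)
    · exact h.segment_subset ho.sign_ne hw hs hv hk (right_mem_segment ℝ _ _) (crit _ e)
  have seen2 : ∀ v ∈ V, ∀ v' ∈ V, B t v = 0 → B t v' = 0 → Sees (p t) v v' := by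
    intro v hvV v' hvV' e e'
    refine segment_subset_of_orient_eq_zero (b := p t u) ?_ (seen v hvV e).symm (seen v' hvV' e')
    rw [← orient_rotate]
    exact orient_eq_zero_of_cross hw (crit _ e') (crit _ e)
  have vlt : ∀ v ∈ V, v < m := by
    intro v hvV
    obtain ⟨k, hk, rfl | rfl⟩ := mem_sleeveVertices.mp hvV
    · have := hs.left_lt k hk; have := hs.lt_right k hk; have := hs.right_lt k hk
      omega
    · exact hs.right_lt k hk
  -- This is where monotonicity enters: triples that are mutually visible at time `t` are so at time
  -- `s`, and hence correctly oriented.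
  have nonneg : ∀ i j k, i < j → j < k → k < i + m → Sees (p t) i j → Sees (p t) j k →
      Sees (p t) i k → 0 ≤ ε * orient (p s i) (p s j) (p s k) := fun i j k hij hjk hk v1 v2 v3 =>
    hos.orient_nonneg_of_visible hij hjk hk (hp.mono s t hst _ _ v1) (hp.mono s t hst _ _ v2)
      (hp.mono s t hst _ _ v3.symm)
  have hum : u < m := (hs.lt_right 0 (by omega)).trans (hs.right_lt 0 (by omega))
  -- A critical vertex behind `p u` is an end of the first chord, and so the vertex on its side that
  -- is next to `u` in the numbering.
  have side : ∀ v ∈ V, (v < u ∧ v ≤ L 0 ∧ (A t v < 0 → B t v = 0 → v = L 0)) ∨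
      (u < v ∧ R 0 ≤ v ∧ (A t v < 0 → B t v = 0 → v = R 0)) := by
    intro v hvV
    obtain ⟨k, hk, hvk⟩ := mem_sleeveVertices.mp hvV
    have hb : A t v < 0 → B t v = 0 → k = 0 := by
      intro a b
      by_contra hk0
      have := behind v hvV b a k (by omega) hk
      exact hvk.elim this.1 this.2
    rcases hvk with rfl | rfl
    · exact Or.inl ⟨hs.left_lt k hk, hs.left_le hk, fun a b => by rw [hb a b]⟩
    · exact Or.inr ⟨hs.lt_right k hk, hs.le_right hk, fun a b => by rw [hb a b]⟩
  -- The critical vertices give lower bounds (first set) and upper bounds (second set) for the slope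
  -- `σ`. Being less than `δ` in absolute value, `σ` does no harm to the other vertices.
  obtain ⟨σ, hσ, hS, hT⟩ := exists_threshold
    (V.filter fun v => B t v = 0 ∧ sideSign u v * A t v < 0)
    (V.filter fun v => B t v = 0 ∧ 0 < sideSign u v * A t v) (fun v => B s v / A s v) hδ
    (fun v hv => (e1 v (Finset.mem_filter.mp hv).1 (Finset.mem_filter.mp hv).2.1).1)
    (fun v hv => (e1 v (Finset.mem_filter.mp hv).1 (Finset.mem_filter.mp hv).2.1).1)
    (by
      intro i hi j hj
      obtain ⟨hiV, hi0, hiA⟩ := Finset.mem_filter.mp hi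
      obtain ⟨hjV, hj0, hjA⟩ := Finset.mem_filter.mp hj
      have si := (e1 i hiV hi0).2
      have sj := (e1 j hjV hj0).2
      have him := vlt i hiV
      have hjm := vlt j hjV
      have hij : i ≠ j := by rintro rfl; linarith
      apply threshold_le (hsq i) (hsq j)
      · by_contra! hcon
        nlinarith [hsq i, mul_nonneg_of_nonpos_of_nonpos hiA.le (neg_nonpos.mpr hcon)]
      · by_contra! hcon
        nlinarith [hsq j, mul_nonneg_of_nonpos_of_nonpos (neg_nonpos.mpr hjA.le) hcon]
      have e : B s i * A s j - B s j * A s i =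
          ε * orient (p s u) (p s j) (p s i) * dotp w w := by
        have e0 := orient_eq_dotp_cross w (p s u) (p s j) (p s i)
        simp only [hA, hB]
        linear_combination -ε * e0
      rw [e, ← mul_assoc]
      refine mul_nonneg ?_ hww.le
      have vij := seen2 i hiV j hjV hi0 hj0
      -- In each case the boundary order of `i`, `j`, `u` gives the sign of the determinant. The
      -- exception is `i` on the left and `j` on the right, both behind `p u`: they would be the two
      -- ends of the first chord, one of which is also an end of the second chord and therefore in
      -- front.
      rcases side i hiV with ⟨iu, iL, ib⟩ | ⟨iu, iR, ib⟩ <;>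
        rcases side j hjV with ⟨ju, jL, jb⟩ | ⟨ju, jR, jb⟩
      · rw [sideSign_of_lt iu] at hiA ⊢
        rw [sideSign_of_lt ju, one_mul, one_mul]
        have := ib (by linarith) hi0
        have := nonneg j i u (by omega) iu (by omega) vij.symm (seen i hiV hi0).symm
          (seen j hjV hj0).symm
        rwa [← orient_rotate, ← orient_rotate] at this
      · exfalso
        rw [sideSign_of_lt iu] at hiA
        rw [sideSign_of_gt ju] at hjA
        have hi := ib (by linarith) hi0
        have hj := jb (by linarith) hj0
        rcases hs.step 0 (by omega) with ⟨e, -⟩ | ⟨e, -⟩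
        · exact (behind i hiV hi0 (by linarith) 1 le_rfl hK).1 (hi.trans e.symm)
        · exact (behind j hjV hj0 (by linarith) 1 le_rfl hK).2 (hj.trans e.symm)
      · rw [sideSign_of_gt iu, sideSign_of_lt ju]
        have := nonneg j u i ju iu (by omega) (seen j hjV hj0).symm (seen i hiV hi0) vij.symm
        have e3 : orient (p s j) (p s u) (p s i) = -orient (p s u) (p s j) (p s i) :=
          orient_swap _ _ _
        rw [e3] at this
        linarith
      · rw [sideSign_of_gt iu, sideSign_of_gt ju]
        rw [sideSign_of_gt ju] at hjA
        have := jb (by linarith) hj0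
        have := nonneg u j i ju (by omega) (by omega) (seen j hjV hj0) vij.symm (seen i hiV hi0)
        linarith)
  refine ⟨w + σ • normalTo ε w, add_normalTo_ne_zero hw σ, hs.stabs_iff.mpr ⟨?_, ?_⟩⟩
  · intro v hvV
    rw [cross_add_normalTo ho.sign]
    change 0 ≤ sideSign u v * (B s v - σ * A s v)
    by_cases e : B t v = 0
    · have sv := (e1 v hvV e).2
      have hne : A s v ≠ 0 := by intro e'; rw [e', zero_mul] at sv; exact lt_irrefl _ sv
      have e4 : sideSign u v * (B s v - σ * A s v) =
          sideSign u v * A s v * (B s v / A s v - σ) := by field_simp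
      rw [e4]
      have hne' : sideSign u v * A t v ≠ 0 := by
        apply mul_ne_zero _ (hAne v hvV e)
        intro e'; have := hsq v; rw [e'] at this; simp at this
      have hprod : 0 < (sideSign u v * A s v) * (sideSign u v * A t v) := by
        have : (sideSign u v * A s v) * (sideSign u v * A t v) =
          (sideSign u v * sideSign u v) * (A s v * A t v) := by ring
        rw [this, hsq, one_mul]; exact sv
      rcases lt_or_gt_of_ne hne' with hlt | hgt
      · have := hS v (Finset.mem_filter.mpr ⟨hvV, e, hlt⟩)
        have : sideSign u v * A s v < 0 := by by_contra! hcon; nlinarith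
        nlinarith
      · have := hT v (Finset.mem_filter.mpr ⟨hvV, e, hgt⟩)
        have : 0 < sideSign u v * A s v := by by_contra! hcon; nlinarith
        nlinarith
    · refine (hball (y := (s, σ)) ?_ v hvV e).le
      rw [Prod.dist_eq, max_lt_iff]
      exact ⟨e3, by simpa using hσ⟩
  · intro k hk
    -- The first chord forms a visible triangle with `p u`, so its orientation is known at time `s`.
    -- For the later chords the strict inequality at time `t` persists.
    rcases Nat.eq_zero_or_pos k with rfl | hk0
    · have h1 := hs.left_lt 0 hk
      have h2 := hs.lt_right 0 hk
      have h3 := hs.right_lt 0 hk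
      have := nonneg (L 0) u (R 0) h1 h2 (by omega) hv.left.symm hv.right (hv.chord 0 hk)
      rwa [← orient_rotate] at this
    · exact (e2 k (Finset.mem_Icc.mpr ⟨hk0, hk⟩)).le

end IsMonotoneMotion


lemma continuous_cross₂ {X : Type*} [TopologicalSpace X] {f g : X → Plane} (hf : Continuous f)
    (hg : Continuous g) : Continuous fun x => cross (f x) (g x) := by
  unfold cross; fun_prop

lemma continuous_orient₃ {X : Type*} [TopologicalSpace X] {f g k : X → Plane} (hf : Continuous f)
    (hg : Continuous g) (hk : Continuous k) : Continuous fun x => orient (f x) (g x) (k x) := by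
  unfold orient; fun_prop

/-- No vertex lies between two vertices that see each other. -/
def IsGeneric (p : ℕ → Plane) : Prop :=
  ∀ i j k, p i ≠ p j → Sees p i j → p k ∉ openSegment ℝ (p i) (p j)

lemma IsGeneric.orient_ne_zero {p : ℕ → Plane} (h : IsGeneric p) {i j k : ℕ} (hij : p i ≠ p j)
    (hjk : p j ≠ p k) (hki : p k ≠ p i) (sij : Sees p i j) (sjk : Sees p j k)
    (ski : Sees p k i) : orient (p i) (p j) (p k) ≠ 0 := by
  intro e
  rcases mem_segment_of_orient_eq_zero e with e | e | e
  · exact h j k i hjk sjk (mem_openSegment_of_ne_left_right hij.symm hki e)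
  · exact h k i j hki ski (mem_openSegment_of_ne_left_right hjk.symm hij e)
  · exact h i j k hij sij (mem_openSegment_of_ne_left_right hki.symm hjk e)

/-- In generic position a stabbing line can be made to avoid the endpoints of the last chord. -/
lemma Stabs.exists_mem_openSegment {p : ℕ → Plane} {m u K : ℕ} {L R : ℕ → ℕ} {ε : ℝ} {w : Plane}
    (h : Stabs p ε u K L R w) (ho : IsOrientedLoop p m ε) (hgen : IsGeneric p) (hw : w ≠ 0)
    (hs : IsSleeve m u K L R) (hv : SleeveVisible p u K L R)
    (hno : ¬ (Sees p u (L K) ∧ Sees p u (R K))) :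
    ∃ q ∈ openSegment ℝ (p (L K)) (p (R K)), segment ℝ (p u) q ⊆ cls (Bd p) := by
  -- the case of a line avoiding the endpoints
  have main : ∀ w', w' ≠ 0 → Stabs p ε u K L R w' → cross w' (p (L K) - p u) ≠ 0 →
      cross w' (p (R K) - p u) ≠ 0 →
      ∃ q ∈ openSegment ℝ (p (L K)) (p (R K)), segment ℝ (p u) q ⊆ cls (Bd p) := by
    intro w' hw' h' hl hr
    obtain ⟨q, hq, hqw⟩ := exists_mem_segment_cross ho.sign_ne (h'.left K le_rfl) (h'.right K le_rfl)
    refine ⟨q, mem_openSegment_of_ne_left_right ?_ ?_ hq,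
      h'.segment_subset ho.sign_ne hw' hs hv le_rfl hq hqw⟩
    · rintro rfl; exact hl hqw
    · rintro rfl; exact hr hqw
  by_cases hcr : cross w (p (L K) - p u) ≠ 0 ∧ cross w (p (R K) - p u) ≠ 0
  · exact main w hw h hcr.1 hcr.2
  have hsq : ∀ v, sideSign u v * sideSign u v = 1 := by
    intro v; unfold sideSign; split_ifs <;> norm_num
  -- `v0` is an end of the last chord on the line, in front of `p u`. By genericity it is the only
  -- vertex of the sleeve on the line, so a small turn that relaxes its constraint makes all
  -- constraints strict.
  obtain ⟨v0, hv0, hc0, hA0⟩ : ∃ v0 ∈ sleeveVertices K L R, cross w (p v0 - p u) = 0 ∧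
      0 < dotp w (p v0 - p u) := by
    by_cases hl : cross w (p (L K) - p u) = 0
    · exact ⟨L K, mem_sleeveVertices.mpr ⟨K, le_rfl, Or.inl rfl⟩, hl,
        h.left_pos ho hw hs hv le_rfl hno hl⟩
    · have hr : cross w (p (R K) - p u) = 0 := by
        by_contra hr; exact hcr ⟨hl, hr⟩
      exact ⟨R K, mem_sleeveVertices.mpr ⟨K, le_rfl, Or.inr rfl⟩, hr,
        h.right_pos ho hw hs hv le_rfl hno hr⟩
  have seen : ∀ v ∈ sleeveVertices K L R, cross w (p v - p u) = 0 → Sees p u v := by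
    intro v hvV e
    obtain ⟨k, hk, rfl | rfl⟩ := mem_sleeveVertices.mp hvV
    · exact h.segment_subset ho.sign_ne hw hs hv hk (left_mem_segment ℝ _ _) e
    · exact h.segment_subset ho.sign_ne hw hs hv hk (right_mem_segment ℝ _ _) e
  have vne : ∀ v ∈ sleeveVertices K L R, p u ≠ p v := by
    intro v hvV e
    have hvu : v ≠ u ∧ v < m ∧ u < m := by
      obtain ⟨k, hk, rfl | rfl⟩ := mem_sleeveVertices.mp hvV
      · have := hs.left_lt k hk; have := hs.lt_right k hk; have := hs.right_lt k hk
        omega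
      · have := hs.lt_right k hk; have := hs.right_lt k hk
        omega
    exact hvu.1 (ho.window_inj (i := 0) (by omega) (by omega) (by omega) (by omega) e.symm)
  obtain ⟨hQ, hO⟩ := hs.stabs_iff.mp h
  -- all the other vertices are off the line
  have hother : ∀ v ∈ sleeveVertices K L R, p v ≠ p v0 →
      0 < sideSign u v * (ε * cross w (p v - p u)) := by
    intro v hvV hvv
    refine lt_of_le_of_ne (hQ v hvV) fun e => ?_
    have e' : cross w (p v - p u) = 0 := by
      rcases mul_eq_zero.mp e.symm with e | e
      · have := hsq v; rw [e] at this; simp at this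
      · exact (mul_eq_zero.mp e).resolve_left ho.sign_ne
    have s1 := seen v hvV e'
    have s2 := seen v0 hv0 hc0
    have ho0 := orient_eq_zero_of_cross hw e' hc0
    refine hgen.orient_ne_zero (vne v hvV) hvv (vne v0 hv0).symm s1 ?_ s2.symm ho0
    exact segment_subset_of_orient_eq_zero (b := p u)
      (by rw [← orient_rotate]; exact orient_eq_zero_of_cross hw hc0 e') s1.symm s2
  have hev : ∀ᶠ τ : ℝ in 𝓝[>] 0, ∀ v ∈ sleeveVertices K L R, p v ≠ p v0 →
      0 < sideSign u v * (ε * cross w (p v - p u) - (-τ * sideSign u v0) * dotp w (p v - p u)) := by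
    rw [Filter.eventually_all_finset]
    intro v hvV
    by_cases e : p v = p v0
    · simp [e]
    · have hc : Continuous fun τ : ℝ => sideSign u v *
          (ε * cross w (p v - p u) - (-τ * sideSign u v0) * dotp w (p v - p u)) := by fun_prop
      have h0 := hc.tendsto 0
      simp only [neg_zero, zero_mul, sub_zero] at h0
      filter_upwards [nhdsWithin_le_nhds (h0.eventually (lt_mem_nhds (hother v hvV e)))]
        with τ hτ _ using hτ
  obtain ⟨τ, hτ, hτ0⟩ := (hev.and self_mem_nhdsWithin).exists
  have hτ0 : 0 < τ := hτ0
  have hall : ∀ v ∈ sleeveVertices K L R, 0 < sideSign u v *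
      (ε * cross (w + (-τ * sideSign u v0) • normalTo ε w) (p v - p u)) := by
    intro v hvV
    rw [cross_add_normalTo ho.sign]
    by_cases e : p v = p v0
    · have hvv : v = v0 := by
        have lt : ∀ v ∈ sleeveVertices K L R, v < m := by
          intro v hvV
          obtain ⟨k, hk, rfl | rfl⟩ := mem_sleeveVertices.mp hvV
          · have := hs.left_lt k hk; have := hs.lt_right k hk; have := hs.right_lt k hk
            omega
          · exact hs.right_lt k hk
        have l1 := lt v hvV
        have l2 := lt v0 hv0
        exact ho.window_inj (i := 0) (by omega) (by omega) (by omega) (by omega) e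
      rw [hvv, hc0]
      have : sideSign u v0 * (ε * 0 - -τ * sideSign u v0 * dotp w (p v0 - p u)) =
          (sideSign u v0 * sideSign u v0) * (τ * dotp w (p v0 - p u)) := by ring
      rw [this, hsq, one_mul]
      positivity
    · exact hτ v hvV e
  have hne : ∀ v ∈ sleeveVertices K L R,
      cross (w + (-τ * sideSign u v0) • normalTo ε w) (p v - p u) ≠ 0 := by
    intro v hvV e
    have := hall v hvV
    rw [e] at this
    simp at this
  exact main _ (add_normalTo_ne_zero hw _) (hs.stabs_iff.mpr ⟨fun v hvV => (hall v hvV).le, hO⟩)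
    (hne _ (mem_sleeveVertices.mpr ⟨K, le_rfl, Or.inl rfl⟩))
    (hne _ (mem_sleeveVertices.mpr ⟨K, le_rfl, Or.inr rfl⟩))

namespace IsMonotoneMotion

variable {p : ℝ → ℕ → Plane} {m u : ℕ} {ε : ℝ}

/-- The directions can be normalised to the compact unit sphere, and the projection along a compact
factor is a closed map. -/
lemma isClosed_stabs (hp : IsMonotoneMotion p m ε) (u K : ℕ) (L R : ℕ → ℕ) :
    IsClosed {t | ∃ w, w ≠ 0 ∧ Stabs (p t) ε u K L R w} := by
  have e : {t | ∃ w, w ≠ 0 ∧ Stabs (p t) ε u K L R w} =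
      Prod.fst '' {x : ℝ × Metric.sphere (0 : Plane) 1 | Stabs (p x.1) ε u K L R x.2} := by
    ext t
    constructor
    · rintro ⟨w, hw, h⟩
      refine ⟨(t, ⟨‖w‖⁻¹ • w, ?_⟩), h.smul (by positivity), rfl⟩
      rw [mem_sphere_zero_iff_norm, norm_smul, norm_inv, norm_norm,
        inv_mul_cancel₀ (norm_ne_zero_iff.mpr hw)]
    · rintro ⟨⟨t, w, hw⟩, h, rfl⟩
      refine ⟨w, ?_, h⟩
      rintro rfl
      simp at hw
  rw [e]
  apply isClosedMap_fst_of_compactSpace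
  have e' : {x : ℝ × Metric.sphere (0 : Plane) 1 | Stabs (p x.1) ε u K L R x.2} =
      ⋂ k, ⋂ (_ : k ≤ K), ({x | 0 ≤ ε * cross x.2 (p x.1 (L k) - p x.1 u)} ∩
        {x | ε * cross x.2 (p x.1 (R k) - p x.1 u) ≤ 0}) ∩
        {x | 0 ≤ ε * orient (p x.1 u) (p x.1 (R k)) (p x.1 (L k))} := by
    ext x
    simp only [Set.mem_iInter, Set.mem_inter_iff, Set.mem_ofPred_eq]
    exact ⟨fun h k hk => ⟨⟨h.left k hk, h.right k hk⟩, h.orient k hk⟩, fun h =>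
      ⟨fun k hk => (h k hk).1.1, fun k hk => (h k hk).1.2, fun k hk => (h k hk).2⟩⟩
  rw [e']
  have hc : ∀ k, Continuous fun x : ℝ × Metric.sphere (0 : Plane) 1 => p x.1 k := fun k =>
    (hp.continuous k).comp continuous_fst
  have hw : Continuous fun x : ℝ × Metric.sphere (0 : Plane) 1 => (x.2 : Plane) :=
    continuous_subtype_val.comp continuous_snd
  refine isClosed_iInter fun k => isClosed_iInter fun _ => (IsClosed.inter ?_ ?_).inter ?_
  · exact isClosed_le continuous_const
      (continuous_const.mul (continuous_cross₂ hw ((hc (L k)).sub (hc u))))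
  · exact isClosed_le (continuous_const.mul (continuous_cross₂ hw ((hc (R k)).sub (hc u))))
      continuous_const
  · exact isClosed_le continuous_const
      (continuous_const.mul (continuous_orient₃ (hc u) (hc (R k)) (hc (L k))))

/-- A vertex with a stabbing line for a sleeve at some time sees the last edge at time zero. -/
theorem exists_sees_edge (hp : IsMonotoneMotion p m ε) (hgen : IsGeneric (p 0)) {K : ℕ}
    {L R : ℕ → ℕ} {t : ℝ} {w : Plane} (ht : 0 ≤ t) (hs : IsSleeve m u K L R)
    (hv : SleeveVisible (p t) u K L R) (hw : w ≠ 0) (h : Stabs (p t) ε u K L R w)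
    (hL : L K = 0) (hR : R K = m - 1) :
    ∃ q ∈ openSegment ℝ (p 0 0) (p 0 (m - 1)), segment ℝ (p 0 u) q ⊆ cls (Bd (p 0)) := by
  induction K using Nat.strong_induction_on generalizing L R t w with
  | _ K ih =>
  -- A sleeve with a single chord is a visible triangle on the last edge, which is visible at time 0
  -- too.
  rcases Nat.eq_zero_or_pos K with rfl | hK
  · have h1 := hp.mono 0 t ht _ _ hv.left
    have h2 := hp.mono 0 t ht _ _ hv.right
    have h3 := hp.mono 0 t ht _ _ (hv.chord 0 le_rfl)
    rw [hL] at h1 h3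
    rw [hR] at h2 h3
    have hmid : p 0 0 + (1 / 2 : ℝ) • (p 0 (m - 1) - p 0 0) ∈
        openSegment ℝ (p 0 0) (p 0 (m - 1)) :=
      mem_openSegment_iff_smul.mpr ⟨1 / 2, by norm_num, by norm_num, rfl⟩
    exact ⟨_, hmid, segment_subset_cls h1 h3 h2.symm (openSegment_subset_segment _ _ _ hmid)⟩
  -- If at some stabbed time `p u` sees both ends of a later chord, the sleeve is cut off there and
  -- the argument restarts from this time.
  by_cases hres : ∃ t', 0 ≤ t' ∧ t' ≤ t ∧ ∃ k, 1 ≤ k ∧ k ≤ K ∧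
      (∃ w', w' ≠ 0 ∧ Stabs (p t') ε u K L R w') ∧
      Sees (p t') u (L k) ∧ Sees (p t') u (R k)
  · obtain ⟨t', h0, h1, k, hk1, hk, ⟨w', hw', h'⟩, hl, hr⟩ := hres
    exact ih (K - k) (by omega) h0 (hs.truncate hk) ((hv.mono hp h1).truncate hk hl hr) hw'
      (h'.truncate hk) (by rwa [show K - k + k = K by omega]) (by rwa [show K - k + k = K by omega])
  have hcl := hp.isClosed_stabs u K L R
  set S := {t | ∃ w, w ≠ 0 ∧ Stabs (p t) ε u K L R w} with hS
  have hno : ∀ t', 0 ≤ t' → t' ≤ t → t' ∈ S → ∀ k, 1 ≤ k → k ≤ K →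
      ¬ (Sees (p t') u (L k) ∧ Sees (p t') u (R k)) := fun t' h0 h1 h2 k hk1 hk hcon =>
    hres ⟨t', h0, h1, k, hk1, hk, h2, hcon⟩
  -- Continuous induction backwards in time: the set `S` is closed, and `eventually_stabs` extends
  -- it to the past.
  have hsub : Set.Icc 0 t ⊆ (fun x => t - x) ⁻¹' S := by
    apply IsClosed.Icc_subset_of_forall_mem_nhdsWithin
    · exact (hcl.preimage (by fun_prop)).inter isClosed_Icc
    · simpa using ⟨w, hw, h⟩
    · rintro x ⟨⟨w', hw', h'⟩, hx0, hxt⟩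
      have hev := hp.eventually_stabs hs hK (hv.mono hp (show t - x ≤ t by linarith)) hw' h'
        (hno (t - x) (by linarith) (by linarith) ⟨w', hw', h'⟩)
      have htend : Tendsto (fun y => t - y) (𝓝[>] x) (𝓝[<] (t - x)) := by
        apply tendsto_nhdsWithin_of_tendsto_nhds_of_eventually_within
        · exact ((continuous_const.sub continuous_id).tendsto x).mono_left nhdsWithin_le_nhds
        · filter_upwards [self_mem_nhdsWithin] with y hy
          have : x < y := hy
          simpa using this
      exact htend.eventually hev
  have h0 : (0 : ℝ) ∈ S := by
    have := hsub ⟨ht, le_rfl⟩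
    simpa using this
  obtain ⟨w', hw', h'⟩ := id h0
  have := h'.exists_mem_openSegment (hp.oriented 0) hgen hw' hs (hv.mono hp ht)
    (hno 0 le_rfl ht h0 K hK le_rfl)
  rwa [hL, hR] at this

end IsMonotoneMotion


/-! ### Stabbing lines of triangulated polygons -/

lemma IsChord.sees {p : ℕ → Plane} {m i j : ℕ} (h : IsSimpleLoop p m) (hc : IsChord p m i j) :
    Sees p i j := by
  rcases hc with rfl | ⟨rfl, rfl⟩ | hd
  · exact (IsSimpleLoop.edge_subset p i).trans Set.subset_union_left
  · refine Set.Subset.trans ?_ Set.subset_union_left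
    have := IsSimpleLoop.edge_subset p j
    rwa [h.per_zero, segment_symm] at this
  · unfold Sees
    rw [← insert_endpoints_openSegment]
    rintro x (rfl | rfl | hx)
    · exact Or.inl (IsSimpleLoop.vertex_mem p i)
    · exact Or.inl (IsSimpleLoop.vertex_mem p j)
    · exact Or.inr (hd hx)

/-- The point `p u` has a sleeve ending with the chord from `l` to `r` that is stabbed in
direction `w`. -/
def HasSleeve (p : ℕ → Plane) (m : ℕ) (ε : ℝ) (u : ℕ) (w : Plane) (l r : ℕ) : Prop :=
  ∃ K L R, IsSleeve m u K L R ∧ SleeveVisible p u K L R ∧ Stabs p ε u K L R w ∧ L K = l ∧ R K = r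

lemma HasSleeve.extend {p : ℕ → Plane} {m : ℕ} {ε : ℝ} {u : ℕ} {w : Plane} {l r l' r' : ℕ}
    (h : HasSleeve p m ε u w l r) (hlr : (l' = l ∧ r ≤ r') ∨ (r' = r ∧ l' ≤ l))
    (hl : l' < u) (hr : u < r') (hm : r' < m) (v : Sees p l' r') (vl : Sees p l l')
    (vr : Sees p r r') (sl : 0 ≤ ε * cross w (p l' - p u)) (sr : ε * cross w (p r' - p u) ≤ 0)
    (so : 0 ≤ ε * orient (p u) (p r') (p l')) : HasSleeve p m ε u w l' r' := by
  obtain ⟨K, L, R, hs, hv, hS, rfl, rfl⟩ := h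
  have e : ∀ (f : ℕ → ℕ) (x k : ℕ), k ≤ K → Function.update f (K + 1) x k = f k := fun f x k hk =>
    Function.update_of_ne (by omega) _ _
  have e' : ∀ (f : ℕ → ℕ) (x : ℕ), Function.update f (K + 1) x (K + 1) = x := fun f x =>
    Function.update_self _ _ _
  have cases : ∀ k, k ≤ K + 1 → k ≤ K ∨ k = K + 1 := fun k hk => by omega
  have cases' : ∀ k, k < K + 1 → k < K ∨ k = K := fun k hk => by omega
  refine ⟨K + 1, Function.update L (K + 1) l', Function.update R (K + 1) r',
    ⟨?_, ?_, ?_, ?_⟩, ⟨?_, ?_, ?_, ?_, ?_⟩, ⟨?_, ?_, ?_⟩, e' _ _, e' _ _⟩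
  · intro k hk
    rcases cases k hk with hk | rfl
    · rw [e _ _ _ hk]; exact hs.left_lt k hk
    · rwa [e']
  · intro k hk
    rcases cases k hk with hk | rfl
    · rw [e _ _ _ hk]; exact hs.lt_right k hk
    · rwa [e']
  · intro k hk
    rcases cases k hk with hk | rfl
    · rw [e _ _ _ hk]; exact hs.right_lt k hk
    · rwa [e']
  · intro k hk
    rcases cases' k hk with hk | rfl
    · rw [e _ _ _ hk, e _ _ _ hk, e _ _ _ hk.le, e _ _ _ hk.le]; exact hs.step k hk
    · rw [e', e', e _ _ _ le_rfl, e _ _ _ le_rfl]; exact hlr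
  · rw [e _ _ _ (by omega)]; exact hv.left
  · rw [e _ _ _ (by omega)]; exact hv.right
  · intro k hk
    rcases cases k hk with hk | rfl
    · rw [e _ _ _ hk, e _ _ _ hk]; exact hv.chord k hk
    · rwa [e', e']
  · intro k hk
    rcases cases' k hk with hk | rfl
    · rw [e _ _ _ hk, e _ _ _ hk.le]; exact hv.left_side k hk
    · rwa [e', e _ _ _ le_rfl]
  · intro k hk
    rcases cases' k hk with hk | rfl
    · rw [e _ _ _ hk, e _ _ _ hk.le]; exact hv.right_side k hk
    · rwa [e', e _ _ _ le_rfl]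
  · intro k hk
    rcases cases k hk with hk | rfl
    · rw [e _ _ _ hk]; exact hS.left k hk
    · rwa [e']
  · intro k hk
    rcases cases k hk with hk | rfl
    · rw [e _ _ _ hk]; exact hS.right k hk
    · rwa [e']
  · intro k hk
    rcases cases k hk with hk | rfl
    · rw [e _ _ _ hk, e _ _ _ hk]; exact hS.orient k hk
    · rwa [e', e']

/-- A ray that crosses a segment sees its endpoints in the right order. -/
lemma orient_nonneg_of_crossing {u w l r z : Plane} {ε κ : ℝ} (hw : w ≠ 0)
    (hz : z ∈ segment ℝ l r) (hzu : z = u + κ • w) (hκ : 0 ≤ κ) (hl : 0 ≤ ε * cross w (l - u))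
    (hr : ε * cross w (r - u) ≤ 0) : 0 ≤ ε * orient u r l := by
  obtain ⟨t, t0, t1, ht⟩ := mem_segment_iff_smul.mp hz
  have hww := dotp_self_pos hw
  have e := orient_eq_dotp_cross w u r l
  have eA : (1 - t) * dotp w (l - u) + t * dotp w (r - u) = κ * dotp w w := by
    have : dotp w (z - u) = κ * dotp w w := by rw [hzu]; simp [dotp]; ring
    rw [← this, ht]; simp [dotp]; ring
  have eB : (1 - t) * cross w (l - u) + t * cross w (r - u) = 0 := by
    have : cross w (z - u) = 0 := by rw [hzu]; simp [cross]; ring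
    rw [← this, ht]; simp [cross]; ring
  have key : ε * orient u r l * dotp w w =
      κ * dotp w w * (ε * cross w (l - u) - ε * cross w (r - u)) := by
    linear_combination ε * e + ε * (cross w (l - u) - cross w (r - u)) * eA -
      ε * (dotp w (l - u) - dotp w (r - u)) * eB
  have : 0 ≤ ε * orient u r l * dotp w w := by
    rw [key]
    exact mul_nonneg (mul_nonneg hκ hww.le) (by linarith)
  by_contra! hneg
  nlinarith [mul_neg_of_neg_of_pos hneg hww]

/-- A sight line through a corner of a triangle cannot enter the triangle there. -/
lemma not_crossing_at_corner {B : Set Plane} {u w a b c : Plane} {ε s α : ℝ} 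
    (hα : 0 < α) (ha : a = u + α • w) (hua : segment ℝ u a ⊆ cls B)
    (hc : 0 < s * (ε * cross w (c - u))) (hb : s * (ε * cross w (b - u)) < 0)
    (vac : segment ℝ a c ⊆ cls B) (vcb : segment ℝ c b ⊆ cls B) (vba : segment ℝ b a ⊆ cls B)
    (h1 : 0 ≤ s * (ε * orient a c b))
    (h2 : segment ℝ u c ⊆ cls B → 0 ≤ s * (ε * orient a u c))
    (h3 : ∀ x ∈ openSegment ℝ c b, openSegment ℝ x u ⊆ cls B → orient c b u ≠ 0 →
      0 < s * (ε * orient c b u)) : False := by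
  have hw : w ≠ 0 := by rintro rfl; simp [cross] at hc
  have hsε : s * ε ≠ 0 := by intro e; rw [← mul_assoc, e] at hc; simp at hc
  -- The line would leave the triangle through the side `c b`, at the parameter `κ`. By the
  -- orientation `h1` of the triangle, `κ ≤ α`, so this point is not beyond `a`.
  obtain ⟨x, hx, hxw⟩ := exists_mem_segment_cross (ε := s * ε) (w := w) (u := u) (a := c) (b := b)
    hsε (by rw [mul_assoc]; exact hc.le) (by rw [mul_assoc]; exact hb.le)
  have hxo : x ∈ openSegment ℝ c b := by
    refine mem_openSegment_of_ne_left_right ?_ ?_ hx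
    · rintro rfl; rw [hxw] at hc; simp at hc
    · rintro rfl; rw [hxw] at hb; simp at hb
  obtain ⟨κ, hκ⟩ := exists_smul_of_cross_eq_zero hw hxw
  have hx' : x = u + κ • w := by rw [← hκ]; abel
  have hD : 0 < s * (ε * cross (b - c) w) := by
    have : s * (ε * cross (b - c) w) =
        s * (ε * cross w (c - u)) - s * (ε * cross w (b - u)) := by simp [cross]; ring
    rw [this]; linarith
  have ex : orient c b u + κ * cross (b - c) w = 0 := by
    rw [← orient_add_smul, ← hx']; exact orient_of_mem_segment hx
  have ea : orient a c b = (α - κ) * cross (b - c) w := by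
    rw [← orient_rotate, ha, orient_add_smul]; linear_combination ex
  have hκα : κ ≤ α := by
    by_contra! hlt
    have : s * (ε * orient a c b) = (α - κ) * (s * (ε * cross (b - c) w)) := by rw [ea]; ring
    rw [this] at h1
    nlinarith
  -- For `κ ≤ 0` the point `u` is in the triangle and sees `c`, contrary to `h2`. For `0 < κ` the
  -- sight line meets the side `c b` from the side forbidden by `h3`.
  rcases le_or_gt κ 0 with h0 | h0
  · have hu : u ∈ segment ℝ x a := by
      refine mem_segment_iff_smul.mpr ⟨-κ / (α - κ), div_nonneg (by linarith) (by linarith),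
        div_le_one_of_le₀ (by linarith) (by linarith), ?_⟩
      have : α - κ ≠ 0 := by linarith
      rw [hx', ha]
      ext <;> simp <;> field_simp <;> ring
    have huc : segment ℝ u c ⊆ cls B := by
      refine Set.Subset.trans ?_ (triangle_subset_cls vac vcb vba)
      apply (convex_convexHull ℝ _).segment_subset _ (subset_convexHull ℝ _ (by simp))
      exact (convex_convexHull ℝ _).segment_subset
        (segment_subset_convexHull (by simp) (by simp) hx) (subset_convexHull ℝ _ (by simp)) hu
    have := h2 huc
    have e : s * (ε * orient a u c) = -(α * (s * (ε * cross w (c - u)))) := by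
      rw [ha]; simp [orient, cross]; ring
    rw [e] at this
    nlinarith [mul_pos hα hc]
  · have hxa : x ∈ segment ℝ u a := by
      refine mem_segment_iff_smul.mpr ⟨κ / α, by positivity, div_le_one_of_le₀ hκα hα.le, ?_⟩
      rw [hx', ha]
      ext <;> simp <;> field_simp
    have e : s * (ε * orient c b u) = -(κ * (s * (ε * cross (b - c) w))) := by
      linear_combination s * ε * ex
    have hneg : s * (ε * orient c b u) < 0 := by rw [e]; nlinarith [mul_pos h0 hD]
    have := h3 x hxo ((openSegment_subset_segment _ _ _).trans
      (((convex_segment _ _).segment_subset hxa (left_mem_segment ℝ _ _)).trans hua))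
      (by intro e; rw [e] at hneg; simp at hneg)
    linarith

namespace IsOrientedLoop

variable {p : ℕ → Plane} {m : ℕ} {ε : ℝ}

/-- Points outside a chord see it from the outside. -/
lemma chord_side_vertex (h : IsOrientedLoop p m ε) {i j k : ℕ} (hij : i < j) (hjm : j < i + m)
    (hj : j < m) (hne : ¬ (i = 0 ∧ j + 1 = m)) (hc : IsChord p m i j) (hjk : j ≤ k) (hk : k ≤ i + m)
    {x : Plane} (hx : x ∈ openSegment ℝ (p i) (p j)) (hxk : openSegment ℝ x (p k) ⊆ cls (Bd p))
    (ho : orient (p i) (p j) (p k) ≠ 0) : 0 < ε * orient (p i) (p j) (p k) := by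
  rcases hc with rfl | hc | hd
  · exact h.side hx ho hxk
  · exact absurd hc hne
  · rcases Nat.lt_or_ge j (i + 2) with hlt | hge
    · obtain rfl : j = i + 1 := by omega
      exact h.side hx ho hxk
    · have hji : j + 2 ≤ i + m := by omega
      refine h.chord_side hge hji hd (Or.inl ?_) hx hxk ho
      have : subchain p j (i + m) (k - j) = p k := by
        rw [subchain_of_le (by omega)]; congr 1; omega
      rw [← this]
      exact IsSimpleLoop.vertex_mem _ _

/-- A sight line from a vertex to the last edge meets the chords in between. -/
lemma exists_crossing (h : IsOrientedLoop p m ε) {u i j : ℕ} {q : Plane}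
    (hi : i < u) (hj : u < j) (hjm : j < m) (hc : IsChord p m i j)
    (hq : q ∈ segment ℝ (p (m - 1)) (p m)) (hv : segment ℝ (p u) q ⊆ cls (Bd p)) :
    ∃ z ∈ segment ℝ (p u) q, z ∈ segment ℝ (p i) (p j) := by
  have hm := h.three_le
  rcases hc with hc | ⟨rfl, rfl⟩ | hd
  · omega
  · refine ⟨q, right_mem_segment ℝ _ _, ?_⟩
    rwa [h.per_zero, Nat.add_sub_cancel, segment_symm] at hq
  · by_cases htop : i = 0 ∧ j + 1 = m
    · obtain ⟨rfl, rfl⟩ := htop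
      refine ⟨q, right_mem_segment ℝ _ _, ?_⟩
      rwa [h.per_zero, Nat.add_sub_cancel, segment_symm] at hq
    · refine h.exists_mem_chord (by omega) (by omega) hd (convex_segment _ _).isPreconnected hv
        ⟨p u, left_mem_segment ℝ _ _, Or.inl ?_⟩ ⟨q, right_mem_segment ℝ _ _, Or.inl ?_⟩
      · have : subchain p i j (u - i) = p u := by
          rw [subchain_of_le (by omega)]; congr 1; omega
        rw [← this]
        exact IsSimpleLoop.vertex_mem _ _
      · refine (mem_Bd_subchain (by omega)).mpr (Or.inl ⟨m - 1, by omega, by omega, ?_⟩)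
        rwa [show m - 1 + 1 = m by omega]

/-- By induction on the chord: the sight line also crosses the side, from the apex to `l` or to `r`,
that separates `u` from the rest of the triangle. This side ends a shorter sleeve, and the chord
from `l` to `r` is appended to it. What has to be shown is that the apex is on the right side of the
sight line. -/
lemma hasSleeve (h : IsOrientedLoop p m ε) (hgen : IsGeneric p) {u : ℕ} {q : Plane} (hum : u < m)
    (hq : q ∈ openSegment ℝ (p (m - 1)) (p m)) (hv : segment ℝ (p u) q ⊆ cls (Bd p))
    {l r : ℕ} (hl : l < u) (hr : u < r) (hrm : r < m) (hc : IsChord p m l r)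
    (sl : 0 ≤ ε * cross (q - p u) (p l - p u)) (sr : ε * cross (q - p u) (p r - p u) ≤ 0) :
    HasSleeve p m ε u (q - p u) l r := by
  induction hN : r - l using Nat.strong_induction_on generalizing l r with
  | _ N ih =>
  set w := q - p u with hw
  have hqs := openSegment_subset_segment ℝ _ _ hq
  have inj : ∀ {a b : ℕ}, a < m → b < m → p a = p b → a = b := fun ha hb e =>
    h.window_inj (i := 0) (by omega) (by omega) (by omega) (by omega) e
  have hw0 : w ≠ 0 := by
    intro e
    have hqu : q = p u := sub_eq_zero.mp e
    rw [hqu, show m = m - 1 + 1 by omega, Nat.add_sub_cancel] at hq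
    have := h.openSegment_edge hq (left_mem_segment ℝ (p u) (p (u + 1)))
    have := inj hum (by omega) this
    omega
  have onray : ∀ {z : Plane}, z ∈ segment ℝ (p u) q → ∃ κ : ℝ, 0 ≤ κ ∧ z = p u + κ • w := by
    intro z hz
    obtain ⟨t, t0, -, ht⟩ := mem_segment_iff_smul.mp hz
    exact ⟨t, t0, ht⟩
  have so : ∀ {a b : ℕ}, a < u → u < b → b < m → IsChord p m a b →
      0 ≤ ε * cross w (p a - p u) → ε * cross w (p b - p u) ≤ 0 →
      0 ≤ ε * orient (p u) (p b) (p a) := by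
    intro a b ha hb hbm hab sa sb
    obtain ⟨z, hz1, hz2⟩ := h.exists_crossing ha hb hbm hab hqs hv
    obtain ⟨κ, hκ, hz⟩ := onray hz1
    exact orient_nonneg_of_crossing hw0 hz2 hz hκ sa sb
  have sub : ∀ {z : Plane}, z ∈ segment ℝ (p u) q → segment ℝ (p u) z ⊆ cls (Bd p) := fun hz =>
    ((convex_segment _ _).segment_subset (left_mem_segment ℝ _ _) hz).trans hv
  -- a chord does not lie on the sight line
  have noncol : ¬ (cross w (p l - p u) = 0 ∧ cross w (p r - p u) = 0) := by
    rintro ⟨el, er⟩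
    obtain ⟨z, hz1, hz2⟩ := h.exists_crossing hl hr hrm hc hqs hv
    obtain ⟨κ, hκ, hz⟩ := onray hz1
    have ez : cross w (z - p u) = 0 := by rw [hz]; simp [cross]; ring
    have vlr := hc.sees h.toIsSimpleLoop
    have vl : Sees p u l := segment_subset_of_orient_eq_zero (orient_eq_zero_of_cross hw0 ez el)
      (sub hz1) (((convex_segment _ _).segment_subset hz2 (left_mem_segment ℝ _ _)).trans vlr)
    have vr : Sees p u r := segment_subset_of_orient_eq_zero (orient_eq_zero_of_cross hw0 ez er)
      (sub hz1) (((convex_segment _ _).segment_subset hz2 (right_mem_segment ℝ _ _)).trans vlr)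
    exact hgen.orient_ne_zero (fun e => hl.ne' (inj hum (by omega) e))
      (fun e => (hl.trans hr).ne (inj (by omega) hrm e)) (fun e => hr.ne' (inj hrm hum e))
      vl vlr vr.symm (orient_eq_zero_of_cross hw0 el er)
  obtain ⟨c, hlc, hcr, c1, c2⟩ := h.exists_apex (by omega) hrm hc
  have v := hc.sees h.toIsSimpleLoop
  have v1 := c1.sees h.toIsSimpleLoop
  have v2 := c2.sees h.toIsSimpleLoop
  have refl : ∀ a, Sees p a a := by
    intro a
    unfold Sees
    rw [segment_same, Set.singleton_subset_iff]
    exact Or.inl (IsSimpleLoop.vertex_mem p a)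
  have comb : ∀ {a b : ℕ} {t : ℝ}, cross w (p a + t • (p b - p a) - p u) =
      (1 - t) * cross w (p a - p u) + t * cross w (p b - p u) := by
    intro a b t; simp [cross]; ring
  rcases lt_trichotomy u c with huc | rfl | huc
  · -- the sleeve continues with the chord from `l` to `c`
    obtain ⟨z, hz1, hz2⟩ := h.exists_crossing hl huc (by omega) c1 hqs hv
    obtain ⟨κ, hκ, hz⟩ := onray hz1
    have ez : cross w (z - p u) = 0 := by rw [hz]; simp [cross]; ring
    obtain ⟨t, t0, t1, ht⟩ := mem_segment_iff_smul.mp hz2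
    rw [ht, comb] at ez
    -- Otherwise the sight line could meet the chord from `l` to `c` only in `p l`, and it would
    -- enter the triangle at this corner.
    have sc : ε * cross w (p c - p u) ≤ 0 := by
      by_contra! hpos
      have ez' : (1 - t) * (ε * cross w (p l - p u)) + t * (ε * cross w (p c - p u)) = 0 := by
        linear_combination ε * ez
      have ht0 : t = 0 := by
        have := mul_nonneg (sub_nonneg.mpr t1) sl
        rcases t0.eq_or_lt with e | t0
        · exact e.symm
        · nlinarith [mul_pos t0 hpos]
      rw [ht0] at ez ht
      simp only [sub_zero, one_mul, zero_mul, add_zero, zero_smul] at ez ht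
      have sr' : ε * cross w (p r - p u) < 0 :=
        lt_of_le_of_ne sr (mul_ne_zero h.sign_ne fun e => noncol ⟨ez, e⟩)
      rw [ht] at hz hz1
      refine not_crossing_at_corner (B := Bd p) (u := p u) (w := w) (a := p l) (b := p r)
        (c := p c) (ε := ε) (s := 1) (α := κ) ?_ hz (sub hz1) (by linarith) (by linarith) v1 v2
        v.symm ?_ ?_ ?_
      · refine lt_of_le_of_ne hκ ?_
        rintro rfl
        rw [zero_smul, add_zero] at hz
        exact hl.ne (inj (by omega) hum hz)
      · rw [one_mul]; exact h.orient_nonneg_of_visible hlc hcr (by omega) v1 v2 v.symm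
      · intro vuc
        rw [one_mul]
        exact h.orient_nonneg_of_visible hl huc (by omega) (Sees.symm (sub hz1)) vuc v1.symm
      · intro x hx hxu ho
        rw [one_mul]
        have e : p (u + m) = p u := h.per u
        rw [← e] at hxu ho ⊢
        exact h.chord_side_vertex hcr (by omega) hrm (by omega) c2 (by omega) (by omega) hx hxu ho
    exact (ih (c - l) (by omega) hl huc (by omega) c1 sl sc rfl).extend (Or.inl ⟨rfl, hcr.le⟩)
      hl hr hrm v (refl l) v2 sl sr (so hl hr hrm hc sl sr)
  -- The apex is `u`, and the sleeve has a single chord.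
  · refine ⟨0, fun _ => l, fun _ => r, ⟨fun _ _ => hl, fun _ _ => hr, fun _ _ => hrm,
      fun k hk => absurd hk (by omega)⟩, ⟨v1.symm, v2, fun _ _ => v, fun k hk => absurd hk (by omega),
      fun k hk => absurd hk (by omega)⟩, ⟨fun _ _ => sl, fun _ _ => sr,
      fun _ _ => so hl hr hrm hc sl sr⟩, rfl, rfl⟩
  · -- the sleeve continues with the chord from `c` to `r`
    obtain ⟨z, hz1, hz2⟩ := h.exists_crossing huc hr hrm c2 hqs hv
    obtain ⟨κ, hκ, hz⟩ := onray hz1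
    have ez : cross w (z - p u) = 0 := by rw [hz]; simp [cross]; ring
    rw [segment_symm] at hz2
    obtain ⟨t, t0, t1, ht⟩ := mem_segment_iff_smul.mp hz2
    rw [ht, comb] at ez
    have sc : 0 ≤ ε * cross w (p c - p u) := by
      by_contra! hneg
      have ez' : (1 - t) * (ε * cross w (p r - p u)) + t * (ε * cross w (p c - p u)) = 0 := by
        linear_combination ε * ez
      have ht0 : t = 0 := by
        have := mul_nonneg (sub_nonneg.mpr t1) (neg_nonneg.mpr sr)
        rcases t0.eq_or_lt with e | t0
        · exact e.symm
        · nlinarith [mul_neg_of_pos_of_neg t0 hneg]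
      rw [ht0] at ez ht
      simp only [sub_zero, one_mul, zero_mul, add_zero, zero_smul] at ez ht
      have sl' : 0 < ε * cross w (p l - p u) :=
        lt_of_le_of_ne sl (mul_ne_zero h.sign_ne fun e => noncol ⟨e, ez⟩).symm
      rw [ht] at hz hz1
      refine not_crossing_at_corner (B := Bd p) (u := p u) (w := w) (a := p r) (b := p l)
        (c := p c) (ε := ε) (s := -1) (α := κ) ?_ hz (sub hz1) (by linarith) (by linarith) v2.symm
        v1.symm v ?_ ?_ ?_
      · refine lt_of_le_of_ne hκ ?_
        rintro rfl
        rw [zero_smul, add_zero] at hz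
        exact hr.ne' (inj hrm hum hz)
      · have := h.orient_nonneg_of_visible hlc hcr (by omega) v1 v2 v.symm
        have e : orient (p r) (p c) (p l) = -orient (p l) (p c) (p r) := by unfold orient; ring
        rw [e]; linarith
      · intro vuc
        have := h.orient_nonneg_of_visible huc hr (by omega) (Sees.symm vuc) (sub hz1) v2.symm
        have e : orient (p r) (p u) (p c) = -orient (p c) (p u) (p r) := by unfold orient; ring
        rw [e]; linarith
      · intro x hx hxu ho
        rw [openSegment_symm] at hx
        rw [orient_swap] at ho ⊢
        have := h.chord_side_vertex hlc (by omega) (by omega) (by omega) c1 huc.le (by omega) hx hxu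
          (by simpa using ho)
        linarith
    exact (ih (r - c) (by omega) huc hr hrm c2 sc sr rfl).extend (Or.inr ⟨rfl, hlc.le⟩)
      hl hr hrm v v1.symm (refl r) sl sr (so hl hr hrm hc sl sr)

/-- A vertex seeing the last edge has a stabbed sleeve ending with this edge. -/
lemma hasSleeve_top (h : IsOrientedLoop p m ε) (hgen : IsGeneric p) {u : ℕ} {q : Plane}
    (hu0 : 0 < u) (hum : u < m - 1) (hq : q ∈ openSegment ℝ (p (m - 1)) (p m))
    (hv : segment ℝ (p u) q ⊆ cls (Bd p)) : HasSleeve p m ε u (q - p u) 0 (m - 1) := by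
  have inj : ∀ {a b : ℕ}, a < m → b < m → p a = p b → a = b := fun ha hb e =>
    h.window_inj (i := 0) (by omega) (by omega) (by omega) (by omega) e
  have hedge : Sees p (m - 1) 0 := by
    have := (IsSimpleLoop.edge_subset p (m - 1)).trans (Set.subset_union_left (t := opn (Bd p)))
    rwa [show m - 1 + 1 = m by omega, h.per_zero] at this
  have hq' : q ∈ openSegment ℝ (p (m - 1)) (p 0) := by rwa [h.per_zero] at hq
  obtain ⟨t, t0, t1, ht⟩ := mem_openSegment_iff_smul.mp hq'
  -- On the line of the edge, `p u` would see both ends of it, and three mutually visible vertices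
  -- would be collinear.
  have hne : orient (p (m - 1)) (p 0) (p u) ≠ 0 := by
    intro e
    have hqs := openSegment_subset_segment ℝ _ _ hq'
    have e0 : orient (p u) q (p 0) = (1 - t) * orient (p (m - 1)) (p 0) (p u) := by
      rw [ht]; simp [orient]; ring
    have e1 : orient (p u) q (p (m - 1)) = -(t * orient (p (m - 1)) (p 0) (p u)) := by
      rw [ht]; simp [orient]; ring
    have v0 : Sees p u 0 := segment_subset_of_orient_eq_zero (by rw [e0, e, mul_zero]) hv
      (((convex_segment _ _).segment_subset hqs (right_mem_segment ℝ _ _)).trans hedge)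
    have v1 : Sees p u (m - 1) := segment_subset_of_orient_eq_zero
      (by rw [e1, e, mul_zero, neg_zero]) hv
      (((convex_segment _ _).segment_subset hqs (left_mem_segment ℝ _ _)).trans hedge)
    exact hgen.orient_ne_zero (fun e => by have := inj (by omega) (by omega) e; omega)
      (fun e => by have := inj (by omega) (by omega) e; omega)
      (fun e => by have := inj (by omega) (by omega) e; omega) hedge v0.symm v1 e
  have hpos : 0 < ε * orient (p (m - 1)) (p 0) (p u) := by
    have := h.side (k := m - 1) (z := q) (y := p u)
    rw [show m - 1 + 1 = m by omega, h.per_zero] at this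
    exact this hq' hne (by
      rw [openSegment_symm]; exact (openSegment_subset_segment _ _ _).trans hv)
  refine h.hasSleeve hgen (by omega) hq hv hu0 hum (by omega) (Or.inr (Or.inl ⟨rfl, by omega⟩))
    ?_ ?_
  · have : ε * cross (q - p u) (p 0 - p u) =
        (1 - t) * (ε * orient (p (m - 1)) (p 0) (p u)) := by
      rw [ht]; simp [orient, cross]; ring
    rw [this]
    exact mul_nonneg (by linarith) hpos.le
  · have : ε * cross (q - p u) (p (m - 1) - p u) =
        -(t * (ε * orient (p (m - 1)) (p 0) (p u))) := by
      rw [ht]; simp [orient, cross]; ring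
    rw [this]
    nlinarith [mul_pos t0 hpos]

end IsOrientedLoop


/-! ### Polygons as periodic sequences -/

namespace SimplePolygon

variable {n : ℕ}

lemma pos (P : SimplePolygon n) : 0 < n := by
  have := P.isSimple.three_le; omega

/-- The vertices of a polygon as a periodic sequence. -/
def loop (P : SimplePolygon n) (k : ℕ) : Plane := P ⟨k % n, Nat.mod_lt _ P.pos⟩

lemma loop_val (P : SimplePolygon n) (v : Fin n) : P.loop v = P v := by
  unfold loop; congr 1; exact Fin.ext (Nat.mod_eq_of_lt v.2)

lemma val_finRotate (P : SimplePolygon n) (v : Fin n) :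
    ((finRotate n v : Fin n) : ℕ) = (v + 1) % n := by
  have := P.pos
  obtain ⟨k, rfl⟩ : ∃ k, n = k + 1 := ⟨n - 1, by omega⟩
  rw [coe_finRotate]
  have := v.2
  split_ifs with h
  · rw [h]; simp
  · have : (v : ℕ) ≠ k := fun e => h (Fin.ext e)
    rw [Nat.mod_eq_of_lt (by omega)]

lemma loop_succ (P : SimplePolygon n) (k : ℕ) :
    P.loop (k + 1) = P (finRotate n ⟨k % n, Nat.mod_lt _ P.pos⟩) := by
  unfold loop; congr 1; apply Fin.ext
  rw [P.val_finRotate]; simp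

lemma segment_loop (P : SimplePolygon n) (k : ℕ) :
    segment ℝ (P.loop k) (P.loop (k + 1)) =
      P.toPolygon.edgeSet ℝ ⟨k % n, Nat.mod_lt _ P.pos⟩ := by
  have := P.pos
  obtain ⟨l, rfl⟩ : ∃ l, n = l + 1 := ⟨n - 1, by omega⟩
  rw [loop_succ]
  unfold Polygon.edgeSet
  rw [affineSegment_eq_segment]
  congr 2

lemma boundary_eq (P : SimplePolygon n) : P.boundary = Bd P.loop := by
  ext x
  unfold boundary Polygon.boundary
  rw [IsSimpleLoop.mem_Bd]
  simp only [Set.mem_iUnion, segment_loop]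
  constructor
  · rintro ⟨i, hi⟩
    refine ⟨i, ?_⟩
    convert hi using 2
    exact Fin.ext (Nat.mod_eq_of_lt i.2)
  · rintro ⟨k, hk⟩
    exact ⟨_, hk⟩

lemma openRegion_eq (P : SimplePolygon n) : P.openRegion = opn (Bd P.loop) := by
  unfold openRegion opn; rw [P.boundary_eq]

lemma closedRegion_eq (P : SimplePolygon n) : P.closedRegion = cls (Bd P.loop) := by
  unfold closedRegion cls; rw [P.boundary_eq, P.openRegion_eq]

lemma isSimpleLoop (P : SimplePolygon n) : IsSimpleLoop P.loop n where
  three_le := P.isSimple.three_le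
  per k := by unfold loop; congr 2; simp
  inj i j e := by
    have := P.isSimple.injective e
    simpa using this
  edges i j z hi hj := by
    by_cases hij : i % n = j % n
    · left; unfold loop; congr 2
    · right
      rw [segment_loop] at hi hj
      have h := P.isSimple.edges ⟨i % n, Nat.mod_lt _ P.pos⟩ ⟨j % n, Nat.mod_lt _ P.pos⟩
        (by simpa using hij) ⟨hi, hj⟩
      rw [loop_succ, loop_succ]
      have inj : ∀ {a b : Fin n}, P a = P b → a = b := fun e => P.isSimple.injective e
      change z ∈ ({P.loop i, P (finRotate n ⟨i % n, _⟩)} : Set Plane) ∩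
        {P.loop j, P (finRotate n ⟨j % n, _⟩)} at h
      rcases h with ⟨h1 | h1, h2 | h2⟩
      · exact absurd (by simpa using inj (h1.symm.trans h2)) hij
      · exact Or.inr ⟨h1, h1.symm.trans h2⟩
      · exact Or.inl ⟨h2, h2.symm.trans h1⟩
      · have := (finRotate n).injective (inj (h1.symm.trans h2))
        exact absurd (by simpa using this) hij

lemma signedArea_eq (P : SimplePolygon n) : P.signedArea = 1 / 2 * area2 P.loop n := by
  unfold signedArea area2
  congr 1
  rw [← Fin.sum_univ_eq_sum_range (fun k => cross (P.loop k) (P.loop (k + 1)))]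
  refine Finset.sum_congr rfl fun i _ => ?_
  rw [loop_succ, loop_val]
  have : (⟨(i : ℕ) % n, Nat.mod_lt _ P.pos⟩ : Fin n) = i := Fin.ext (Nat.mod_eq_of_lt i.2)
  rw [this]; unfold cross; ring

end SimplePolygon

/-! ### Triangulations of chains -/

/-- The triples in `A` form a triangulation of the part of the polygon `p` between the chord from
`p i` to `p j` and the vertices between them. -/
inductive IsTri (p : ℕ → Plane) (m : ℕ) : ℕ → ℕ → List (ℕ × ℕ × ℕ) → Prop
  | edge (i : ℕ) : IsTri p m i (i + 1) []
  | node {i c j : ℕ} {A B : List (ℕ × ℕ × ℕ)} (hic : i < c) (hcj : c < j) (hj : j < m)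
      (h1 : IsChord p m i c) (h2 : IsChord p m c j) (h3 : IsChord p m i j)
      (hA : IsTri p m i c A) (hB : IsTri p m c j B) : IsTri p m i j ((i, c, j) :: (A ++ B))

/-- The pair `a b` is one of the two upper sides of the triangle `t`. -/
def IsSide (t : ℕ × ℕ × ℕ) (a b : ℕ) : Prop :=
  (a = t.1 ∧ b = t.2.1) ∨ (a = t.2.1 ∧ b = t.2.2)

lemma IsSimpleLoop.exists_isTri {p : ℕ → Plane} {m : ℕ} (h : IsSimpleLoop p m) {i j : ℕ}
    (hij : i < j) (hj : j < m) (hc : IsChord p m i j) : ∃ A, IsTri p m i j A := by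
  induction hN : j - i using Nat.strong_induction_on generalizing i j with
  | _ N ih =>
  rcases Nat.lt_or_ge j (i + 2) with hlt | hge
  · obtain rfl : j = i + 1 := by omega
    exact ⟨[], .edge i⟩
  · obtain ⟨c, h1, h2, c1, c2⟩ := h.exists_apex hge hj hc
    obtain ⟨A, hA⟩ := ih (c - i) (by omega) h1 (by omega) c1 rfl
    obtain ⟨B, hB⟩ := ih (j - c) (by omega) h2 hj c2 rfl
    exact ⟨_, .node h1 h2 hj c1 c2 hc hA hB⟩

namespace IsTri

variable {p : ℕ → Plane} {m i j : ℕ} {A : List (ℕ × ℕ × ℕ)}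

lemma range (h : IsTri p m i j A) {t : ℕ × ℕ × ℕ} (ht : t ∈ A) :
    i ≤ t.1 ∧ t.1 < t.2.1 ∧ t.2.1 < t.2.2 ∧ t.2.2 ≤ j := by
  induction h with
  | edge => simp at ht
  | node hic hcj _ _ _ _ _ _ ihA ihB =>
    rcases List.mem_cons.mp ht with rfl | ht
    · exact ⟨le_rfl, hic, hcj, le_rfl⟩
    · rcases List.mem_append.mp ht with ht | ht
      · have := ihA ht; omega
      · have := ihB ht; omega

lemma chords (h : IsTri p m i j A) {t : ℕ × ℕ × ℕ} (ht : t ∈ A) : t.2.2 < m ∧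
    IsChord p m t.1 t.2.1 ∧ IsChord p m t.2.1 t.2.2 ∧ IsChord p m t.1 t.2.2 := by
  induction h with
  | edge => simp at ht
  | node _ _ hj h1 h2 h3 _ _ ihA ihB =>
    rcases List.mem_cons.mp ht with rfl | ht
    · exact ⟨hj, h1, h2, h3⟩
    · rcases List.mem_append.mp ht with ht | ht
      · exact ihA ht
      · exact ihB ht

/-- This and the next lemmas describe how triangles fit together: a chord is the base of at most one
triangle and an upper side of at most one. Except at the boundary both exist, which makes the dual a
rooted tree. -/
lemma exists_base (h : IsTri p m i j A) (hij : i + 2 ≤ j) : ∃ t ∈ A, t.1 = i ∧ t.2.2 = j := by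
  cases h with
  | edge => omega
  | node => exact ⟨_, List.mem_cons_self, rfl, rfl⟩

lemma base_inj (h : IsTri p m i j A) {t t' : ℕ × ℕ × ℕ} (ht : t ∈ A) (ht' : t' ∈ A)
    (e1 : t.1 = t'.1) (e2 : t.2.2 = t'.2.2) : t = t' := by
  induction h with
  | edge => simp at ht
  | node hic hcj _ _ _ _ hA hB ihA ihB =>
    rcases List.mem_cons.mp ht with rfl | ht <;> rcases List.mem_cons.mp ht' with rfl | ht'
    · rfl
    · exfalso
      dsimp only at e1 e2
      rcases List.mem_append.mp ht' with ht' | ht'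
      · have := hA.range ht'; omega
      · have := hB.range ht'; omega
    · exfalso
      dsimp only at e1 e2
      rcases List.mem_append.mp ht with ht | ht
      · have := hA.range ht; omega
      · have := hB.range ht; omega
    · rcases List.mem_append.mp ht with ht | ht <;> rcases List.mem_append.mp ht' with ht' | ht'
      · exact ihA ht ht'
      · have := hA.range ht; have := hB.range ht'; omega
      · have := hB.range ht; have := hA.range ht'; omega
      · exact ihB ht ht'

lemma below_side (h : IsTri p m i j A) {t : ℕ × ℕ × ℕ} (ht : t ∈ A) {a b : ℕ} (hs : IsSide t a b) :
    b = a + 1 ∨ ∃ t' ∈ A, t'.1 = a ∧ t'.2.2 = b := by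
  induction h with
  | edge => simp at ht
  | node hic hcj _ _ _ _ hA hB ihA ihB =>
    rcases List.mem_cons.mp ht with rfl | ht
    · rcases hs with ⟨rfl, rfl⟩ | ⟨rfl, rfl⟩
      · rcases Nat.lt_or_ge _ (_ + 2) with hlt | hge
        · left; exact le_antisymm (Nat.lt_succ_iff.mp hlt) hic
        · obtain ⟨t', ht', e⟩ := hA.exists_base hge
          exact Or.inr ⟨t', by simp [ht'], e⟩
      · rcases Nat.lt_or_ge _ (_ + 2) with hlt | hge
        · left; exact le_antisymm (Nat.lt_succ_iff.mp hlt) hcj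
        · obtain ⟨t', ht', e⟩ := hB.exists_base hge
          exact Or.inr ⟨t', by simp [ht'], e⟩
    · rcases List.mem_append.mp ht with ht | ht
      · exact (ihA ht).imp id fun ⟨t', ht', e⟩ => ⟨t', by simp [ht'], e⟩
      · exact (ihB ht).imp id fun ⟨t', ht', e⟩ => ⟨t', by simp [ht'], e⟩

lemma above_base (h : IsTri p m i j A) {t : ℕ × ℕ × ℕ} (ht : t ∈ A) :
    (t.1 = i ∧ t.2.2 = j) ∨ ∃ t' ∈ A, IsSide t' t.1 t.2.2 := by
  induction h with
  | edge => simp at ht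
  | node hic hcj _ _ _ _ hA hB ihA ihB =>
    rcases List.mem_cons.mp ht with rfl | ht
    · exact Or.inl ⟨rfl, rfl⟩
    · right
      rcases List.mem_append.mp ht with ht | ht
      · rcases ihA ht with e | ⟨t', ht', e⟩
        · exact ⟨_, List.mem_cons_self, Or.inl e⟩
        · exact ⟨t', by simp [ht'], e⟩
      · rcases ihB ht with e | ⟨t', ht', e⟩
        · exact ⟨_, List.mem_cons_self, Or.inr e⟩
        · exact ⟨t', by simp [ht'], e⟩

lemma above_edge (h : IsTri p m i j A) {k : ℕ} (hik : i ≤ k) (hkj : k < j) :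
    (k = i ∧ k + 1 = j) ∨ ∃ t' ∈ A, IsSide t' k (k + 1) := by
  induction h with
  | edge => left; omega
  | @node i c j A B hic hcj _ _ _ _ hA hB ihA ihB =>
    right
    rcases Nat.lt_or_ge k c with hkc | hkc
    · rcases ihA hik hkc with e | ⟨t', ht', e⟩
      · exact ⟨_, List.mem_cons_self, Or.inl e⟩
      · exact ⟨t', by simp [ht'], e⟩
    · rcases ihB hkc hkj with e | ⟨t', ht', e⟩
      · exact ⟨_, List.mem_cons_self, Or.inr e⟩
      · exact ⟨t', by simp [ht'], e⟩

lemma side_inj (h : IsTri p m i j A) {t t' : ℕ × ℕ × ℕ} (ht : t ∈ A) (ht' : t' ∈ A) {a b : ℕ}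
    (hs : IsSide t a b) (hs' : IsSide t' a b) : t = t' := by
  induction h with
  | edge => simp at ht
  | node hic hcj _ _ _ _ hA hB ihA ihB =>
    unfold IsSide at hs hs'
    rcases List.mem_cons.mp ht with rfl | ht <;> rcases List.mem_cons.mp ht' with rfl | ht'
    · rfl
    · exfalso
      dsimp only at hs
      rcases List.mem_append.mp ht' with ht' | ht'
      · have := hA.range ht'; omega
      · have := hB.range ht'; omega
    · exfalso
      dsimp only at hs'
      rcases List.mem_append.mp ht with ht | ht
      · have := hA.range ht; omega
      · have := hB.range ht; omega
    · rcases List.mem_append.mp ht with ht | ht <;> rcases List.mem_append.mp ht' with ht' | ht'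
      · exact ihA ht ht'
      · have := hA.range ht; have := hB.range ht'; omega
      · have := hB.range ht; have := hA.range ht'; omega
      · exact ihB ht ht'

end IsTri


/-! ### Winding numbers and areas of triangulated polygons -/

namespace IsOrientedLoop

variable {p : ℕ → Plane} {m : ℕ} {ε : ℝ}

lemma notMem_chord (h : IsOrientedLoop p m ε) {i j : ℕ} (hij : p i ≠ p j) (hc : IsChord p m i j)
    (k : ℕ) : p k ∉ openSegment ℝ (p i) (p j) := by
  have edge := h.vertex_notMem_openSegment k
  rcases hc with rfl | ⟨rfl, rfl⟩ | hd
  · exact edge i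
  · have := edge j
    rwa [h.per_zero, openSegment_symm] at this
  · exact fun hk => (hd hk).1 (IsSimpleLoop.vertex_mem p k)

/-- Triangles of chords are nondegenerate. -/
lemma orient_pos_of_chords (h : IsOrientedLoop p m ε) {i c j : ℕ} (hic : i < c) (hcj : c < j)
    (hj : j < m) (h1 : IsChord p m i c) (h2 : IsChord p m c j) (h3 : IsChord p m i j) :
    0 < ε * orient (p i) (p c) (p j) := by
  have inj : ∀ {a b : ℕ}, a < m → b < m → p a = p b → a = b := fun ha hb e =>
    h.window_inj (i := 0) (by omega) (by omega) (by omega) (by omega) e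
  have s1 := h1.sees h.toIsSimpleLoop
  have s2 := h2.sees h.toIsSimpleLoop
  have s3 := h3.sees h.toIsSimpleLoop
  have n1 : p i ≠ p c := fun e => hic.ne (inj (by omega) (by omega) e)
  have n2 : p c ≠ p j := fun e => hcj.ne (inj (by omega) (by omega) e)
  have n3 : p i ≠ p j := fun e => (hic.trans hcj).ne (inj (by omega) (by omega) e)
  refine lt_of_le_of_ne (h.orient_nonneg_of_visible hic hcj (by omega) s1 s2 s3.symm)
    (Ne.symm (mul_ne_zero h.sign_ne ?_))
  intro e
  rcases mem_segment_of_orient_eq_zero e with e | e | e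
  · exact h.notMem_chord n2 h2 i (mem_openSegment_of_ne_left_right n1.symm n3.symm e)
  · rw [segment_symm] at e
    exact h.notMem_chord n3 h3 c (mem_openSegment_of_ne_left_right n1 n2.symm e)
  · exact h.notMem_chord n1 h1 j (mem_openSegment_of_ne_left_right n3 n2 e)

end IsOrientedLoop

/-- The points on no line through two vertices. -/
def offLines (p : ℕ → Plane) (m : ℕ) : Set Plane :=
  {x | ∀ a < m, ∀ b < m, a ≠ b → orient (p a) (p b) x ≠ 0}

lemma isOpen_orient_ne (a b : Plane) : IsOpen {x | orient a b x ≠ 0} :=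
  isOpen_ne_fun (continuous_orient a b) continuous_const

lemma dense_orient_ne {a b : Plane} (h : a ≠ b) : Dense {x | orient a b x ≠ 0} := by
  intro x
  by_cases hx : orient a b x = 0
  · apply closure_of_direction (d := (-(b - a).2, (b - a).1))
    filter_upwards [self_mem_nhdsWithin] with t ht
    have ht : 0 < t := ht
    change orient a b _ ≠ 0
    rw [orient_add_smul, hx, zero_add]
    refine mul_ne_zero ht.ne' ?_
    have := dotp_self_pos (sub_ne_zero.mpr h.symm)
    have e : cross (b - a) (-(b - a).2, (b - a).1) = dotp (b - a) (b - a) := by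
      unfold cross dotp; ring
    rw [e]; exact this.ne'
  · exact subset_closure hx

/-- The complements of finitely many lines are open and dense, and so is their intersection. -/
lemma IsSimpleLoop.dense_offLines {p : ℕ → Plane} {m : ℕ} (h : IsSimpleLoop p m) :
    Dense (offLines p m) := by
  have e : offLines p m = ⋂ x ∈ ((Finset.range m) ×ˢ (Finset.range m)).filter
      (fun x : ℕ × ℕ => x.1 ≠ x.2), {y | orient (p x.1) (p x.2) y ≠ 0} := by
    ext y
    simp only [offLines, Set.mem_ofPred_eq, Set.mem_iInter, Finset.mem_filter, Finset.mem_product,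
      Finset.mem_range]
    exact ⟨fun hy x hx => hy _ hx.1.1 _ hx.1.2 hx.2, fun hy a ha b hb hab =>
      hy (a, b) ⟨⟨ha, hb⟩, hab⟩⟩
  rw [e]
  generalize hS : ((Finset.range m) ×ˢ (Finset.range m)).filter
      (fun x : ℕ × ℕ => x.1 ≠ x.2) = S
  have hne : ∀ x ∈ S, p x.1 ≠ p x.2 := by
    intro x hx e
    rw [← hS] at hx
    simp only [Finset.mem_filter, Finset.mem_product, Finset.mem_range] at hx
    exact hx.2 (h.window_inj (i := 0) (by omega) (by omega) (by omega) (by omega) e)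
  clear hS e
  induction S using Finset.induction_on with
  | empty => simp
  | insert a S ha ih =>
    rw [Finset.set_biInter_insert]
    exact (dense_orient_ne (hne a (Finset.mem_insert_self _ _))).inter_of_isOpen_left
      (ih fun x hx => hne x (Finset.mem_insert_of_mem hx)) (isOpen_orient_ne _ _)

/-- The triangle spanned by a triple of vertices. -/
def triHull (p : ℕ → Plane) (t : ℕ × ℕ × ℕ) : Set Plane :=
  convexHull ℝ {p t.1, p t.2.1, p t.2.2}

lemma triTot_eq_ite {x a b c : Plane} {ε : ℝ} (hε : ε = 1 ∨ ε = -1) (hD : 0 < ε * orient a b c)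
    (h0 : orient a b x ≠ 0) (h1 : orient b c x ≠ 0) (h2 : orient c a x ≠ 0)
    [Decidable (x ∈ convexHull ℝ ({a, b, c} : Set Plane))] : triTot x a b c =
      ε * (2 * Real.pi) * if x ∈ convexHull ℝ ({a, b, c} : Set Plane) then 1 else 0 := by
  have hε0 : ε ≠ 0 := by rcases hε with rfl | rfl <;> norm_num
  have hD1 : 0 < ε * orient b c a := by rwa [orient_rotate]
  have hD2 : 0 < ε * orient c a b := by rwa [orient_rotate, orient_rotate]
  split_ifs with hx
  · rw [convexHull_triple hD] at hx
    obtain ⟨g0, g1, g2⟩ := hx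
    rw [mul_one]
    exact triTot_inside hε (lt_of_le_of_ne g0 (mul_ne_zero hε0 h0).symm)
      (lt_of_le_of_ne g1 (mul_ne_zero hε0 h1).symm) (lt_of_le_of_ne g2 (mul_ne_zero hε0 h2).symm)
  · rw [mul_zero]
    rw [convexHull_triple hD] at hx
    by_cases g0 : 0 ≤ ε * orient a b x
    · by_cases g1 : 0 ≤ ε * orient b c x
      · have g2 : ¬ 0 ≤ ε * orient c a x := fun g2 => hx ⟨g0, g1, g2⟩
        rw [← triTot_rotate, ← triTot_rotate]
        exact triTot_outside hD2 (not_le.mp g2)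
      · rw [← triTot_rotate]
        exact triTot_outside hD1 (not_le.mp g1)
    · exact triTot_outside hD (not_le.mp g0)

/-- For counting: two different triangles that contain a point contribute at least 2. -/
lemma add_le_sum_map {α : Type*} {f : α → ℝ} {l : List α} (hf : ∀ a, 0 ≤ f a) {a b : α}
    (ha : a ∈ l) (hb : b ∈ l) (hab : a ≠ b) : f a + f b ≤ (l.map f).sum := by
  have hs : ∀ l : List α, 0 ≤ (l.map f).sum := fun l => List.sum_nonneg (by
    intro x hx
    obtain ⟨y, -, rfl⟩ := List.mem_map.mp hx
    exact hf y)
  have h1 : ∀ (l : List α) (c : α), c ∈ l → f c ≤ (l.map f).sum := by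
    intro l
    induction l with
    | nil => simp
    | cons d l ih =>
      intro c hc
      rw [List.map_cons, List.sum_cons]
      rcases List.mem_cons.mp hc with rfl | hc
      · linarith [hs l]
      · linarith [ih c hc, hf d]
  induction l with
  | nil => simp at ha
  | cons d l ih =>
    rw [List.map_cons, List.sum_cons]
    rcases List.mem_cons.mp ha with rfl | ha'
    · rcases List.mem_cons.mp hb with rfl | hb'
      · exact absurd rfl hab
      · linarith [h1 l b hb']
    · rcases List.mem_cons.mp hb with rfl | hb'
      · linarith [h1 l a ha']
      · linarith [ih ha' hb', hf d]

namespace IsTri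

variable {p : ℕ → Plane} {m i j : ℕ} {A : List (ℕ × ℕ × ℕ)} {ε : ℝ}

lemma orient_pos (h : IsTri p m i j A) (ho : IsOrientedLoop p m ε) {t : ℕ × ℕ × ℕ} (ht : t ∈ A) :
    0 < ε * orient (p t.1) (p t.2.1) (p t.2.2) := by
  obtain ⟨hm, h1, h2, h3⟩ := h.chords ht
  obtain ⟨-, r1, r2, -⟩ := h.range ht
  exact ho.orient_pos_of_chords r1 r2 hm h1 h2 h3

/-- Quantities that are antisymmetric along the chords are additive. -/
lemma sum_eq (h : IsTri p m i j A) (F : Plane → Plane → ℝ)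
    (hF : ∀ a < m, ∀ b < m, a ≠ b → F (p b) (p a) = -F (p a) (p b)) (hj : j < m) :
    ∑ k ∈ Finset.Ico i j, F (p k) (p (k + 1)) + F (p j) (p i) =
      (A.map fun t => F (p t.1) (p t.2.1) + F (p t.2.1) (p t.2.2) + F (p t.2.2) (p t.1)).sum := by
  induction h with
  | edge i =>
    rw [hF i (by omega) (i + 1) hj (by omega)]; simp
  | @node i c j A B hic hcj _ _ _ _ _ _ ihA ihB =>
    rw [List.map_cons, List.sum_cons, List.map_append, List.sum_append, ← ihA (by omega),
      ← ihB hj, ← Finset.sum_Ico_consecutive _ hic.le hcj.le,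
      hF i (by omega) c (by omega) (by omega), hF c (by omega) j (by omega) (by omega)]
    ring

lemma area_eq (h : IsTri p m 0 (m - 1) A) (hp : IsSimpleLoop p m) :
    area2 p m = (A.map fun t => orient (p t.1) (p t.2.1) (p t.2.2)).sum := by
  have hm := hp.three_le
  have := h.sum_eq cross (fun a _ b _ _ => by unfold cross; ring) (by omega)
  have e : area2 p m = ∑ k ∈ Finset.Ico 0 (m - 1), cross (p k) (p (k + 1)) +
      cross (p (m - 1)) (p 0) := by
    unfold area2
    obtain ⟨l, rfl⟩ : ∃ l, m = l + 1 := ⟨m - 1, by omega⟩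
    rw [Finset.sum_range_succ, hp.per_zero, Nat.add_sub_cancel, Finset.range_eq_Ico]
  rw [e, this]
  congr 1
  apply List.map_congr_left
  intro t _
  unfold cross orient; ring

lemma tot_eq (h : IsTri p m 0 (m - 1) A) (hp : IsSimpleLoop p m) {x : Plane}
    (hx : x ∈ offLines p m) :
    tot p m x = (A.map fun t => triTot x (p t.1) (p t.2.1) (p t.2.2)).sum := by
  have hm := hp.three_le
  have := h.sum_eq (ang x) (fun a ha b hb hab => ang_swap fun hseg =>
    hx a ha b hb hab (orient_of_mem_segment hseg)) (by omega)
  have e : tot p m x = ∑ k ∈ Finset.Ico 0 (m - 1), ang x (p k) (p (k + 1)) +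
      ang x (p (m - 1)) (p 0) := by
    unfold tot
    obtain ⟨l, rfl⟩ : ∃ l, m = l + 1 := ⟨m - 1, by omega⟩
    rw [Finset.sum_range_succ, hp.per_zero, Nat.add_sub_cancel, Finset.range_eq_Ico]
  rw [e, this]
  rfl

open Classical in
/-- The number of triangles containing a point is its winding number. -/
lemma tot_eq_count (h : IsTri p m 0 (m - 1) A) (ho : IsOrientedLoop p m ε) {x : Plane}
    (hx : x ∈ offLines p m) : tot p m x =
      ε * (2 * Real.pi) * (A.map fun t => if x ∈ triHull p t then (1 : ℝ) else 0).sum := by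
  rw [h.tot_eq ho.toIsSimpleLoop hx, ← List.sum_map_mul_left]
  congr 1
  apply List.map_congr_left
  intro t ht
  obtain ⟨hm, -⟩ := h.chords ht
  obtain ⟨-, r1, r2, -⟩ := h.range ht
  exact triTot_eq_ite ho.sign (h.orient_pos ho ht) (hx _ (by omega) _ (by omega) (by omega))
    (hx _ (by omega) _ (by omega) (by omega)) (hx _ (by omega) _ (by omega) (by omega))

lemma notMem_Bd (hp : IsSimpleLoop p m) {x : Plane} (hx : x ∈ offLines p m) : x ∉ Bd p := by
  intro hB
  obtain ⟨k, hk, hs⟩ := hp.mem_Bd_lt.mp hB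
  have h0 := orient_of_mem_segment hs
  rw [← hp.mod_eq (k + 1)] at h0
  refine hx k hk _ (Nat.mod_lt _ (by omega)) ?_ h0
  intro e
  have := hp.ne_succ k
  rw [← hp.mod_eq (k + 1), ← e] at this
  exact this rfl

lemma triHull_subset (h : IsTri p m i j A) (hp : IsSimpleLoop p m) {t : ℕ × ℕ × ℕ} (ht : t ∈ A) :
    triHull p t ⊆ cls (Bd p) := by
  obtain ⟨-, h1, h2, h3⟩ := h.chords ht
  exact triangle_subset_cls (h1.sees hp) (h2.sees hp) (h3.sees hp).symm

/-- At an inner point off all lines the total angle is not zero, so by `tot_eq_count` some triangle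
contains it. Such points are dense in the open polygon, and the triangles are closed. -/
lemma cover (h : IsTri p m 0 (m - 1) A) (ho : IsOrientedLoop p m ε) :
    cls (Bd p) ⊆ ⋃ t ∈ A, triHull p t := by
  classical
  have hcl : IsClosed (⋃ t ∈ A, triHull p t) := by
    have : (⋃ t ∈ A, triHull p t) = ⋃ t ∈ A.toFinset, triHull p t := by simp
    rw [this]
    exact A.toFinset.finite_toSet.isClosed_biUnion fun t _ =>
      ((Set.toFinite _).isCompact_convexHull ℝ).isClosed
  have h1 : opn (Bd p) ∩ offLines p m ⊆ ⋃ t ∈ A, triHull p t := by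
    rintro x ⟨hxo, hx⟩
    by_contra hcon
    have h0 : ∀ t ∈ A, x ∉ triHull p t := fun t ht hxt => hcon (Set.mem_biUnion ht hxt)
    have e := h.tot_eq_count ho hx
    have : (A.map fun t => if x ∈ triHull p t then (1 : ℝ) else 0).sum = 0 := by
      apply List.sum_eq_zero
      intro y hy
      obtain ⟨t, ht, rfl⟩ := List.mem_map.mp hy
      exact if_neg (h0 t ht)
    rw [this, mul_zero] at e
    exact ho.tot_ne hxo e
  have h2 : opn (Bd p) ⊆ ⋃ t ∈ A, triHull p t := by
    refine Set.Subset.trans ?_ (closure_minimal h1 hcl)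
    exact ho.dense_offLines.open_subset_closure_inter (isOpen_opn ho.isClosed_Bd)
  exact Set.union_subset (ho.Bd_subset_closure_opn.trans (closure_minimal h2 hcl)) h2

/-- A point common to two interiors can be chosen off all lines. It would be counted at least twice,
but the winding number of a simple polygon is `0` or `ε`. -/
lemma disjoint_interior (h : IsTri p m 0 (m - 1) A) (ho : IsOrientedLoop p m ε)
    {t t' : ℕ × ℕ × ℕ} (ht : t ∈ A) (ht' : t' ∈ A) (hne : t ≠ t') :
    Disjoint (interior (triHull p t)) (interior (triHull p t')) := by
  classical
  rw [Set.disjoint_iff_inter_eq_empty]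
  by_contra hcon
  obtain ⟨x, ⟨hx1, hx2⟩, hx⟩ := ho.dense_offLines.inter_open_nonempty _
    (isOpen_interior.inter isOpen_interior) (Set.nonempty_iff_ne_empty.mpr hcon)
  have e := h.tot_eq_count ho hx
  have h2 := add_le_sum_map (f := fun t => if x ∈ triHull p t then (1 : ℝ) else 0)
    (fun t => by split_ifs <;> norm_num) ht ht' hne
  rw [if_pos (interior_subset hx1), if_pos (interior_subset hx2)] at h2
  have hpi := Real.pi_pos
  rcases ho.tot_dichotomy (notMem_Bd ho.toIsSimpleLoop hx) with e' | e' <;> rw [e'] at e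
  · have : ε * (2 * Real.pi) ≠ 0 := mul_ne_zero ho.sign_ne (by positivity)
    have := mul_left_cancel₀ this ((mul_one _).trans e)
    linarith
  · rcases mul_eq_zero.mp e.symm with e | e
    · exact mul_ne_zero ho.sign_ne (by positivity) e
    · linarith

/-- The areas of the triangles add up and all have the sign `ε`. This ties the sign defined by
winding to the shoelace formula. -/
lemma area_pos (h : IsTri p m 0 (m - 1) A) (ho : IsOrientedLoop p m ε) : 0 < ε * area2 p m := by
  have hm := ho.three_le
  rw [h.area_eq ho.toIsSimpleLoop, ← List.sum_map_mul_left]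
  obtain ⟨t, ht, -⟩ := h.exists_base (by omega)
  apply List.sum_pos
  · intro y hy
    obtain ⟨t, ht, rfl⟩ := List.mem_map.mp hy
    exact h.orient_pos ho ht
  · intro e
    rw [List.map_eq_nil_iff] at e
    rw [e] at ht; simp at ht

end IsTri


/-! ### The dual tree -/

/-- Parents lead to the root because the rank decreases, so the graph is connected. The edges
correspond to the nodes other than the root, each to the edge towards its parent. -/
lemma SimpleGraph.isTree_of_parent {V : Type*} [Finite V] (G : SimpleGraph V) (root : V)
    (par : V → V) (rank : V → ℕ)
    (hadj : ∀ v w, G.Adj v w ↔ (v ≠ root ∧ w = par v) ∨ (w ≠ root ∧ v = par w))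
    (hrank : ∀ v, v ≠ root → rank (par v) < rank v) : G.IsTree := by
  classical
  rw [SimpleGraph.isTree_iff_connected_and_card]
  constructor
  · have hreach : ∀ v, G.Reachable v root := by
      intro v
      induction hN : rank v using Nat.strong_induction_on generalizing v with
      | _ N ih =>
      by_cases hv : v = root
      · rw [hv]
      · have h1 := ih _ (hN ▸ hrank v hv) (par v) rfl
        exact (SimpleGraph.Adj.reachable ((hadj _ _).mpr (Or.inl ⟨hv, rfl⟩))).trans h1
    have : Nonempty V := ⟨root⟩
    exact ⟨fun v w => (hreach v).trans (hreach w).symm⟩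
  · have e : Nat.card G.edgeSet = Nat.card {v // v ≠ root} := by
      symm
      refine Nat.card_eq_of_bijective (fun v => ⟨s(v.1, par v.1), ?_⟩) ⟨?_, ?_⟩
      · rw [SimpleGraph.mem_edgeSet]; exact (hadj _ _).mpr (Or.inl ⟨v.2, rfl⟩)
      · rintro ⟨v, hv⟩ ⟨w, hw⟩ h
        have h' : s(v, par v) = s(w, par w) := congrArg Subtype.val h
        rcases Sym2.eq_iff.mp h' with ⟨e, -⟩ | ⟨e1, e2⟩
        · exact Subtype.ext e
        -- Two nodes cannot be parents of each other, since the rank would decrease both ways.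
        · exfalso
          have h1 := hrank v hv
          have h2 := hrank w hw
          rw [e2] at h1; rw [← e1] at h2
          omega
      · rintro ⟨e, he⟩
        induction e using Sym2.ind with
        | _ v w =>
        rw [SimpleGraph.mem_edgeSet] at he
        rcases (hadj _ _).mp he with ⟨h1, rfl⟩ | ⟨h1, rfl⟩
        · exact ⟨⟨v, h1⟩, rfl⟩
        · exact ⟨⟨w, h1⟩, Subtype.ext Sym2.eq_swap⟩
    rw [e]
    have : Fintype V := Fintype.ofFinite V
    rw [Nat.card_eq_fintype_card, Nat.card_eq_fintype_card, Fintype.card_subtype_compl,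
      Fintype.card_subtype_eq]
    have : 0 < Fintype.card V := Fintype.card_pos_iff.mpr ⟨root⟩
    omega

lemma exists_cycle_three {X : Type*} {a b c : X} (hab : a ≠ b) (hbc : b ≠ c) (hca : c ≠ a)
    (h : ∀ x, x = a ∨ x = b ∨ x = c) :
    ∃ ρ : Equiv.Perm X, ρ.IsCycleOn Set.univ ∧ ρ a = b ∧ ρ b = c ∧ ρ c = a := by
  classical
  have ea : (Equiv.swap a b * Equiv.swap b c) a = b := by
    rw [Equiv.Perm.mul_apply, Equiv.swap_apply_of_ne_of_ne hab hca.symm, Equiv.swap_apply_left]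
  have eb : (Equiv.swap a b * Equiv.swap b c) b = c := by
    rw [Equiv.Perm.mul_apply, Equiv.swap_apply_left, Equiv.swap_apply_of_ne_of_ne hca hbc.symm]
  have ec : (Equiv.swap a b * Equiv.swap b c) c = a := by
    rw [Equiv.Perm.mul_apply, Equiv.swap_apply_right, Equiv.swap_apply_right]
  refine ⟨Equiv.swap a b * Equiv.swap b c, ⟨?_, ?_⟩, ea, eb, ec⟩
  · exact Set.bijOn_univ.mpr (Equiv.bijective _)
  · have s1 : (Equiv.swap a b * Equiv.swap b c).SameCycle a b := ⟨1, by rw [zpow_one]; exact ea⟩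
    have s2 : (Equiv.swap a b * Equiv.swap b c).SameCycle b c := ⟨1, by rw [zpow_one]; exact eb⟩
    have hs : ∀ x, (Equiv.swap a b * Equiv.swap b c).SameCycle a x := by
      intro x
      rcases h x with rfl | rfl | rfl
      · exact Equiv.Perm.SameCycle.refl _ _
      · exact s1
      · exact s1.trans s2
    exact fun x _ y _ => (hs x).symm.trans (hs y)

namespace SimplePolygon

variable {n : ℕ}

/-- The vertex with number `k` modulo `n`. -/
def vert (P : SimplePolygon n) (k : ℕ) : Fin n := ⟨k % n, Nat.mod_lt _ P.pos⟩

lemma loop_eq_vert (P : SimplePolygon n) (k : ℕ) : P.loop k = P (P.vert k) := rfl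

lemma vert_val (P : SimplePolygon n) (v : Fin n) : P.vert v = v :=
  Fin.ext (Nat.mod_eq_of_lt v.2)

lemma vert_inj (P : SimplePolygon n) {a b : ℕ} (ha : a < n) (hb : b < n) :
    P.vert a = P.vert b ↔ a = b := by
  simp only [vert, Fin.mk.injEq, Nat.mod_eq_of_lt ha, Nat.mod_eq_of_lt hb]

lemma finRotate_vert (P : SimplePolygon n) (k : ℕ) : finRotate n (P.vert k) = P.vert (k + 1) := by
  apply Fin.ext
  rw [P.val_finRotate]; simp [vert]

/-- The set of vertices of a triangle. -/
def triFin (P : SimplePolygon n) (t : ℕ × ℕ × ℕ) : Finset (Fin n) :=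
  {P.vert t.1, P.vert t.2.1, P.vert t.2.2}

lemma image_triFin (P : SimplePolygon n) (t : ℕ × ℕ × ℕ) :
    convexHull ℝ (P.vertices '' (P.triFin t : Set (Fin n))) = triHull P.loop t := by
  unfold triFin triHull
  rw [Finset.coe_insert, Finset.coe_insert, Finset.coe_singleton, Set.image_insert_eq,
    Set.image_insert_eq, Set.image_singleton]
  rfl

/-- The triangulation given by a triangulation of the vertex sequence. -/
noncomputable def triangulation (P : SimplePolygon n) {ε : ℝ} {A : List (ℕ × ℕ × ℕ)}
    (ho : IsOrientedLoop P.loop n ε) (hA : IsTri P.loop n 0 (n - 1) A) : P.Triangulation where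
  triangles := (A.map P.triFin).toFinset
  isTriangle t ht := by
    obtain ⟨t, htA, rfl⟩ := List.mem_map.mp (List.mem_toFinset.mp ht)
    have := hA.orient_pos ho htA
    rcases ho.sign with rfl | rfl
    · exact ⟨_, _, _, rfl, by rw [one_mul] at this; exact this⟩
    · refine ⟨P.vert t.2.2, P.vert t.2.1, P.vert t.1, ?_, ?_⟩
      · unfold triFin; ext; simp; tauto
      · have e : orient (P (P.vert t.2.2)) (P (P.vert t.2.1)) (P (P.vert t.1)) =
            -orient (P.loop t.1) (P.loop t.2.1) (P.loop t.2.2) := by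
          simp only [loop_eq_vert]; unfold orient; ring
        rw [e]; linarith
  disjoint s hs t ht hst := by
    obtain ⟨s, hsA, rfl⟩ := List.mem_map.mp (List.mem_toFinset.mp hs)
    obtain ⟨t, htA, rfl⟩ := List.mem_map.mp (List.mem_toFinset.mp ht)
    rw [image_triFin, image_triFin]
    exact hA.disjoint_interior ho hsA htA fun e => hst (by rw [e])
  cover := by
    rw [P.closedRegion_eq]
    apply Set.Subset.antisymm
    · intro x hx
      obtain ⟨t, ht, hxt⟩ := Set.mem_iUnion₂.mp hx
      obtain ⟨t, htA, rfl⟩ := List.mem_map.mp (List.mem_toFinset.mp ht)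
      rw [image_triFin] at hxt
      exact hA.triHull_subset ho.toIsSimpleLoop htA hxt
    · intro x hx
      obtain ⟨t, htA, hxt⟩ := Set.mem_iUnion₂.mp (hA.cover ho hx)
      refine Set.mem_iUnion₂.mpr ⟨P.triFin t, List.mem_toFinset.mpr (List.mem_map_of_mem htA), ?_⟩
      rwa [image_triFin]

namespace Triangulation

variable {P : SimplePolygon n} {T : P.Triangulation}

lemma orient_perm_ne {a b c : Plane} (h : 0 < orient a b c) : a ≠ b ∧ b ≠ c ∧ c ≠ a := by
  refine ⟨?_, ?_, ?_⟩ <;> rintro rfl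
  · rw [orient_same] at h; exact lt_irrefl _ h
  · rw [orient_self_right] at h; exact lt_irrefl _ h
  · rw [orient_self_left] at h; exact lt_irrefl _ h

lemma RightReflex.ne {a b : Finset (Fin n)} (h : T.RightReflex a b) : a ≠ b := by
  obtain ⟨p, v, w, q, rfl, hb, h1, h2, -⟩ := h
  rintro rfl
  obtain ⟨n1, n2, n3⟩ := orient_perm_ne h1
  obtain ⟨m1, m2, m3⟩ := orient_perm_ne h2
  have : p ∈ ({q, w, v} : Finset (Fin n)) := by rw [← hb]; simp
  simp only [Finset.mem_insert, Finset.mem_singleton] at this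
  rcases this with rfl | rfl | rfl
  · have e := orient_swap (P p) (P v) (P w)
    have e2 : orient (P p) (P w) (P v) = -orient (P p) (P v) (P w) := by unfold orient; ring
    linarith
  · exact n3 rfl
  · exact n1 rfl

/-- Both directions would make both ends of the common edge reflex, which is impossible: the two
turns add up to twice the area of the quadrilateral, a positive number. -/
lemma RightReflex.asymm {a b : Finset (Fin n)} (h : T.RightReflex a b) :
    ¬ T.RightReflex b a := by
  intro h'
  have hne := h.ne
  obtain ⟨p, v, w, q, rfl, rfl, h1, h2, h3⟩ := h
  obtain ⟨p', v', w', q', hb, ha, h1', h2', h3'⟩ := h'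
  obtain ⟨n1, n2, n3⟩ := orient_perm_ne h1
  obtain ⟨m1, m2, m3⟩ := orient_perm_ne h2
  obtain ⟨n1', n2', n3'⟩ := orient_perm_ne h1'
  obtain ⟨m1', m2', m3'⟩ := orient_perm_ne h2'
  have hpq : p ≠ q := by
    rintro rfl
    apply hne; ext x; simp; tauto
  have ea : ∀ x, (x = p ∨ x = v ∨ x = w) ↔ (x = q' ∨ x = w' ∨ x = v') := by
    intro x; simpa using Finset.ext_iff.mp ha x
  have eb : ∀ x, (x = q ∨ x = w ∨ x = v) ↔ (x = p' ∨ x = v' ∨ x = w') := by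
    intro x; simpa using Finset.ext_iff.mp hb x
  have hp : p = q' := by
    rcases (ea p).mp (Or.inl rfl) with e | e | e
    · exact e
    · rcases (eb p).mpr (Or.inr (Or.inr e)) with e' | e' | e'
      · exact absurd e' hpq
      · exact absurd (by rw [e']) n3
      · exact absurd (by rw [e']) n1
    · rcases (eb p).mpr (Or.inr (Or.inl e)) with e' | e' | e'
      · exact absurd e' hpq
      · exact absurd (by rw [e']) n3
      · exact absurd (by rw [e']) n1
  have hq : q = p' := by
    rcases (eb q).mp (Or.inl rfl) with e | e | e
    · exact e
    · rcases (ea q).mpr (Or.inr (Or.inr e)) with e' | e' | e'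
      · exact absurd e'.symm hpq
      · exact absurd (by rw [e']) m3
      · exact absurd (by rw [e']) m1
    · rcases (ea q).mpr (Or.inr (Or.inl e)) with e' | e' | e'
      · exact absurd e'.symm hpq
      · exact absurd (by rw [e']) m3
      · exact absurd (by rw [e']) m1
  subst hp hq
  rcases (ea v).mp (Or.inr (Or.inl rfl)) with e | e | e
  · exact n1 (by rw [e])
  · rcases (ea w).mp (Or.inr (Or.inr rfl)) with e' | e' | e'
    · exact n3 (by rw [e'])
    · exact n2 (by rw [e, e'])
    · subst e e'
      have : orient (P p) (P v) (P q) + orient (P q) (P w) (P p) =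
          orient (P p) (P v) (P w) + orient (P q) (P w) (P v) := by unfold orient; ring
      linarith
  · rcases (ea w).mp (Or.inr (Or.inr rfl)) with e' | e' | e'
    · exact n3 (by rw [e'])
    · subst e e'
      have : orient (P q) (P v) (P w) = -orient (P q) (P w) (P v) := by unfold orient; ring
      linarith
    · exact n2 (by rw [e, e'])

/-- The dual graph. -/
def dualGraph (T : P.Triangulation) : SimpleGraph T.DualNode where
  Adj x y := x ≠ y ∧ (T.nodeEdges x ∩ T.nodeEdges y).Nonempty
  symm := ⟨fun x y h => ⟨h.1.symm, by rw [Set.inter_comm]; exact h.2⟩⟩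
  loopless := ⟨fun _ h => h.1 rfl⟩

end Triangulation

end SimplePolygon


/-! ### The nodes of the dual, its tree structure and its cyclic orders -/

namespace SimplePolygon

variable {n : ℕ}

lemma mem_triFin {P : SimplePolygon n} {t : ℕ × ℕ × ℕ} (ht : t.1 < t.2.1 ∧ t.2.1 < t.2.2 ∧ t.2.2 < n)
    {a : ℕ} (ha : a < n) : P.vert a ∈ P.triFin t ↔ a = t.1 ∨ a = t.2.1 ∨ a = t.2.2 := by
  unfold triFin
  rw [Finset.mem_insert, Finset.mem_insert, Finset.mem_singleton, P.vert_inj ha (by omega),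
    P.vert_inj ha (by omega), P.vert_inj ha (by omega)]

lemma triFin_inj {P : SimplePolygon n} {t t' : ℕ × ℕ × ℕ}
    (ht : t.1 < t.2.1 ∧ t.2.1 < t.2.2 ∧ t.2.2 < n)
    (ht' : t'.1 < t'.2.1 ∧ t'.2.1 < t'.2.2 ∧ t'.2.2 < n) (e : P.triFin t = P.triFin t') : t = t' := by
  have h : ∀ a < n, (a = t.1 ∨ a = t.2.1 ∨ a = t.2.2) ↔ (a = t'.1 ∨ a = t'.2.1 ∨ a = t'.2.2) := by
    intro a ha; rw [← mem_triFin (P := P) ht ha, e, mem_triFin ht' ha]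
  have h1 := (h t.1 (by omega)).mp (by simp)
  have h2 := (h t.2.1 (by omega)).mp (by simp)
  have h3 := (h t.2.2 (by omega)).mp (by simp)
  have h1' := (h t'.1 (by omega)).mpr (by simp)
  have h2' := (h t'.2.1 (by omega)).mpr (by simp)
  have h3' := (h t'.2.2 (by omega)).mpr (by simp)
  obtain ⟨x, y, z⟩ := t
  obtain ⟨x', y', z'⟩ := t'
  dsimp only at *
  rw [Prod.mk.injEq, Prod.mk.injEq]
  omega

namespace Triangulation

variable {P : SimplePolygon n} {T : P.Triangulation} {A : List (ℕ × ℕ × ℕ)}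

/-- The pair `a b` is the lowest side of the node: the base of a triangle or a polygon edge. -/
def Low (A : List (ℕ × ℕ × ℕ)) (v : T.DualNode) (a b : ℕ) : Prop :=
  Sum.elim (fun τ => ∃ t ∈ A, τ.1 = P.triFin t ∧ t.1 = a ∧ t.2.2 = b)
    (fun k => (k : ℕ) = a ∧ a + 1 = b ∧ b < n) v

/-- The pair `a b` is an upper side of the node; the last polygon edge lies below everything. -/
def Up (A : List (ℕ × ℕ × ℕ)) (v : T.DualNode) (a b : ℕ) : Prop :=
  Sum.elim (fun τ => ∃ t ∈ A, τ.1 = P.triFin t ∧ IsSide t a b)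
    (fun k => (k : ℕ) = n - 1 ∧ a = 0 ∧ b = n - 1) v

lemma tri_range (hA : IsTri P.loop n 0 (n - 1) A) {t : ℕ × ℕ × ℕ} (ht : t ∈ A) :
    t.1 < t.2.1 ∧ t.2.1 < t.2.2 ∧ t.2.2 < n := by
  have := hA.range ht
  have := P.pos
  omega

lemma Low.lt (hA : IsTri P.loop n 0 (n - 1) A) {v : T.DualNode} {a b : ℕ} (h : Low A v a b) :
    a < b ∧ b < n := by
  rcases v with τ | k
  · obtain ⟨t, ht, -, rfl, rfl⟩ := h
    have := tri_range hA ht; omega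
  · obtain ⟨-, h1, h2⟩ := h; omega

lemma Up.lt (hA : IsTri P.loop n 0 (n - 1) A) {v : T.DualNode} {a b : ℕ} (h : Up A v a b) :
    a < b ∧ b < n := by
  rcases v with τ | k
  · obtain ⟨t, ht, -, h⟩ := h
    have := tri_range hA ht
    unfold IsSide at h; omega
  · obtain ⟨-, h1, h2⟩ := h
    have := P.isSimple.three_le
    omega

lemma Low.base_unique (hA : IsTri P.loop n 0 (n - 1) A) {v : T.DualNode} {a b a' b' : ℕ}
    (h : Low A v a b) (h' : Low A v a' b') : a = a' ∧ b = b' := by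
  rcases v with τ | k
  · obtain ⟨t, ht, e, rfl, rfl⟩ := h
    obtain ⟨t', ht', e', rfl, rfl⟩ := h'
    obtain rfl := triFin_inj (tri_range hA ht) (tri_range hA ht') (e.symm.trans e')
    exact ⟨rfl, rfl⟩
  · obtain ⟨h1, h2, h3⟩ := h
    obtain ⟨h1', h2', h3'⟩ := h'
    omega

lemma Low.inj (hA : IsTri P.loop n 0 (n - 1) A) {v w : T.DualNode} {a b : ℕ}
    (h : Low A v a b) (h' : Low A w a b) : v = w := by
  rcases v with τ | k <;> rcases w with τ' | k'
  · obtain ⟨t, ht, e, h1, h2⟩ := h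
    obtain ⟨t', ht', e', h1', h2'⟩ := h'
    obtain rfl := hA.base_inj ht ht' (by omega) (by omega)
    rw [Subtype.ext (e.trans e'.symm)]
  · obtain ⟨t, ht, e, h1, h2⟩ := h
    have := tri_range hA ht
    obtain ⟨h1', h2', -⟩ := h'
    omega
  · obtain ⟨t, ht, e, h1, h2⟩ := h'
    have := tri_range hA ht
    obtain ⟨h1', h2', -⟩ := h
    omega
  · obtain ⟨h1, -⟩ := h
    obtain ⟨h1', -⟩ := h'
    rw [Fin.ext (h1.trans h1'.symm)]

lemma Up.inj (hA : IsTri P.loop n 0 (n - 1) A) {v w : T.DualNode} {a b : ℕ}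
    (h : Up A v a b) (h' : Up A w a b) : v = w := by
  have key : ∀ t ∈ A, IsSide t a b → ¬ (a = 0 ∧ b = n - 1) := by
    intro t ht hs e
    have := hA.range ht
    unfold IsSide at hs
    omega
  rcases v with τ | k <;> rcases w with τ' | k'
  · obtain ⟨t, ht, e, h1⟩ := h
    obtain ⟨t', ht', e', h1'⟩ := h'
    obtain rfl := hA.side_inj ht ht' h1 h1'
    rw [Subtype.ext (e.trans e'.symm)]
  · obtain ⟨t, ht, -, h1⟩ := h
    exact absurd h'.2 (key t ht h1)
  · obtain ⟨t, ht, -, h1⟩ := h'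
    exact absurd h.2 (key t ht h1)
  · rw [Fin.ext (h.1.trans h'.1.symm)]

/-- The index length of the sides decreases from the base of a triangle to its upper sides. It
serves as the rank in the tree. -/
lemma Up.lt_low (hA : IsTri P.loop n 0 (n - 1) A) {v : T.DualNode} {a b a' b' : ℕ}
    (h : Up A v a b) (h' : Low A v a' b') : b - a < b' - a' := by
  rcases v with τ | k
  · obtain ⟨t, ht, e, h1⟩ := h
    obtain ⟨t', ht', e', rfl, rfl⟩ := h'
    obtain rfl := triFin_inj (tri_range hA ht) (tri_range hA ht') (e.symm.trans e')
    have := tri_range hA ht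
    unfold IsSide at h1; omega
  · obtain ⟨h1, h2, h3⟩ := h
    obtain ⟨h1', h2', h3'⟩ := h'
    omega

lemma Low.exists_up (hA : IsTri P.loop n 0 (n - 1) A) (hT : ∀ t ∈ A, P.triFin t ∈ T.triangles)
    {v : T.DualNode} {a b : ℕ} (h : Low A v a b) : ∃ w : T.DualNode, Up A w a b := by
  have hn := P.isSimple.three_le
  have hroot : a = 0 → b = n - 1 → ∃ w : T.DualNode, Up A w a b := fun h1 h2 =>
    ⟨Sum.inr ⟨n - 1, by omega⟩, rfl, h1, h2⟩
  have htri : (∃ t ∈ A, IsSide t a b) → ∃ w : T.DualNode, Up A w a b := fun ⟨t, ht, hs⟩ =>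
    ⟨Sum.inl ⟨_, hT t ht⟩, t, ht, rfl, hs⟩
  rcases v with τ | k
  · obtain ⟨t, ht, -, rfl, rfl⟩ := h
    rcases hA.above_base ht with ⟨e1, e2⟩ | h
    · exact hroot e1 e2
    · exact htri h
  · obtain ⟨-, rfl, h2⟩ := h
    rcases hA.above_edge (Nat.zero_le a) (by omega) with ⟨e1, e2⟩ | h
    · exact hroot e1 e2
    · exact htri h

lemma Up.exists_low (hA : IsTri P.loop n 0 (n - 1) A) (hT : ∀ t ∈ A, P.triFin t ∈ T.triangles)
    {v : T.DualNode} {a b : ℕ} (h : Up A v a b) : ∃ w : T.DualNode, Low A w a b := by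
  have hn := P.isSimple.three_le
  have hlt := h.lt hA
  have htri : (∃ t ∈ A, t.1 = a ∧ t.2.2 = b) → ∃ w : T.DualNode, Low A w a b := fun ⟨t, ht, hs⟩ =>
    ⟨Sum.inl ⟨_, hT t ht⟩, t, ht, rfl, hs⟩
  rcases v with τ | k
  · obtain ⟨t, ht, -, hs⟩ := h
    rcases hA.below_side ht hs with e | h
    · exact ⟨Sum.inr ⟨a, by omega⟩, rfl, e.symm, hlt.2⟩
    · exact htri h
  · obtain ⟨-, rfl, rfl⟩ := h
    exact htri (hA.exists_base (by omega))

lemma mem_nodeEdges_iff (hA : IsTri P.loop n 0 (n - 1) A)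
    (hT : ∀ τ ∈ T.triangles, ∃ t ∈ A, P.triFin t = τ) {v : T.DualNode} {a b : ℕ} (hab : a < b)
    (hb : b < n) : s(P.vert a, P.vert b) ∈ T.nodeEdges v ↔ Low A v a b ∨ Up A v a b := by
  have hn := P.isSimple.three_le
  rcases v with τ | k
  · have e : s(P.vert a, P.vert b) ∈ T.nodeEdges (Sum.inl τ) ↔
        P.vert a ∈ τ.1 ∧ P.vert b ∈ τ.1 := by
      change (¬ s(P.vert a, P.vert b).IsDiag ∧ ∀ v ∈ s(P.vert a, P.vert b), v ∈ τ.1) ↔ _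
      rw [Sym2.mk_isDiag_iff, P.vert_inj (by omega) hb]
      constructor
      · exact fun h => ⟨h.2 _ (by simp), h.2 _ (by simp)⟩
      · refine fun h => ⟨by omega, fun v hv => ?_⟩
        rcases Sym2.mem_iff.mp hv with rfl | rfl
        · exact h.1
        · exact h.2
    rw [e]
    obtain ⟨t, ht, et⟩ := hT τ.1 τ.2
    have r := tri_range hA ht
    rw [← et, mem_triFin r (by omega), mem_triFin r hb]
    constructor
    · intro h
      by_cases hl : a = t.1 ∧ b = t.2.2
      · exact Or.inl ⟨t, ht, et.symm, hl.1.symm, hl.2.symm⟩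
      · refine Or.inr ⟨t, ht, et.symm, ?_⟩
        unfold IsSide; omega
    · rintro (⟨t', ht', e', rfl, rfl⟩ | ⟨t', ht', e', hs⟩)
      · obtain rfl := triFin_inj r (tri_range hA ht') (et.trans e')
        simp
      · obtain rfl := triFin_inj r (tri_range hA ht') (et.trans e')
        unfold IsSide at hs; omega
  · change s(P.vert a, P.vert b) = s(k, finRotate n k) ↔ _
    have ek : k = P.vert k := (P.vert_val k).symm
    have hk := k.2
    change _ ↔ ((k : ℕ) = a ∧ a + 1 = b ∧ b < n) ∨ ((k : ℕ) = n - 1 ∧ a = 0 ∧ b = n - 1)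
    by_cases hk1 : (k : ℕ) + 1 < n
    · rw [ek, P.finRotate_vert, Sym2.eq_iff, P.vert_inj (by omega) hk, P.vert_inj hb hk1,
        P.vert_inj (by omega) hk1, P.vert_inj hb hk, ← ek]
      omega
    · have e0 : P.vert ((k : ℕ) + 1) = P.vert 0 := by
        unfold vert; apply Fin.ext
        rw [show (k : ℕ) + 1 = n by omega]; simp
      rw [ek, P.finRotate_vert, e0, Sym2.eq_iff, P.vert_inj (by omega) hk,
        P.vert_inj hb (by omega), P.vert_inj (by omega) (by omega), P.vert_inj hb hk, ← ek]
      omega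

lemma exists_vert_pair {v : T.DualNode} {e : Sym2 (Fin n)} (he : e ∈ T.nodeEdges v) :
    ∃ a b, a < b ∧ b < n ∧ e = s(P.vert a, P.vert b) := by
  have hn := P.isSimple.three_le
  have key : ∀ x y : Fin n, x ≠ y → ∃ a b, a < b ∧ b < n ∧ s(x, y) = s(P.vert a, P.vert b) := by
    intro x y hxy
    rcases lt_or_gt_of_ne (fun e => hxy (Fin.ext e)) with h | h
    · exact ⟨x, y, h, y.2, by rw [P.vert_val, P.vert_val]⟩
    · exact ⟨y, x, h, x.2, by rw [P.vert_val, P.vert_val, Sym2.eq_swap]⟩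
  rcases v with τ | k
  · induction e using Sym2.ind with
    | _ x y => exact key x y fun e => he.1 (Sym2.mk_isDiag_iff.mpr e)
  · obtain rfl : e = s(k, finRotate n k) := he
    apply key
    intro e
    have := congrArg Fin.val e
    rw [P.val_finRotate] at this
    have hk := k.2
    rcases Nat.lt_or_ge ((k : ℕ) + 1) n with h | h
    · rw [Nat.mod_eq_of_lt h] at this; omega
    · rw [show (k : ℕ) + 1 = n by omega, Nat.mod_self] at this; omega

/-- Each edge belongs to exactly two nodes: it is the lowest side of one and an upper side of the
other. -/
lemma exists_other_node (hA : IsTri P.loop n 0 (n - 1) A)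
    (hT : ∀ τ, τ ∈ T.triangles ↔ ∃ t ∈ A, P.triFin t = τ) {v : T.DualNode} {e : Sym2 (Fin n)}
    (he : e ∈ T.nodeEdges v) : ∃ w, w ≠ v ∧ e ∈ T.nodeEdges w ∧
      ∀ w', w' ≠ v → e ∈ T.nodeEdges w' → w' = w := by
  obtain ⟨a, b, hab, hb, rfl⟩ := exists_vert_pair he
  have iff := fun v : T.DualNode => mem_nodeEdges_iff hA (fun τ h => (hT τ).mp h) (v := v) hab hb
  have hT' : ∀ t ∈ A, P.triFin t ∈ T.triangles := fun t ht => (hT _).mpr ⟨t, ht, rfl⟩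
  rcases (iff v).mp he with h | h
  · obtain ⟨w, hw⟩ := h.exists_up hA hT'
    refine ⟨w, ?_, (iff w).mpr (Or.inr hw), fun w' hw' he' => ?_⟩
    · rintro rfl; exact lt_irrefl _ (hw.lt_low hA h)
    · rcases (iff w').mp he' with h' | h'
      · exact absurd (h'.inj hA h) hw'
      · exact h'.inj hA hw
  · obtain ⟨w, hw⟩ := h.exists_low hA hT'
    refine ⟨w, ?_, (iff w).mpr (Or.inl hw), fun w' hw' he' => ?_⟩
    · rintro rfl; exact lt_irrefl _ (h.lt_low hA hw)
    · rcases (iff w').mp he' with h' | h'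
      · exact h'.inj hA hw
      · exact absurd (h'.inj hA h) hw'

/-- The root is the terminal node of the last polygon edge. The parent of any other node is the node
that has its lowest side as an upper side. -/
lemma dualGraph_isTree (hA : IsTri P.loop n 0 (n - 1) A)
    (hT : ∀ τ, τ ∈ T.triangles ↔ ∃ t ∈ A, P.triFin t = τ) : T.dualGraph.IsTree := by
  classical
  have hn := P.isSimple.three_le
  have hT' : ∀ t ∈ A, P.triFin t ∈ T.triangles := fun t ht => (hT _).mpr ⟨t, ht, rfl⟩
  let root : T.DualNode := Sum.inr ⟨n - 1, by omega⟩
  have hroot : ∀ a b, ¬ Low A root a b := by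
    rintro a b ⟨h1, h2, h3⟩
    dsimp only at h1
    omega
  have hbase : ∀ v : T.DualNode, ∃ (x : ℕ × ℕ) (w : T.DualNode), v ≠ root →
      Low A v x.1 x.2 ∧ Up A w x.1 x.2 := by
    intro v
    by_cases hv : v = root
    · exact ⟨0, root, fun h => absurd hv h⟩
    have : ∃ a b, Low A v a b := by
      rcases v with τ | k
      · obtain ⟨t, ht, e⟩ := (hT τ.1).mp τ.2
        exact ⟨_, _, t, ht, e.symm, rfl, rfl⟩
      · refine ⟨k, k + 1, rfl, rfl, ?_⟩
        by_contra hk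
        apply hv
        have := k.2
        exact congrArg Sum.inr (Fin.ext (show (k : ℕ) = n - 1 by omega))
    obtain ⟨a, b, h⟩ := this
    obtain ⟨w, hw⟩ := h.exists_up hA hT'
    exact ⟨(a, b), w, fun _ => ⟨h, hw⟩⟩
  choose x par hx using hbase
  have iff : ∀ {v : T.DualNode} {a b : ℕ}, a < b → b < n →
      (s(P.vert a, P.vert b) ∈ T.nodeEdges v ↔ Low A v a b ∨ Up A v a b) := fun hab hb =>
    mem_nodeEdges_iff hA (fun τ h => (hT τ).mp h) hab hb
  have step : ∀ {v w : T.DualNode} {a b : ℕ}, Low A v a b → Up A w a b →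
      v ≠ root ∧ w = par v := by
    intro v w a b h h'
    have hv : v ≠ root := by rintro rfl; exact hroot _ _ h
    refine ⟨hv, ?_⟩
    obtain ⟨h1, h2⟩ := hx v hv
    obtain ⟨rfl, rfl⟩ := h.base_unique hA h1
    exact h'.inj hA h2
  have back : ∀ v, v ≠ root → T.dualGraph.Adj v (par v) := by
    intro v hv
    obtain ⟨h1, h2⟩ := hx v hv
    obtain ⟨l1, l2⟩ := h1.lt hA
    refine ⟨?_, s(P.vert (x v).1, P.vert (x v).2), (iff l1 l2).mpr (Or.inl h1),
      (iff l1 l2).mpr (Or.inr h2)⟩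
    intro e
    rw [← e] at h2
    exact lt_irrefl _ (h2.lt_low hA h1)
  refine SimpleGraph.isTree_of_parent _ root par
    -- A longer lowest side means a smaller rank. The root has no lowest side; it gets rank zero,
    -- while all other ranks are positive.
    (fun v => if v = root then 0 else n - ((x v).2 - (x v).1)) (fun v w => ⟨?_, ?_⟩) ?_
  · rintro ⟨hne, e, he, he'⟩
    obtain ⟨a, b, hab, hb, rfl⟩ := exists_vert_pair he
    rcases (iff hab hb).mp he with h | h <;> rcases (iff hab hb).mp he' with h' | h'
    · exact absurd (h.inj hA h') hne
    · exact Or.inl (step h h')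
    · exact Or.inr (step h' h)
    · exact absurd (h.inj hA h') hne
  · rintro (⟨h, rfl⟩ | ⟨h, rfl⟩)
    · exact back _ h
    · exact (back _ h).symm
  · intro v hv
    obtain ⟨h1, h2⟩ := hx v hv
    obtain ⟨l1, l2⟩ := h1.lt hA
    rw [if_neg hv]
    split_ifs with hw
    · omega
    · obtain ⟨h3, -⟩ := hx _ hw
      have := h2.lt_low hA h3
      have := h3.lt hA
      omega

/-- Odd permutations of the corners reverse the orientation, so only the cyclic ones remain. -/
lemma orient_pos_rotation {i j k i' j' k' : Fin n} (h : 0 < orient (P i) (P j) (P k))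
    (h' : 0 < orient (P i') (P j') (P k'))
    (e : ({i', j', k'} : Finset (Fin n)) = {i, j, k}) :
    (i' = i ∧ j' = j ∧ k' = k) ∨ (i' = j ∧ j' = k ∧ k' = i) ∨ (i' = k ∧ j' = i ∧ k' = j) := by
  obtain ⟨n1, n2, n3⟩ := orient_perm_ne h'
  have hi : i' = i ∨ i' = j ∨ i' = k := by
    have : i' ∈ ({i, j, k} : Finset (Fin n)) := by rw [← e]; simp
    simpa using this
  have hj : j' = i ∨ j' = j ∨ j' = k := by
    have : j' ∈ ({i, j, k} : Finset (Fin n)) := by rw [← e]; simp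
    simpa using this
  have hk : k' = i ∨ k' = j ∨ k' = k := by
    have : k' ∈ ({i, j, k} : Finset (Fin n)) := by rw [← e]; simp
    simpa using this
  have s1 : orient (P i) (P k) (P j) = -orient (P i) (P j) (P k) := by unfold orient; ring
  have s2 : orient (P j) (P i) (P k) = -orient (P i) (P j) (P k) := by unfold orient; ring
  have s3 : orient (P k) (P j) (P i) = -orient (P i) (P j) (P k) := by unfold orient; ring
  rcases hi with rfl | rfl | rfl <;> rcases hj with rfl | rfl | rfl <;>
    rcases hk with rfl | rfl | rfl <;>
    first
      | exact absurd rfl n1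
      | exact absurd rfl n2
      | exact absurd rfl n3
      | exact Or.inl ⟨rfl, rfl, rfl⟩
      | exact Or.inr (Or.inl ⟨rfl, rfl, rfl⟩)
      | exact Or.inr (Or.inr ⟨rfl, rfl, rfl⟩)
      | (exfalso; linarith)

lemma edge_mem_triangle {τ : {t : Finset (Fin n) // t ∈ T.triangles}} {i j k : Fin n}
    (e : τ.1 = {i, j, k}) (hij : i ≠ j) : s(i, j) ∈ T.nodeEdges (Sum.inl τ) := by
  refine ⟨fun h => hij (Sym2.mk_isDiag_iff.mp h), fun v hv => ?_⟩
  rw [e]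
  rcases Sym2.mem_iff.mp hv with rfl | rfl <;> simp

lemma eq_of_two_edges {τ : {t : Finset (Fin n) // t ∈ T.triangles}} {i j k : Fin n}
    (e : τ.1 = {i, j, k}) (hij : i ≠ j) (hjk : j ≠ k) (hki : k ≠ i) {w : T.DualNode}
    (h1 : s(i, j) ∈ T.nodeEdges w) (h2 : s(j, k) ∈ T.nodeEdges w) : w = Sum.inl τ := by
  rcases w with τ' | l
  · congr 1
    symm
    apply Subtype.ext
    obtain ⟨i', j', k', e', -⟩ := T.isTriangle τ'.1 τ'.2
    apply Finset.eq_of_subset_of_card_le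
    · rw [e]
      intro v hv
      simp only [Finset.mem_insert, Finset.mem_singleton] at hv
      rcases hv with rfl | rfl | rfl
      · exact h1.2 _ (by simp)
      · exact h1.2 _ (by simp)
      · exact h2.2 _ (by simp)
    · rw [e, e', Finset.card_eq_three.mpr ⟨i, j, k, hij, hki.symm, hjk, rfl⟩]
      exact Finset.card_le_three
  · exfalso
    have : s(i, j) = s(j, k) := (show s(i, j) = _ from h1).trans (show s(j, k) = _ from h2).symm
    rcases Sym2.eq_iff.mp this with ⟨e1, -⟩ | ⟨e1, -⟩
    · exact hij e1
    · exact hki e1.symm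

/-- A triangle node has one neighbour across each side, three different ones since two sides
determine the triangle, and they are permuted cyclically. A terminal node has one neighbour, on
which the identity is cyclic. -/
lemma exists_rot (hA : IsTri P.loop n 0 (n - 1) A)
    (hT : ∀ τ, τ ∈ T.triangles ↔ ∃ t ∈ A, P.triFin t = τ) (v : T.DualNode) :
    ∃ ρ : Equiv.Perm (T.dualGraph.neighborSet v), ρ.IsCycleOn Set.univ ∧
      ∀ (a : {t : Finset (Fin n) // t ∈ T.triangles}) (i j k : Fin n)
        (x y : T.dualGraph.neighborSet v), v = Sum.inl a → a.1 = {i, j, k} →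
        0 < orient (P i) (P j) (P k) → s(i, j) ∈ T.nodeEdges x.1 → s(j, k) ∈ T.nodeEdges y.1 →
        ρ x = y := by
  rcases v with τ | l
  · obtain ⟨i, j, k, e, hpos⟩ := T.isTriangle τ.1 τ.2
    obtain ⟨n1, n2, n3⟩ := orient_perm_ne hpos
    have n1 : i ≠ j := fun e => n1 (by rw [e])
    have n2 : j ≠ k := fun e => n2 (by rw [e])
    have n3 : k ≠ i := fun e => n3 (by rw [e])
    have e2 : τ.1 = {j, k, i} := by rw [e]; ext; simp; tauto
    have e3 : τ.1 = {k, i, j} := by rw [e]; ext; simp; tauto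
    have m1 := edge_mem_triangle e n1
    have m2 := edge_mem_triangle e2 n2
    have m3 := edge_mem_triangle e3 n3
    obtain ⟨a, ha, ha', ua⟩ := exists_other_node hA hT m1
    obtain ⟨b, hb, hb', ub⟩ := exists_other_node hA hT m2
    obtain ⟨c, hc, hc', uc⟩ := exists_other_node hA hT m3
    have hab : a ≠ b := by rintro rfl; exact ha (eq_of_two_edges e n1 n2 n3 ha' hb')
    have hbc : b ≠ c := by rintro rfl; exact hb (eq_of_two_edges e2 n2 n3 n1 hb' hc')
    have hca : c ≠ a := by rintro rfl; exact hc (eq_of_two_edges e3 n3 n1 n2 hc' ha')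
    have ja : T.dualGraph.Adj (Sum.inl τ) a := ⟨ha.symm, _, m1, ha'⟩
    have jb : T.dualGraph.Adj (Sum.inl τ) b := ⟨hb.symm, _, m2, hb'⟩
    have jc : T.dualGraph.Adj (Sum.inl τ) c := ⟨hc.symm, _, m3, hc'⟩
    have uni : ∀ x : T.dualGraph.neighborSet (Sum.inl τ), x = ⟨a, ja⟩ ∨ x = ⟨b, jb⟩ ∨ x = ⟨c, jc⟩ := by
      rintro ⟨x, hx, f, hf, hf'⟩
      have hx' := hx.symm
      have hd : ¬ f.IsDiag := hf.1
      have hm : ∀ v ∈ f, v ∈ τ.1 := hf.2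
      suffices x = a ∨ x = b ∨ x = c from
        this.imp Subtype.ext (Or.imp Subtype.ext Subtype.ext)
      induction f using Sym2.ind with
      | _ p q =>
      have hpq : p ≠ q := fun h => hd (Sym2.mk_isDiag_iff.mpr h)
      have hp := hm p (by simp)
      have hq := hm q (by simp)
      rw [e] at hp hq
      simp only [Finset.mem_insert, Finset.mem_singleton] at hp hq
      have f1 : s(p, q) = s(i, j) → x = a := fun h => ua x hx' (h ▸ hf')
      have f2 : s(p, q) = s(j, k) → x = b := fun h => ub x hx' (h ▸ hf')
      have f3 : s(p, q) = s(k, i) → x = c := fun h => uc x hx' (h ▸ hf')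
      rcases hp with rfl | rfl | rfl <;> rcases hq with rfl | rfl | rfl <;>
        first
          | exact absurd rfl hpq
          | exact Or.inl (f1 rfl)
          | exact Or.inl (f1 Sym2.eq_swap)
          | exact Or.inr (Or.inl (f2 rfl))
          | exact Or.inr (Or.inl (f2 Sym2.eq_swap))
          | exact Or.inr (Or.inr (f3 rfl))
          | exact Or.inr (Or.inr (f3 Sym2.eq_swap))
    have ne : ∀ {x y : T.DualNode} {hx : T.dualGraph.Adj (Sum.inl τ) x}
        {hy : T.dualGraph.Adj (Sum.inl τ) y}, x ≠ y →
        (⟨x, hx⟩ : T.dualGraph.neighborSet (Sum.inl τ)) ≠ ⟨y, hy⟩ := fun h e =>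
      h (congrArg Subtype.val e)
    obtain ⟨ρ, hρ, r1, r2, r3⟩ := exists_cycle_three (ne (hx := ja) (hy := jb) hab)
      (ne (hy := jc) hbc) (ne hca) uni
    refine ⟨ρ, hρ, ?_⟩
    rintro a' i' j' k' ⟨x, hx⟩ ⟨y, hy⟩ ea e' hpos' h1 h2
    obtain rfl : τ = a' := Sum.inl_injective ea
    have hxne := hx.1.symm
    have hyne := hy.1.symm
    rcases orient_pos_rotation hpos hpos' (e'.symm.trans e) with
      ⟨rfl, rfl, rfl⟩ | ⟨rfl, rfl, rfl⟩ | ⟨rfl, rfl, rfl⟩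
    · obtain rfl := ua x hxne h1
      obtain rfl := ub y hyne h2
      exact r1
    · obtain rfl := ub x hxne h1
      obtain rfl := uc y hyne h2
      exact r2
    · obtain rfl := uc x hxne h1
      obtain rfl := ua y hyne h2
      exact r3
  · refine ⟨1, ?_, fun a i j k x y h => by cases h⟩
    rw [Equiv.Perm.isCycleOn_one]
    have m : s(l, finRotate n l) ∈ T.nodeEdges (Sum.inr l) := rfl
    obtain ⟨w, -, -, u⟩ := exists_other_node hA hT m
    have key : ∀ x : T.dualGraph.neighborSet (Sum.inr l), x.1 = w := by
      rintro ⟨x, hx, f, hf, hf'⟩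
      obtain rfl : f = s(l, finRotate n l) := hf
      exact u x hx.symm hf'
    exact fun x _ y _ => Subtype.ext ((key x).trans (key y).symm)

lemma exists_isDirectedDual (hA : IsTri P.loop n 0 (n - 1) A)
    (hT : ∀ τ, τ ∈ T.triangles ↔ ∃ t ∈ A, P.triFin t = τ) :
    ∃ D : PartiallyDirectedPlaneTree, T.IsDirectedDual D := by
  choose ρ hρ hρ' using exists_rot hA hT
  refine ⟨{
    Node := T.DualNode
    finite := inferInstance
    graph := T.dualGraph
    isTree := dualGraph_isTree hA hT
    rot := ρ
    rot_cyclic := hρ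
    arc := fun x y => ∃ a b : {t : Finset (Fin n) // t ∈ T.triangles},
      x = Sum.inl a ∧ y = Sum.inl b ∧ T.RightReflex a.1 b.1
    arc_adj := ?_
    arc_asymm := ?_ }, Equiv.refl _, fun x y => Iff.rfl, ?_, fun x y => Iff.rfl⟩
  · rintro x y ⟨a, b, rfl, rfl, h⟩
    refine ⟨fun e => h.ne (congrArg Subtype.val (Sum.inl_injective e)), ?_⟩
    obtain ⟨p, v, w, q, ea, eb, h1, h2, -⟩ := h
    obtain ⟨-, n2, -⟩ := orient_perm_ne h1
    have n2 : v ≠ w := fun e => n2 (by rw [e])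
    refine ⟨s(v, w), edge_mem_triangle (k := p) ?_ n2, edge_mem_triangle (k := q) ?_ n2⟩
    · rw [ea]; ext; simp; tauto
    · rw [eb]; ext; simp; tauto
  · rintro x y ⟨a, b, rfl, rfl, h⟩ ⟨a', b', e1, e2, h'⟩
    obtain rfl := Sum.inl_injective e1
    obtain rfl := Sum.inl_injective e2
    exact h.asymm h'
  · intro a i j k x y hx hy e hpos h1 h2
    exact hρ' _ a i j k ⟨x, hx⟩ ⟨y, hy⟩ rfl e hpos h1 h2

end Triangulation

end SimplePolygon


/-! ### Deformations as motions -/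

lemma IsSimpleLoop.exists_isTri_top {p : ℕ → Plane} {m : ℕ} (h : IsSimpleLoop p m) :
    ∃ A, IsTri p m 0 (m - 1) A := by
  have := h.three_le
  exact h.exists_isTri (by omega) (by omega) (Or.inr (Or.inl ⟨rfl, by omega⟩))

/-- The orientation does not change during a motion, and it is the sign of the area. -/
lemma exists_sign_of_motion {p : ℝ → ℕ → Plane} {m : ℕ} (hc : ∀ k, Continuous fun t => p t k)
    (hp : ∀ t, IsSimpleLoop (p t) m) :
    ∃ ε, ∀ t, IsOrientedLoop (p t) m ε ∧ 0 < ε * area2 (p t) m := by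
  have key : ∀ t, ∃ ε, IsOrientedLoop (p t) m ε ∧ 0 < ε * area2 (p t) m := by
    intro t
    obtain ⟨ε, ho⟩ := (hp t).exists_isOrientedLoop
    obtain ⟨A, hA⟩ := (hp t).exists_isTri_top
    exact ⟨ε, ho, hA.area_pos ho⟩
  have hcont : Continuous fun t => area2 (p t) m := by
    unfold area2
    exact continuous_finsetSum _ fun k _ => continuous_cross₂ (hc k) (hc (k + 1))
  have hne : ∀ t, area2 (p t) m ≠ 0 := by
    intro t e
    obtain ⟨ε, -, h⟩ := key t
    rw [e, mul_zero] at h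
    exact lt_irrefl _ h
  -- The area is continuous in time and never zero.
  have hsign : ∀ s t, 0 < area2 (p s) m → 0 < area2 (p t) m := by
    intro s t hs
    by_contra! ht
    obtain ⟨r, hr⟩ := mem_range_of_exists_le_of_exists_ge hcont ⟨t, ht⟩ ⟨s, hs.le⟩
    exact hne r hr
  obtain ⟨ε, ho, h⟩ := key 0
  refine ⟨ε, fun t => ?_⟩
  obtain ⟨δ, ho', h'⟩ := key t
  suffices δ = ε by rw [← this]; exact ⟨ho', h'⟩
  rcases ho.sign with rfl | rfl <;> rcases ho'.sign with rfl | rfl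
  · rfl
  · have := hsign 0 t (by linarith); linarith
  · have := hsign t 0 (by linarith); linarith
  · rfl

namespace SimplePolygon

variable {n : ℕ}

lemma visible_vert_iff (P : SimplePolygon n) (a b : ℕ) :
    P.Visible (P.vert a) (P.vert b) ↔ Sees P.loop a b := by
  unfold Visible Sees; rw [P.closedRegion_eq]; rfl

lemma sees_shift_iff (P : SimplePolygon n) (s a b : ℕ) :
    Sees (fun k => P.loop (k + s)) a b ↔ P.Visible (P.vert (a + s)) (P.vert (b + s)) := by
  rw [visible_vert_iff]; unfold Sees; rw [P.isSimpleLoop.Bd_shift]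

lemma isGeneric_shift {P : SimplePolygon n} (h : IsGeneric P.loop) (s : ℕ) :
    IsGeneric fun k => P.loop (k + s) := by
  intro i j k hij hs
  rw [sees_shift_iff, visible_vert_iff] at hs
  exact h _ _ _ hij hs

lemma InGeneralPosition.isGeneric {P : SimplePolygon n} (hP : P.InGeneralPosition) :
    IsGeneric P.loop := by
  have hl := P.isSimpleLoop
  intro i j k hij hs hk
  have hne : P.vert i ≠ P.vert j := fun e => hij (by rw [loop_eq_vert, e, loop_eq_vert])
  by_cases h1 : P.vert j = finRotate n (P.vert i)
  · rw [finRotate_vert] at h1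
    rw [loop_eq_vert P j, h1, ← loop_eq_vert] at hk
    exact hl.vertex_notMem_openSegment k i hk
  by_cases h2 : P.vert i = finRotate n (P.vert j)
  · rw [finRotate_vert] at h2
    rw [loop_eq_vert P i, h2, ← loop_eq_vert, openSegment_symm] at hk
    exact hl.vertex_notMem_openSegment k j hk
  have := hP _ _ hne h1 h2 ((P.visible_vert_iff i j).mpr hs) hk
  rw [P.openRegion_eq] at this
  exact this.1 (IsSimpleLoop.vertex_mem _ k)

/-- If `k` were between `i` and `j`, the visibility edges `i k` and `i j` would overlap. -/
lemma IsDeflated.isGeneric {P : SimplePolygon n} (hP : P.IsDeflated) : IsGeneric P.loop := by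
  intro i j k hij hs hk
  obtain ⟨t, h0, h1, e⟩ := mem_openSegment_iff_smul.mp hk
  have hik : P.loop i ≠ P.loop k := by
    intro h
    rw [← h] at hk
    exact hij ((left_mem_openSegment_iff (𝕜 := ℝ)).mp hk)
  have hjk : P.loop k ≠ P.loop j := by
    intro h
    rw [h] at hk
    exact hij ((right_mem_openSegment_iff (𝕜 := ℝ)).mp hk)
  have ne : ∀ {a b : ℕ}, P.loop a ≠ P.loop b → P.vert a ≠ P.vert b := fun h e =>
    h (by rw [loop_eq_vert, e, loop_eq_vert])
  have hs' : P.Visible (P.vert i) (P.vert k) := by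
    rw [visible_vert_iff]
    exact ((convex_segment _ _).segment_subset (left_mem_segment ℝ _ _)
      (openSegment_subset_segment ℝ _ _ hk)).trans hs
  have hd := hP (P.vert i) (P.vert k) (P.vert i) (P.vert j) ⟨ne hik, hs'⟩
    ⟨ne hij, (P.visible_vert_iff i j).mpr hs⟩ (by
      intro e
      rcases Sym2.eq_iff.mp e with ⟨-, e⟩ | ⟨e, -⟩
      · exact ne hjk e
      · exact ne hij e)
  have hm : P.loop i + (1 / 2 : ℝ) • (P.loop k - P.loop i) ∈
      openSegment ℝ (P.loop i) (P.loop k) :=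
    mem_openSegment_iff_smul.mpr ⟨1 / 2, by norm_num, by norm_num, rfl⟩
  refine Set.disjoint_left.mp hd hm
    (mem_openSegment_iff_smul.mpr ⟨1 / 2 * t, by linarith, by linarith, ?_⟩)
  rw [e, add_sub_cancel_left, smul_smul]; rfl

/-- A deformation as a motion of periodic sequences, starting the enumeration at `s`. -/
noncomputable def Deformation.motion {P : SimplePolygon n} (M : P.Deformation) (s : ℕ) (t : ℝ) (k : ℕ) : Plane :=
  (M.polygonAt (Set.projIcc 0 1 zero_le_one t)).loop (k + s)

namespace Deformation

variable {P : SimplePolygon n} (M : P.Deformation)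

lemma continuous_motion (s k : ℕ) : Continuous fun t => M.motion s t k :=
  (M.continuous ((M.polygonAt 0).vert (k + s))).comp continuous_projIcc

lemma isSimpleLoop_motion (s : ℕ) (t : ℝ) : IsSimpleLoop (M.motion s t) n :=
  (M.polygonAt _).isSimpleLoop.shift s

lemma motion_zero (s : ℕ) : M.motion s 0 = fun k => P.loop (k + s) := by
  have h : M.polygonAt (Set.projIcc 0 1 zero_le_one 0) = P := by
    rw [Set.projIcc_left]; exact M.start
  funext k; unfold motion; rw [h]

lemma motion_one (s : ℕ) : M.motion s 1 = fun k => (M.polygonAt 1).loop (k + s) := by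
  have h : M.polygonAt (Set.projIcc 0 1 zero_le_one 1) = M.polygonAt 1 := by
    rw [Set.projIcc_right]; rfl
  funext k; unfold motion; rw [h]

lemma visible_mono (hM : M.IsMonotonic) {s t : unitInterval} (hst : s ≤ t) {u v : Fin n}
    (h : (M.polygonAt t).Visible u v) : (M.polygonAt s).Visible u v := by
  rcases hst.eq_or_lt with rfl | hlt
  · exact h
  · by_contra hs
    exact hM ⟨u, v, s, t, hlt, h, hs⟩

/-- Time is clamped to `[0, 1]`, so the motion rests outside this interval; clamping is monotone and
preserves the order of times. -/
lemma isMonotoneMotion (hM : M.IsMonotonic) (s : ℕ) :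
    ∃ ε, IsMonotoneMotion (M.motion s) n ε ∧ ∀ t, 0 < ε * area2 (M.motion s t) n := by
  obtain ⟨ε, h⟩ := exists_sign_of_motion (M.continuous_motion s) (M.isSimpleLoop_motion s)
  refine ⟨ε, ⟨M.continuous_motion s, fun t => (h t).1, fun t t' htt' a b hs => ?_⟩,
    fun t => (h t).2⟩
  exact ((M.polygonAt _).sees_shift_iff s a b).mpr (M.visible_mono hM
    (Set.monotone_projIcc _ htt') (((M.polygonAt _).sees_shift_iff s a b).mp hs))

/-- The area keeps its sign, so the numbering has the same sense at both ends of the deformation. -/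
lemma ccwNext_eq (hM : M.IsMonotonic) (u : Fin n) : P.ccwNext u = (M.polygonAt 1).ccwNext u := by
  obtain ⟨ε, ho, h⟩ := M.isMonotoneMotion hM 0
  have h0 := h 0
  have h1 := h 1
  rw [motion_zero] at h0
  rw [motion_one] at h1
  have : 0 < P.signedArea ↔ 0 < (M.polygonAt 1).signedArea := by
    rw [signedArea_eq, signedArea_eq]
    change 0 < ε * area2 P.loop n at h0
    change 0 < ε * area2 (M.polygonAt 1).loop n at h1
    rcases (ho.oriented 0).sign with rfl | rfl
    · constructor <;> intro <;> linarith
    · constructor <;> intro <;> linarith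
  unfold ccwNext
  simp only [this]

/-- The numbering is shifted to start at the end of edge `i`, which becomes the last edge, from
number `n - 1` to number `0`. At time 1 the vertex has a stabbed sleeve for this edge, and
`exists_sees_edge` turns it into a sight line at time 0. -/
lemma seesEdge_of_one (hP : P.InGeneralPosition) (hM : M.IsMonotonic)
    (hdef : (M.polygonAt 1).IsDeflated) {u i : Fin n}
    (h : (M.polygonAt 1).SeesEdge u i (finRotate n i)) : P.SeesEdge u i (finRotate n i) := by
  have hn := P.isSimple.three_le
  have hi := i.2
  have hu := u.2
  have e0 : ∀ Q : SimplePolygon n, Q.loop (0 + ((i : ℕ) + 1)) = Q (finRotate n i) := by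
    intro Q
    rw [zero_add, loop_succ]
    congr 2
    exact Fin.ext (Nat.mod_eq_of_lt hi)
  have e1 : ∀ Q : SimplePolygon n, Q.loop (n - 1 + ((i : ℕ) + 1)) = Q i := by
    intro Q
    rw [show n - 1 + ((i : ℕ) + 1) = i + n by omega, Q.isSimpleLoop.per, loop_val]
  obtain ⟨v, hv, hvu⟩ : ∃ v < n, (v + ((i : ℕ) + 1)) % n = u := by
    -- The number of `u` after the shift by `i + 1`.
    refine ⟨(u + (n - (i + 1))) % n, Nat.mod_lt _ (by omega), ?_⟩
    rw [Nat.mod_add_mod, show (u : ℕ) + (n - (i + 1)) + (i + 1) = u + n by omega,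
      Nat.add_mod_right, Nat.mod_eq_of_lt hu]
  have eu : ∀ Q : SimplePolygon n, Q.loop (v + ((i : ℕ) + 1)) = Q u := by
    intro Q
    rw [← Q.isSimpleLoop.mod_eq, hvu, loop_val]
  have hmid : ∀ z, z ∈ segment ℝ (P i) (P (finRotate n i)) →
      ∃ q ∈ openSegment ℝ (P i) (P (finRotate n i)), segment ℝ z q ⊆ P.closedRegion := by
    intro z hz
    have hq := midpoint_mem_openSegment (𝕜 := ℝ) (P i) (P (finRotate n i))
    refine ⟨_, hq, ((convex_segment _ _).segment_subset hz
      (openSegment_subset_segment ℝ _ _ hq)).trans ?_⟩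
    rw [P.closedRegion_eq]
    refine Set.Subset.trans ?_ Set.subset_union_left
    rw [← loop_val P i, ← e0 P, zero_add]
    exact IsSimpleLoop.edge_subset _ _
  -- The two ends of the edge see it trivially; the sleeve argument needs a vertex strictly between
  -- the numbers `0` and `n - 1`.
  rcases Nat.eq_zero_or_pos v with rfl | hv0
  · exact hmid _ (by rw [← eu P, e0]; exact right_mem_segment ℝ _ _)
  by_cases hv1 : v = n - 1
  · subst hv1
    exact hmid _ (by rw [← eu P, e1]; exact left_mem_segment ℝ _ _)
  obtain ⟨ε, ho, -⟩ := M.isMonotoneMotion hM ((i : ℕ) + 1)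
  obtain ⟨q, hq, hseg⟩ := h
  set Q := M.polygonAt 1 with hQ
  have m0 := M.motion_zero ((i : ℕ) + 1)
  have m1 := M.motion_one ((i : ℕ) + 1)
  have ho1 := ho.oriented 1
  have hgen1 : IsGeneric (M.motion (i + 1) 1) := by rw [m1]; exact isGeneric_shift hdef.isGeneric _
  have hgen0 : IsGeneric (M.motion (i + 1) 0) := by rw [m0]; exact isGeneric_shift hP.isGeneric _
  have b0 : Bd (M.motion (i + 1) 0) = Bd P.loop := by rw [m0, P.isSimpleLoop.Bd_shift]
  have b1 : Bd (M.motion (i + 1) 1) = Bd Q.loop := by rw [m1, Q.isSimpleLoop.Bd_shift]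
  have u0 : M.motion (i + 1) 0 v = P u := by rw [m0]; exact eu P
  have u1 : M.motion (i + 1) 1 v = Q u := by rw [m1]; exact eu Q
  have hq' : q ∈ openSegment ℝ (M.motion (i + 1) 1 (n - 1)) (M.motion (i + 1) 1 n) := by
    rw [ho1.per_zero, m1]
    dsimp only
    rwa [e0, e1]
  have hne : q - M.motion (i + 1) 1 v ≠ 0 := by
    intro e
    rw [sub_eq_zero.mp e] at hq'
    have := ho1.vertex_notMem_openSegment v (n - 1)
    rw [show n - 1 + 1 = n by omega] at this
    exact this hq'
  obtain ⟨K, L, R, hs, hvis, hst, hL, hR⟩ := ho1.hasSleeve_top hgen1 hv0 (by omega) hq'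
    (by rw [u1, b1, ← Q.closedRegion_eq]; exact hseg)
  obtain ⟨z, hz, hzseg⟩ := ho.exists_sees_edge hgen0 zero_le_one hs hvis hne hst hL hR
  refine ⟨z, ?_, ?_⟩
  · rw [m0] at hz
    dsimp only at hz
    rwa [e0, e1, openSegment_symm] at hz
  · rwa [u0, b0, ← P.closedRegion_eq] at hzseg

end Deformation

/-- Every simple polygon has a triangulation with a directed dual. -/
theorem exists_triangulation_isDirectedDual (P : SimplePolygon n) :
    ∃ (T : P.Triangulation) (D : PartiallyDirectedPlaneTree), T.IsDirectedDual D := by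
  obtain ⟨ε, ho⟩ := P.isSimpleLoop.exists_isOrientedLoop
  obtain ⟨A, hA⟩ := P.isSimpleLoop.exists_isTri_top
  refine ⟨P.triangulation ho hA, Triangulation.exists_isDirectedDual hA fun τ => ?_⟩
  change τ ∈ (A.map P.triFin).toFinset ↔ _
  rw [List.mem_toFinset, List.mem_map]

end SimplePolygon

theorem mainTheorem6 {n : ℕ} (P : SimplePolygon n) (hP : P.InGeneralPosition)
    (hD : ¬ ∃ D : PartiallyDirectedPlaneTree, P.IsCompatibleDirectedDual D) :
    ¬ P.IsDeflatable := by
  rintro ⟨M, hM, hdef⟩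
  obtain ⟨T, D, hTD⟩ := (M.polygonAt 1).exists_triangulation_isDirectedDual
  refine hD ⟨D, M.polygonAt 1, hdef, ⟨T, hTD⟩, Equiv.refl _, M.ccwNext_eq hM, ?_, ?_⟩
  · intro u v h
    have := M.visible_mono hM (zero_le_one (α := unitInterval)) h
    rwa [M.start] at this
  · intro u i h
    exact M.seesEdge_of_one hP hM hdef h
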